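/- Let $s>2$ and $\beta>\frac{2s-1}{s-2}$, and put $\theta=\frac{\beta(s-2)-2s+1}{\beta s+1}\in(0,1)$. For each $T\ge1$ and $1\le t\le T$ let $$Y_{t,T}=g(t/T)+V_{t,T},\qquad V_{t,T}=\phi(t/T)V_{t-1,T}+e_{t,T},$$ where, for each $T$, $e_{1,T},\dots,e_{T,T}$ are i.i.d. and independent of $V_{0,T}$, $E(e_{t,T})=0$, $E(V_{0,T})=0$ and $E(V_{0,T}^2)<\infty$. Assume: (a) $g$ and $\phi$ are twice continuously differentiable on $[0,1]$, and $\max_{[0,1]}|\phi|\le\bar\phi$ for some $0<\bar\phi<1$. (b) $\sup_{T\ge1}\sup_{1\le t\le T}E|e_{t,T}|^s<\infty$; $e_{t,T}$ has unit variance and a density $f_e$, the same for all $t,T$, with $\int|f_e(u)-f_e(u+a)|\,du\le C|a|$ for all $a\in\mathbb R$. (c) $\sup_{T\ge1}\sup_{1\le t\le T}E|V_{t,T}|^s<\infty$. (d) $K,G:\mathbb R\to\mathbb R$ are bounded, compactly supported, Lipschitz on $\mathbb R$, nonnegative and symmetric, and each is positive on a set of positive Lebesgue measure in each of $[-1,1]$,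 $[0,1]$ and $[-1,0]$. (e) $h=h_T$ and $v=v_T$ are positive, tend to $0$, satisfy $Th\to\infty$, $Tv\to\infty$, $\frac{\ln T}{T^\theta h}\to0$, $\frac{\ln T}{T^\theta v}\to0$, and $v/h\to c_v$ for some $c_v>0$. Moreover $b_T\to0$ and $b_T/v\to\infty$; put $\mathcal I_T=[b_T,1-b_T]$. Write $K_h(u)=K(u/h)/h$, $G_v(u)=G(u/v)/v$, $x_t=t/T$. The local linear estimator is $\hat g(x)=(1,0)\,S_{T,x}^{-1}D_{T,x}$ with $$S_{T,x}=\frac1T\sum_{t=1}^TK_h(x_t-x)\begin{pmatrix}1&\frac{x_t-x}h\\ \frac{x_t-x}h&\left(\frac{x_t-x}h\right)^2\end{pmatrix},\qquad D_{T,x}=\frac1T\sum_{t=1}^TY_{t,T}K_h(x_t-x)\begin{pmatrix}1\\ \frac{x_t-x}h\end{pmatrix},$$ and with the residuals $\hat V_{t,T}=Y_{t,T}-\hat g(t/T)$ the two-step local constant estimator is $$\hat\phi(x)=\frac{T^{-1}\sum_{t=2}^TG_v(x_t-x)\hat V_{t,T}\hat V_{t-1,T}}{T^{-1}\sum_{t=2}^TG_v(x_t-x)\hat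 V_{t-1,T}^2}.$$ Then $$\sup_{x\in[0,1]}|\hat g(x)-g(x)|=O(h^2)+O_p\!\left(\sqrt{\frac{\ln T}{Th}}\right),$$ that is, for all large $T$ the left side equals $B_T+R_T$ with $B_T$ deterministic, $B_T=O(h^2)$ and $R_T=O_p(\sqrt{\ln T/(Th)})$. If moreover the moment condition holds also for the products that are averaged in $\hat\phi$, that is, $\sup_{T}\sup_{2\le t\le T}E|V_{t,T}V_{t-1,T}|^s<\infty$ and $\sup_{T}\sup_{2\le t\le T}E|V_{t-1,T}^2|^s<\infty$, then $$\sup_{x\in\mathcal I_T}|\hat\phi(x)-\phi(x)|=O_p\!\left(h^2+\sqrt{\frac{\ln T}{Th}}\right).$$ -/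

import Mathlib

open MeasureTheory ProbabilityTheory Filter Topology Asymptotics
open scoped ENNReal NNReal Matrix

noncomputable section

/-- Kernel condition: `K` is bounded, some power `|K|^s` with `s > 2` is integrable, and `K` is
compactly supported and globally Lipschitz. -/
structure IsLipschitzKernel (K : ℝ → ℝ) : Prop where
  bounded : ∃ B : ℝ, ∀ u, |K u| ≤ B
  integrable_rpow : ∃ s : ℝ, 2 < s ∧ Integrable (fun u => |K u| ^ s) volume
  support_lipschitz : ∃ Λ₁ L₁ : ℝ, 1 ≤ Λ₁ ∧ 1 ≤ L₁ ∧ (∀ u, L₁ < |u| → K u = 0) ∧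
    ∀ u u', |K u - K u'| ≤ Λ₁ * |u - u'|

/-- Additional kernel regularity: `K` is nonnegative and symmetric, and the set where it is
positive has positive Lebesgue measure within each of `[-1,1]`, `[0,1]`, `[-1,0]`. -/
structure IsRegularKernel (K : ℝ → ℝ) : Prop where
  nonneg : ∀ u, 0 ≤ K u
  symm : ∀ u, K (-u) = K u
  pos_interior : 0 < volume {u ∈ Set.Icc (-1 : ℝ) 1 | 0 < K u}
  pos_left : 0 < volume {u ∈ Set.Icc (0 : ℝ) 1 | 0 < K u}
  pos_right : 0 < volume {u ∈ Set.Icc (-1 : ℝ) 0 | 0 < K u}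

/-- `K_h(u) = K(u/h)/h`. -/
def scaledKernel (K : ℝ → ℝ) (h u : ℝ) : ℝ := K (u / h) / h

/-- Design point `x_t = t/T`. -/
def designPt (T t : ℕ) : ℝ := (t : ℝ) / (T : ℝ)

/-- `s_j(x) = T⁻¹ ∑_{t=1}^T K_h(x_t - x) ((x_t - x)/h)^j`. -/
def kernelMoment (K : ℝ → ℝ) (h : ℝ) (T j : ℕ) (x : ℝ) : ℝ :=
  (1 / (T : ℝ)) * ∑ t ∈ Finset.Icc 1 T,
    scaledKernel K h (designPt T t - x) * ((designPt T t - x) / h) ^ j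

/-- `d_j(x) = T⁻¹ ∑_{t=1}^T y_t K_h(x_t - x) ((x_t - x)/h)^j`. -/
def kernelDataMoment (K : ℝ → ℝ) (h : ℝ) (T j : ℕ) (y : ℕ → ℝ) (x : ℝ) : ℝ :=
  (1 / (T : ℝ)) * ∑ t ∈ Finset.Icc 1 T,
    y t * scaledKernel K h (designPt T t - x) * ((designPt T t - x) / h) ^ j

/-- The matrix `S_{T,x}`. -/
def localLinearMatrix (K : ℝ → ℝ) (h : ℝ) (T : ℕ) (x : ℝ) : Matrix (Fin 2) (Fin 2) ℝ :=
  !![kernelMoment K h T 0 x, kernelMoment K h T 1 x;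
     kernelMoment K h T 1 x, kernelMoment K h T 2 x]

/-- The vector `D_{T,x}`. -/
def localLinearVector (K : ℝ → ℝ) (h : ℝ) (T : ℕ) (y : ℕ → ℝ) (x : ℝ) : Fin 2 → ℝ :=
  ![kernelDataMoment K h T 0 y x, kernelDataMoment K h T 1 y x]

/-- The local linear estimator `ĝ(x) = e₁ᵀ S_{T,x}⁻¹ D_{T,x}` from the observations
`y 1, …, y T`. -/
def localLinearEstimator (K : ℝ → ℝ) (h : ℝ) (T : ℕ) (y : ℕ → ℝ) (x : ℝ) : ℝ :=
  ((localLinearMatrix K h T x)⁻¹ *ᵥ localLinearVector K h T y x) 0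

/-- The residuals `V̂_t = y_t - ĝ(t/T)`. -/
def fittedResidual (K : ℝ → ℝ) (h : ℝ) (T : ℕ) (y : ℕ → ℝ) (t : ℕ) : ℝ :=
  y t - localLinearEstimator K h T y (designPt T t)

/-- The two-step local constant estimator
`φ̂(x) = (T⁻¹ ∑_{t=2}^T G_v(x_t - x) V̂_t V̂_{t-1}) / (T⁻¹ ∑_{t=2}^T G_v(x_t - x) V̂_{t-1}²)`. -/
def arEstimator (K G : ℝ → ℝ) (h v : ℝ) (T : ℕ) (y : ℕ → ℝ) (x : ℝ) : ℝ :=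
  ((1 / (T : ℝ)) * ∑ t ∈ Finset.Icc 2 T, scaledKernel G v (designPt T t - x) *
      (fittedResidual K h T y t * fittedResidual K h T y (t - 1))) /
    ((1 / (T : ℝ)) * ∑ t ∈ Finset.Icc 2 T, scaledKernel G v (designPt T t - x) *
      fittedResidual K h T y (t - 1) ^ 2)

/-- The regression model with time-varying AR(1) errors. Arrays are indexed as `Y T t`;
`V T 0` is the initial value, `e T 1, …, e T T` are i.i.d., centred and independent of `V T 0`. -/
structure IsTimeVaryingARModel {Ω : Type*} [MeasurableSpace Ω] (P : Measure Ω)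
    (g φ : ℝ → ℝ) (Y V e : ℕ → ℕ → Ω → ℝ) : Prop where
  observation : ∀ T ≥ 1, ∀ t ∈ Finset.Icc 1 T, ∀ ω, Y T t ω = g (designPt T t) + V T t ω
  autoregression : ∀ T ≥ 1, ∀ t ∈ Finset.Icc 1 T, ∀ ω,
    V T t ω = φ (designPt T t) * V T (t - 1) ω + e T t ω
  measurable_init : ∀ T ≥ 1, Measurable (V T 0)
  measurable_noise : ∀ T ≥ 1, ∀ t ∈ Finset.Icc 1 T, Measurable (e T t)
  noise_indep : ∀ T ≥ 1, iIndepFun (fun t : Finset.Icc 1 T => e T t) P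
  noise_ident : ∀ T ≥ 1, ∀ t ∈ Finset.Icc 1 T, IdentDistrib (e T t) (e T 1) P P
  noise_indep_init : ∀ T ≥ 1,
    IndepFun (V T 0) (fun ω => fun t : Finset.Icc 1 T => e T t ω) P
  noise_mean : ∀ T ≥ 1, ∀ t ∈ Finset.Icc 1 T, ∫ ω, e T t ω ∂P = 0
  init_sq : ∀ T ≥ 1, MemLp (V T 0) 2 P
  init_mean : ∀ T ≥ 1, ∫ ω, V T 0 ω ∂P = 0

/-- `sup_{T ≥ 1} sup_{t₀ ≤ t ≤ T} E|X_{t,T}|^s < ∞`. -/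
def UniformMomentBound {Ω : Type*} [MeasurableSpace Ω] (P : Measure Ω) (s : ℝ) (t₀ : ℕ)
    (X : ℕ → ℕ → Ω → ℝ) : Prop :=
  ∃ C : ℝ≥0, ∀ T ≥ 1, ∀ t ∈ Finset.Icc t₀ T, ∫⁻ ω, ‖X T t ω‖ₑ ^ s ∂P ≤ C

/-- Conditions on the autoregressive part: `|φ| ≤ φ̄ < 1`, bounded `s`-th moments of the noise,
unit variance, and a density that is `L¹`-Lipschitz under translations. -/
structure AutoregressiveConditions {Ω : Type*} [MeasurableSpace Ω] (P : Measure Ω)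
    (φ : ℝ → ℝ) (e : ℕ → ℕ → Ω → ℝ) (s : ℝ) : Prop where
  coeff_bound : ∃ φbar : ℝ, 0 < φbar ∧ φbar < 1 ∧ ∀ u ∈ Set.Icc (0 : ℝ) 1, |φ u| ≤ φbar
  noise_moment : UniformMomentBound P s 1 e
  noise_variance : ∀ T ≥ 1, ∀ t ∈ Finset.Icc 1 T, variance (e T t) P = 1
  noise_density : ∃ f : ℝ → ℝ, Measurable f ∧ (∀ u, 0 ≤ f u) ∧
    (∀ T ≥ 1, ∀ t ∈ Finset.Icc 1 T,
      P.map (e T t) = volume.withDensity (fun u => ENNReal.ofReal (f u))) ∧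
    ∃ C : ℝ, ∀ a : ℝ, ∫ u, |f u - f (u + a)| ≤ C * |a|

/-- The exponent `θ = (β(s-2) - 2s + 1)/(βs + 1)` of the bandwidth condition (for data that do
not depend on a parameter, i.e. parameter dimension `0`). -/
def bandwidthExponent (β s : ℝ) : ℝ := (β * (s - 2) - 2 * s + 1) / (β * s + 1)

/-- A bandwidth sequence: positive, `h → 0`, `T h → ∞`, and `ln T / (T^θ h) → 0`. -/
structure IsBandwidth (θ : ℝ) (h : ℕ → ℝ) : Prop where
  pos : ∀ T ≥ 1, 0 < h T
  tendsto_zero : Tendsto h atTop (𝓝 0)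
  tendsto_mul : Tendsto (fun T : ℕ => (T : ℝ) * h T) atTop atTop
  rate : Tendsto (fun T : ℕ => Real.log T / ((T : ℝ) ^ θ * h T)) atTop (𝓝 0)

/-- `√(ln T / (T h))`. -/
def stochasticRate (h : ℕ → ℝ) (T : ℕ) : ℝ := Real.sqrt (Real.log T / ((T : ℝ) * h T))

/-- `sup_{x ∈ S} |f x - f₀ x|` as an extended nonnegative real. -/
def supError (S : Set ℝ) (f f₀ : ℝ → ℝ) : ℝ≥0∞ := ⨆ x ∈ S, ‖f x - f₀ x‖ₑ

/-- `X_T = O_p(r_T)` for nonnegative `X_T` and a nonnegative deterministic sequence `r_T`. -/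
def IsBigOInProb {Ω : Type*} [MeasurableSpace Ω] (P : Measure Ω) (X : ℕ → Ω → ℝ≥0∞)
    (r : ℕ → ℝ) : Prop :=
  ∀ ε : ℝ, 0 < ε → ∃ M : ℝ, 0 < M ∧
    ∀ᶠ T in atTop, P {ω | ENNReal.ofReal (M * r T) < X T ω} ≤ ENNReal.ofReal ε

end

/-!
The argument rests on the linear structure of the autoregression: weighted sums of the states are
weighted sums of the innovations.

*Reduction to martingale transforms.* If `Q_t = a_t Q_{t-1} + ξ_t` with `|a_t| ≤ q < 1`, then
`∑ w_t Q_t = (Lw)_1 Q_1 + ∑_{i ≥ 2} (Lw)_i ξ_i` with the transferred weights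
`(Lw)_i = ∑_{t ≥ i} w_t ∏_{i < r ≤ t} a_r` (`sum_mul_eq_arTransfer`), and kernel weights stay kernel
weights under this transfer (`IsWeightArray.arTransfer`). With `ξ = e`, with `ξ = 2φeV + (e² - 1)`
for the centred squares of `V`, and for the products `V_{t-1} e_t` themselves, every stochastic term
becomes a sum `∑ c_i(x) A_i X_i` in which `A_i` depends on the past and `X_i` is a centred function
of the present innovation, independent of the past.

*Uniform rate.* Such a sum is `O_p(√(log T / (T h)))` uniformly in `x ∈ [0,1]`
(`uniformBigOInProb_sum`): truncate `A_i` and `X_i` at powers of `T` determined by their moments,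
apply an exponential inequality for martingale transforms (`measure_lt_sum_le_exp`) with the
quadratic variation `∑ |c_i| A_i² = O_p(1)` at each point of a grid of `T⁴` points, and pass to all
`x` by the Lipschitz property of the weights. The truncation is affordable since the bandwidth
exponent satisfies `θ ≤ 1 - 2/s` (`bandwidthExponent_le`). The bound `∑ w_t V_t² = O_p(1)` comes from
dominating `V_t²` by the autoregression `q V_{t-1}² + e_t² / (1 - q)`.

*First step.* The local linear estimator is linear in the data and reproduces affine functions.
The determinant of its matrix is bounded below because the kernel is bounded below on intervals on
both sides of the origin, one of which is always inside the sample; Taylor expansion gives the bias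
`O(h²)` and the uniform rate gives the stochastic part.

*Second step.* With `ĝ - g = δ`, the error `φ̂(x) - φ(x)` is a quotient whose numerator consists of
`∑ w_t V_{t-1} e_t`, of `∑ w_t (φ(x_t) - φ(x)) V_{t-1}²`, and of terms of order `δ`
(`abs_ratio_sub_le`). In the middle sum `V_{t-1}²` is replaced by its mean, which is close to
`1 / (1 - φ²)` (`exists_secondMoment_approx`); in the interior the first-order term then cancels by
symmetry of the kernel (`IsCompactLipschitz.exists_abs_sum_odd_le`), leaving order `v²`. The
denominator is bounded below since `E V_t² ≥ 1` for `t ≥ 2`.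
-/

/-! ### Independence of the past and an exponential inequality -/

theorem indep_sup_left_of_indep_sup_right {Ω : Type*} {mΩ : MeasurableSpace Ω} {P : Measure Ω}
    [IsProbabilityMeasure P] {m₁ m₂ m₃ : MeasurableSpace Ω} (h₁ : m₁ ≤ mΩ) (h₂ : m₂ ≤ mΩ)
    (h₃ : m₃ ≤ mΩ) (h : Indep m₁ (m₂ ⊔ m₃) P) (h' : Indep m₂ m₃ P) :
    Indep (m₁ ⊔ m₂) m₃ P := by
  -- the intersections `a ∩ b` form a pi-system generating `m₁ ⊔ m₂`
  have hgen : m₁ ⊔ m₂ = MeasurableSpace.generateFrom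
      {s | ∃ a b, MeasurableSet[m₁] a ∧ MeasurableSet[m₂] b ∧ a ∩ b = s} := by
    apply le_antisymm
    · refine sup_le (fun a ha => ?_) (fun b hb => ?_)
      · exact MeasurableSpace.measurableSet_generateFrom
          ⟨a, Set.univ, ha, MeasurableSet.univ, Set.inter_univ _⟩
      · exact MeasurableSpace.measurableSet_generateFrom
          ⟨Set.univ, b, MeasurableSet.univ, hb, Set.univ_inter _⟩
    · refine MeasurableSpace.generateFrom_le ?_
      rintro s ⟨a, b, ha, hb, rfl⟩
      exact MeasurableSet.inter ((le_sup_left : m₁ ≤ m₁ ⊔ m₂) a ha)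
        ((le_sup_right : m₂ ≤ m₁ ⊔ m₂) b hb)
  refine IndepSets.indep (sup_le h₁ h₂) h₃ ?_ (@MeasurableSpace.isPiSystem_measurableSet _ m₃)
    hgen (@MeasurableSpace.generateFrom_measurableSet _ m₃).symm ?_
  · rintro s ⟨a, b, ha, hb, rfl⟩ t ⟨a', b', ha', hb', rfl⟩ -
    exact ⟨a ∩ a', b ∩ b', MeasurableSet.inter ha ha', MeasurableSet.inter hb hb', by
      ext; simp only [Set.mem_inter_iff]; tauto⟩
  · rw [IndepSets_iff]
    rintro s c ⟨a, b, ha, hb, rfl⟩ hc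
    rw [Indep_iff] at h h'
    have hbc : MeasurableSet[m₂ ⊔ m₃] (b ∩ c) :=
      MeasurableSet.inter ((le_sup_left : m₂ ≤ m₂ ⊔ m₃) b hb) ((le_sup_right : m₃ ≤ m₂ ⊔ m₃) c hc)
    rw [Set.inter_assoc, h a _ ha hbc, h' b c hb hc,
      h a b ha ((le_sup_left : m₂ ≤ m₂ ⊔ m₃) b hb), mul_assoc]

theorem integral_mul_of_indep {Ω : Type*} {m mΩ : MeasurableSpace Ω} {P : Measure Ω}
    (hm : m ≤ mΩ) {W X : Ω → ℝ} (hW : Measurable[m] W) (hX : Measurable X)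
    (hind : Indep (MeasurableSpace.comap X inferInstance) m P) :
    ∫ ω, W ω * X ω ∂P = (∫ ω, W ω ∂P) * ∫ ω, X ω ∂P := by
  have : IndepFun W X P := by
    rw [IndepFun_iff_Indep]
    exact indep_of_indep_of_le_left hind.symm hW.comap_le
  exact this.integral_mul_eq_mul_integral (hW.mono hm le_rfl).aestronglyMeasurable
    hX.aestronglyMeasurable

theorem exp_le_one_add_self_add_sq {x : ℝ} (hx : |x| ≤ 1) : Real.exp x ≤ 1 + x + x ^ 2 := by
  have := (abs_le.1 (Real.abs_exp_sub_one_sub_id_le hx)).2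
  linarith

theorem integrable_of_measurable_of_abs_le {Ω : Type*} [MeasurableSpace Ω] {P : Measure Ω}
    [IsFiniteMeasure P] {f : Ω → ℝ} (hf : Measurable f) (C : ℝ) (hC : ∀ ω, |f ω| ≤ C) :
    Integrable f P :=
  Integrable.of_bound hf.aestronglyMeasurable C (Eventually.of_forall hC)

/-- Exponential supermartingale bound for a martingale transform: the `X i` are independent of
the past `F (i - 1)`, centred with second moment at most `σ2`, and the multipliers `a i` are
predictable. -/
theorem integral_exp_sum_le_one {Ω : Type*} {mΩ : MeasurableSpace Ω} {P : Measure Ω}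
    [IsProbabilityMeasure P] {F : ℕ → MeasurableSpace Ω} (hF : ∀ i, F i ≤ mΩ) (hmono : Monotone F)
    {X a : ℕ → Ω → ℝ} {B σ2 : ℝ} {T : ℕ}
    (hX : ∀ i ∈ Finset.Icc 2 T, Measurable[F i] (X i))
    (hind : ∀ i ∈ Finset.Icc 2 T,
      Indep (MeasurableSpace.comap (X i) inferInstance) (F (i - 1)) P)
    (hmean : ∀ i ∈ Finset.Icc 2 T, ∫ ω, X i ω ∂P = 0)
    (hXB : ∀ i ∈ Finset.Icc 2 T, ∀ ω, |X i ω| ≤ B)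
    (hvar : ∀ i ∈ Finset.Icc 2 T, ∫ ω, X i ω ^ 2 ∂P ≤ σ2)
    (ha : ∀ i ∈ Finset.Icc 2 T, Measurable[F (i - 1)] (a i))
    (haB : ∀ i ∈ Finset.Icc 2 T, ∀ ω, |a i ω| ≤ B)
    (hprod : ∀ i ∈ Finset.Icc 2 T, ∀ ω, |a i ω * X i ω| ≤ 1) (hσ : 0 ≤ σ2) :
    Integrable (fun ω => Real.exp (∑ i ∈ Finset.Icc 2 T, (a i ω * X i ω - σ2 * a i ω ^ 2))) P ∧
    ∫ ω, Real.exp (∑ i ∈ Finset.Icc 2 T, (a i ω * X i ω - σ2 * a i ω ^ 2)) ∂P ≤ 1 := by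
  suffices H : ∀ n, n ≤ T →
      (Measurable[F n] fun ω =>
        Real.exp (∑ i ∈ Finset.Icc 2 n, (a i ω * X i ω - σ2 * a i ω ^ 2))) ∧
      (∃ D, ∀ ω, |Real.exp (∑ i ∈ Finset.Icc 2 n, (a i ω * X i ω - σ2 * a i ω ^ 2))| ≤ D) ∧
      ∫ ω, Real.exp (∑ i ∈ Finset.Icc 2 n, (a i ω * X i ω - σ2 * a i ω ^ 2)) ∂P ≤ 1 by
    obtain ⟨h1, ⟨D, h2⟩, h3⟩ := H T le_rfl
    exact ⟨integrable_of_measurable_of_abs_le (h1.mono (hF T) le_rfl) D h2, h3⟩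
  intro n
  induction n with
  | zero => intro _; exact ⟨by simp, ⟨1, by simp⟩, by simp⟩
  | succ n ih =>
    intro hn
    obtain ⟨ihm, ⟨D, ihD⟩, ihle⟩ := ih (by omega)
    by_cases h2 : n + 1 < 2
    · rw [Finset.Icc_eq_empty (by omega)]
      exact ⟨by simp, ⟨1, by simp⟩, by simp⟩
    have hi : n + 1 ∈ Finset.Icc 2 T := Finset.mem_Icc.2 ⟨by omega, hn⟩
    have hXm := hX _ hi
    have ham : Measurable[F n] (a (n + 1)) := ha _ hi
    have hXi := hind _ hi
    simp only [Nat.add_sub_cancel] at hXi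
    have hXmΩ : Measurable (X (n + 1)) := hXm.mono (hF _) le_rfl
    have hamΩ : Measurable (a (n + 1)) := ham.mono (hF _) le_rfl
    simp only [Finset.sum_Icc_succ_top (show 2 ≤ n + 1 by omega), Real.exp_add]
    set W : Ω → ℝ := fun ω =>
      Real.exp (∑ i ∈ Finset.Icc 2 n, (a i ω * X i ω - σ2 * a i ω ^ 2)) with hW
    set x := X (n + 1) with hx
    set A := a (n + 1) with hA
    have hWpos : ∀ ω, 0 < W ω := fun ω => Real.exp_pos _
    have hWD : ∀ ω, W ω ≤ D := fun ω => (le_abs_self _).trans (ihD ω)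
    have hWmΩ : Measurable W := ihm.mono (hF _) le_rfl
    have hmeas : Measurable fun ω => W ω * Real.exp (A ω * x ω - σ2 * A ω ^ 2) := by fun_prop
    have hfac : ∀ ω, Real.exp (A ω * x ω - σ2 * A ω ^ 2) ≤ Real.exp 1 := by
      intro ω
      apply Real.exp_le_exp.2
      have h1 := (abs_le.1 (hprod _ hi ω)).2
      have h3 : 0 ≤ σ2 * A ω ^ 2 := by positivity
      linarith
    refine ⟨?_, ⟨D * Real.exp 1, fun ω => ?_⟩, ?_⟩
    · have hmle : F n ≤ F (n + 1) := hmono (Nat.le_succ n)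
      have h1 : Measurable[F (n + 1)] W := ihm.mono hmle le_rfl
      have h3 : Measurable[F (n + 1)] A := ham.mono hmle le_rfl
      exact h1.mul (Real.measurable_exp.comp ((h3.mul hXm).sub ((h3.pow_const 2).const_mul σ2)))
    · rw [abs_of_pos (mul_pos (hWpos ω) (Real.exp_pos _))]
      exact mul_le_mul (hWD ω) (hfac ω) (Real.exp_pos _).le ((hWpos ω).le.trans (hWD ω))
    · -- `exp y ≤ 1 + y + y²` and the independence of `x` from `W'` and `A`; the linear term vanishes
      -- and the quadratic one is absorbed by the factor `exp (σ2 * A²)`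
      set W' : Ω → ℝ := fun ω => W ω * Real.exp (-(σ2 * A ω ^ 2)) with hW'
      have hW'm : Measurable[F n] W' :=
        ihm.mul (Real.measurable_exp.comp ((ham.pow_const 2).const_mul σ2).neg)
      have hW'mΩ : Measurable W' := hW'm.mono (hF _) le_rfl
      have hW'pos : ∀ ω, 0 < W' ω := fun ω => mul_pos (hWpos ω) (Real.exp_pos _)
      have hW'D : ∀ ω, |W' ω| ≤ D := by
        intro ω
        rw [abs_of_pos (hW'pos ω)]
        refine le_trans ?_ (hWD ω)
        refine mul_le_of_le_one_right (hWpos ω).le (Real.exp_le_one_iff.2 ?_)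
        have h3 : 0 ≤ σ2 * A ω ^ 2 := by positivity
        linarith
      have hAB := haB _ hi
      have hxB := hXB _ hi
      have hD0 : ∀ ω : Ω, 0 ≤ D := fun ω => (abs_nonneg _).trans (hW'D ω)
      have hB0 : ∀ ω : Ω, 0 ≤ B := fun ω => (abs_nonneg _).trans (hAB ω)
      have i1 : Integrable W' P := integrable_of_measurable_of_abs_le hW'mΩ D hW'D
      have i2 : Integrable (fun ω => W' ω * A ω * x ω) P := by
        refine integrable_of_measurable_of_abs_le (by fun_prop) (D * B * B) fun ω => ?_
        rw [abs_mul, abs_mul]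
        exact mul_le_mul (mul_le_mul (hW'D ω) (hAB ω) (abs_nonneg _) (hD0 ω)) (hxB ω)
          (abs_nonneg _) (mul_nonneg (hD0 ω) (hB0 ω))
      have i3 : Integrable (fun ω => W' ω * A ω ^ 2 * x ω ^ 2) P := by
        refine integrable_of_measurable_of_abs_le (by fun_prop) (D * B ^ 2 * B ^ 2) fun ω => ?_
        rw [abs_mul, abs_mul, abs_pow, abs_pow]
        have hb := hB0 ω
        have hd := hD0 ω
        gcongr
        · exact hW'D ω
        · exact hAB ω
        · exact hxB ω
      have i4 : Integrable (fun ω => W' ω * A ω ^ 2) P := by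
        refine integrable_of_measurable_of_abs_le (by fun_prop) (D * B ^ 2) fun ω => ?_
        rw [abs_mul, abs_pow]
        have hb := hB0 ω
        have hd := hD0 ω
        gcongr
        · exact hW'D ω
        · exact hAB ω
      have iW : Integrable W P := integrable_of_measurable_of_abs_le hWmΩ D ihD
      have e2 : ∫ ω, W' ω * A ω * x ω ∂P = 0 := by
        have h1 := integral_mul_of_indep (hF n) (hW'm.mul ham) hXmΩ hXi
        rw [hmean _ hi, mul_zero] at h1
        exact h1
      have e3 : ∫ ω, W' ω * A ω ^ 2 * x ω ^ 2 ∂P =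
          (∫ ω, W' ω * A ω ^ 2 ∂P) * ∫ ω, x ω ^ 2 ∂P := by
        refine integral_mul_of_indep (hF n) (hW'm.mul (ham.pow_const 2)) (hXmΩ.pow_const 2) ?_
        refine indep_of_indep_of_le_left hXi ?_
        exact Measurable.comap_le
          ((measurable_id.pow_const 2).comp (comap_measurable (X (n + 1))))
      calc ∫ ω, W ω * Real.exp (A ω * x ω - σ2 * A ω ^ 2) ∂P
          ≤ ∫ ω, (W' ω + W' ω * A ω * x ω + W' ω * A ω ^ 2 * x ω ^ 2) ∂P := by
            refine integral_mono (integrable_of_measurable_of_abs_le hmeas (D * Real.exp 1)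
              fun ω => ?_) ((i1.add i2).add i3) fun ω => ?_
            · rw [abs_of_pos (mul_pos (hWpos ω) (Real.exp_pos _))]
              exact mul_le_mul (hWD ω) (hfac ω) (Real.exp_pos _).le ((hWpos ω).le.trans (hWD ω))
            · have h1 := exp_le_one_add_self_add_sq (hprod _ hi ω)
              have h3 : W ω * Real.exp (A ω * x ω - σ2 * A ω ^ 2) =
                  W' ω * Real.exp (A ω * x ω) := by
                have h4 : Real.exp (A ω * x ω - σ2 * A ω ^ 2) =
                    Real.exp (-(σ2 * A ω ^ 2)) * Real.exp (A ω * x ω) := by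
                  rw [← Real.exp_add]
                  congr 1
                  ring
                rw [h4, ← mul_assoc]
              simp only
              rw [h3]
              calc W' ω * Real.exp (A ω * x ω)
                  ≤ W' ω * (1 + A ω * x ω + (A ω * x ω) ^ 2) :=
                    mul_le_mul_of_nonneg_left h1 (hW'pos ω).le
                _ = _ := by ring
        _ = ∫ ω, W' ω ∂P + (∫ ω, W' ω * A ω ^ 2 ∂P) * ∫ ω, x ω ^ 2 ∂P := by
            have h1 := integral_add (i1.add i2) i3
            have h3 := integral_add i1 i2
            rw [e2, add_zero] at h3
            rw [e3] at h1
            simp only [Pi.add_apply] at h1 h3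
            rw [h1, h3]
        _ ≤ ∫ ω, W' ω ∂P + (∫ ω, W' ω * A ω ^ 2 ∂P) * σ2 := by
            refine add_le_add le_rfl (mul_le_mul_of_nonneg_left (hvar _ hi) ?_)
            exact integral_nonneg fun ω => mul_nonneg (hW'pos ω).le (sq_nonneg (A ω))
        _ = ∫ ω, (W' ω + W' ω * A ω ^ 2 * σ2) ∂P := by
            rw [integral_add i1 (i4.mul_const _), integral_mul_const]
        _ ≤ ∫ ω, W ω ∂P := by
            refine integral_mono (i1.add (i4.mul_const _)) iW fun ω => ?_
            have h1 := Real.add_one_le_exp (σ2 * A ω ^ 2)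
            calc W' ω + W' ω * A ω ^ 2 * σ2 = W' ω * (σ2 * A ω ^ 2 + 1) := by ring
              _ ≤ W' ω * Real.exp (σ2 * A ω ^ 2) := mul_le_mul_of_nonneg_left h1 (hW'pos ω).le
              _ = W ω := by
                have h4 : Real.exp (-(σ2 * A ω ^ 2)) * Real.exp (σ2 * A ω ^ 2) = 1 := by
                  rw [← Real.exp_add, neg_add_cancel, Real.exp_zero]
                change W ω * _ * _ = W ω
                rw [mul_assoc, h4, mul_one]
        _ ≤ 1 := ihle

/-- The deviation inequality that follows from `integral_exp_sum_le_one` by Markov's inequality. -/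
theorem measure_lt_sum_le_exp {Ω : Type*} {mΩ : MeasurableSpace Ω} {P : Measure Ω}
    [IsProbabilityMeasure P] {F : ℕ → MeasurableSpace Ω} (hF : ∀ i, F i ≤ mΩ) (hmono : Monotone F)
    {X a : ℕ → Ω → ℝ} {B σ2 : ℝ} {T : ℕ}
    (hX : ∀ i ∈ Finset.Icc 2 T, Measurable[F i] (X i))
    (hind : ∀ i ∈ Finset.Icc 2 T,
      Indep (MeasurableSpace.comap (X i) inferInstance) (F (i - 1)) P)
    (hmean : ∀ i ∈ Finset.Icc 2 T, ∫ ω, X i ω ∂P = 0)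
    (hXB : ∀ i ∈ Finset.Icc 2 T, ∀ ω, |X i ω| ≤ B)
    (hvar : ∀ i ∈ Finset.Icc 2 T, ∫ ω, X i ω ^ 2 ∂P ≤ σ2)
    (ha : ∀ i ∈ Finset.Icc 2 T, Measurable[F (i - 1)] (a i))
    (haB : ∀ i ∈ Finset.Icc 2 T, ∀ ω, |a i ω| ≤ B)
    (hprod : ∀ i ∈ Finset.Icc 2 T, ∀ ω, |a i ω * X i ω| ≤ 1) (hσ : 0 ≤ σ2) (u : ℝ) :
    P {ω | u + σ2 * ∑ i ∈ Finset.Icc 2 T, a i ω ^ 2 < |∑ i ∈ Finset.Icc 2 T, a i ω * X i ω|}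
      ≤ ENNReal.ofReal (2 * Real.exp (-u)) := by
  have key : ∀ a : ℕ → Ω → ℝ, (∀ i ∈ Finset.Icc 2 T, Measurable[F (i - 1)] (a i)) →
      (∀ i ∈ Finset.Icc 2 T, ∀ ω, |a i ω| ≤ B) →
      (∀ i ∈ Finset.Icc 2 T, ∀ ω, |a i ω * X i ω| ≤ 1) →
      P {ω | u ≤ ∑ i ∈ Finset.Icc 2 T, (a i ω * X i ω - σ2 * a i ω ^ 2)}
        ≤ ENNReal.ofReal (Real.exp (-u)) := by
    intro a ha haB hprod
    obtain ⟨hint, hle⟩ := integral_exp_sum_le_one hF hmono hX hind hmean hXB hvar ha haB hprod hσ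
    set f : Ω → ℝ := fun ω =>
      Real.exp (∑ i ∈ Finset.Icc 2 T, (a i ω * X i ω - σ2 * a i ω ^ 2)) with hf
    have h0 : 0 ≤ᵐ[P] f := Eventually.of_forall fun ω => (Real.exp_pos _).le
    have hmk := mul_meas_ge_le_integral_of_nonneg h0 hint (Real.exp u)
    have hset : {ω | u ≤ ∑ i ∈ Finset.Icc 2 T, (a i ω * X i ω - σ2 * a i ω ^ 2)} =
        {ω | Real.exp u ≤ f ω} := by
      ext ω; simp [hf]
    rw [hset, ← ENNReal.ofReal_toReal (measure_ne_top P {ω | Real.exp u ≤ f ω})]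
    apply ENNReal.ofReal_le_ofReal
    rw [Real.exp_neg, ← one_div, le_div_iff₀ (Real.exp_pos u), mul_comm]
    exact hmk.trans hle
  have hsub : {ω | u + σ2 * ∑ i ∈ Finset.Icc 2 T, a i ω ^ 2 <
      |∑ i ∈ Finset.Icc 2 T, a i ω * X i ω|} ⊆
      {ω | u ≤ ∑ i ∈ Finset.Icc 2 T, (a i ω * X i ω - σ2 * a i ω ^ 2)} ∪
      {ω | u ≤ ∑ i ∈ Finset.Icc 2 T, ((-a i ω) * X i ω - σ2 * (-a i ω) ^ 2)} := by
    intro ω hω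
    simp only [Set.mem_ofPred_eq, Set.mem_union, Finset.sum_sub_distrib, neg_mul, neg_sq,
      Finset.sum_neg_distrib, ← Finset.mul_sum] at hω ⊢
    rcases lt_abs.1 hω with h | h
    · left; linarith
    · right; linarith
  refine (measure_mono hsub).trans ((measure_union_le _ _).trans ?_)
  rw [two_mul, ENNReal.ofReal_add (Real.exp_pos _).le (Real.exp_pos _).le]
  refine add_le_add (key a ha haB hprod) (key (fun i ω => -a i ω) (fun i hi => (ha i hi).neg)
    (fun i hi ω => by rw [abs_neg]; exact haB i hi ω) fun i hi ω => ?_)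
  rw [neg_mul, abs_neg]; exact hprod i hi ω

/-! ### Moments and truncation -/

theorem integrable_rpow_of_lintegral_le {Ω : Type*} [MeasurableSpace Ω] {P : Measure Ω}
    {X : Ω → ℝ} (hX : Measurable X) {p : ℝ} (hp : 0 ≤ p) {C : ℝ≥0}
    (h : ∫⁻ ω, ‖X ω‖ₑ ^ p ∂P ≤ C) :
    Integrable (fun ω => |X ω| ^ p) P ∧ ∫ ω, |X ω| ^ p ∂P ≤ C := by
  have hnn : ∀ ω, 0 ≤ |X ω| ^ p := fun ω => Real.rpow_nonneg (abs_nonneg _) _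
  have heq : ∀ ω, ENNReal.ofReal (|X ω| ^ p) = ‖X ω‖ₑ ^ p := by
    intro ω
    rw [← ENNReal.ofReal_rpow_of_nonneg (abs_nonneg _) hp, ← Real.norm_eq_abs,
      ofReal_norm]
  have hm : Measurable fun ω => |X ω| ^ p := by fun_prop
  constructor
  · refine ⟨hm.aestronglyMeasurable, ?_⟩
    rw [hasFiniteIntegral_iff_ofReal (Eventually.of_forall hnn)]
    simp only [heq]
    exact h.trans_lt ENNReal.coe_lt_top
  · rw [integral_eq_lintegral_of_nonneg_ae (Eventually.of_forall hnn) hm.aestronglyMeasurable]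
    simp only [heq]
    exact ENNReal.toReal_le_coe_of_le_coe h

theorem abs_rpow_le_one_add_abs_rpow (x : ℝ) {q p : ℝ} (hq : 0 ≤ q) (hqp : q ≤ p) :
    |x| ^ q ≤ 1 + |x| ^ p := by
  have h0 : 0 ≤ |x| ^ p := Real.rpow_nonneg (abs_nonneg _) _
  rcases le_total |x| 1 with h | h
  · have := Real.rpow_le_one (abs_nonneg x) h hq
    linarith
  · have := Real.rpow_le_rpow_of_exponent_le h hqp
    linarith

theorem abs_le_one_add_abs_rpow (x : ℝ) {p : ℝ} (hp : 1 ≤ p) : |x| ≤ 1 + |x| ^ p := by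
  simpa using abs_rpow_le_one_add_abs_rpow x zero_le_one hp

theorem sq_le_one_add_abs_rpow (x : ℝ) {p : ℝ} (hp : 2 ≤ p) : x ^ 2 ≤ 1 + |x| ^ p := by
  have := abs_rpow_le_one_add_abs_rpow x zero_le_two hp
  rwa [Real.rpow_two, sq_abs] at this

theorem integrable_of_lintegral_rpow_le {Ω : Type*} [MeasurableSpace Ω] {P : Measure Ω}
    [IsProbabilityMeasure P] {X : Ω → ℝ} (hX : Measurable X) {p : ℝ} (hp : 1 ≤ p) {C : ℝ≥0}
    (h : ∫⁻ ω, ‖X ω‖ₑ ^ p ∂P ≤ C) : Integrable X P ∧ ∫ ω, |X ω| ∂P ≤ 1 + C := by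
  obtain ⟨hi, hle⟩ := integrable_rpow_of_lintegral_le hX (by linarith) h
  have hd : Integrable (fun ω => 1 + |X ω| ^ p) P := (integrable_const _).add hi
  have h1 : Integrable X P := by
    refine hd.mono' hX.aestronglyMeasurable (Eventually.of_forall fun ω => ?_)
    exact abs_le_one_add_abs_rpow _ hp
  refine ⟨h1, (integral_mono h1.abs hd fun ω => abs_le_one_add_abs_rpow _ hp).trans ?_⟩
  rw [integral_add (integrable_const _) hi]
  simpa using hle

theorem integrable_sq_of_lintegral_rpow_le {Ω : Type*} [MeasurableSpace Ω] {P : Measure Ω}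
    [IsProbabilityMeasure P] {X : Ω → ℝ} (hX : Measurable X) {p : ℝ} (hp : 2 ≤ p) {C : ℝ≥0}
    (h : ∫⁻ ω, ‖X ω‖ₑ ^ p ∂P ≤ C) :
    Integrable (fun ω => X ω ^ 2) P ∧ ∫ ω, X ω ^ 2 ∂P ≤ 1 + C := by
  obtain ⟨hi, hle⟩ := integrable_rpow_of_lintegral_le hX (by linarith) h
  have hd : Integrable (fun ω => 1 + |X ω| ^ p) P := (integrable_const _).add hi
  have h1 : Integrable (fun ω => X ω ^ 2) P := by
    refine hd.mono' (hX.pow_const 2).aestronglyMeasurable (Eventually.of_forall fun ω => ?_)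
    rw [Real.norm_eq_abs, abs_of_nonneg (sq_nonneg _)]
    exact sq_le_one_add_abs_rpow _ hp
  refine ⟨h1, (integral_mono h1 hd fun ω => sq_le_one_add_abs_rpow _ hp).trans ?_⟩
  rw [integral_add (integrable_const _) hi]
  simpa using hle

theorem measure_lt_abs_le {Ω : Type*} [MeasurableSpace Ω] {P : Measure Ω}
    {X : Ω → ℝ} (hX : Measurable X) {p : ℝ} (hp : 0 ≤ p) {C : ℝ≥0}
    (h : ∫⁻ ω, ‖X ω‖ₑ ^ p ∂P ≤ C) {τ : ℝ} (hτ : 0 < τ) :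
    P {ω | τ < |X ω|} ≤ ENNReal.ofReal (C / τ ^ p) := by
  have hτp : 0 < τ ^ p := Real.rpow_pos_of_pos hτ _
  have h1 : P {ω | ENNReal.ofReal (τ ^ p) ≤ ‖X ω‖ₑ ^ p} ≤
      (∫⁻ ω, ‖X ω‖ₑ ^ p ∂P) / ENNReal.ofReal (τ ^ p) :=
    meas_ge_le_lintegral_div (by fun_prop) (by simpa using hτp) ENNReal.ofReal_ne_top
  refine (measure_mono fun ω hω => ?_).trans (h1.trans ?_)
  · simp only [Set.mem_ofPred_eq] at hω ⊢
    rw [← ENNReal.ofReal_rpow_of_nonneg hτ.le hp]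
    refine ENNReal.rpow_le_rpow ?_ hp
    rw [← ofReal_norm, Real.norm_eq_abs]
    exact ENNReal.ofReal_le_ofReal hω.le
  · rw [ENNReal.ofReal_div_of_pos hτp, ENNReal.ofReal_coe_nnreal]
    gcongr

/-- Truncation at level `τ`: `x` if `|x| ≤ τ`, and `0` otherwise. -/
noncomputable def truncAt (τ x : ℝ) : ℝ := if |x| ≤ τ then x else 0

theorem measurable_truncAt (τ : ℝ) : Measurable (truncAt τ) :=
  Measurable.ite (measurableSet_le measurable_id.abs measurable_const) measurable_id
    measurable_const

theorem truncAt_of_abs_le {τ x : ℝ} (h : |x| ≤ τ) : truncAt τ x = x := if_pos h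

theorem abs_truncAt_le {τ : ℝ} (hτ : 0 ≤ τ) (x : ℝ) : |truncAt τ x| ≤ τ := by
  unfold truncAt
  split_ifs with h
  · exact h
  · simpa using hτ

theorem abs_truncAt_le_abs (τ x : ℝ) : |truncAt τ x| ≤ |x| := by
  unfold truncAt
  split_ifs with h
  · exact le_rfl
  · simp

theorem abs_sub_truncAt_le {τ : ℝ} (hτ : 0 < τ) (x : ℝ) {p : ℝ} (hp : 1 ≤ p) :
    |x - truncAt τ x| ≤ τ ^ (1 - p) * |x| ^ p := by
  unfold truncAt
  have h0 : 0 ≤ τ ^ (1 - p) * |x| ^ p := by positivity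
  split_ifs with h
  · simpa using h0
  · push Not at h
    have hx : 0 < |x| := hτ.trans h
    have h1 : |x| ^ (1 - p) ≤ τ ^ (1 - p) :=
      Real.rpow_le_rpow_of_nonpos hτ h.le (by linarith)
    calc |x - 0| = |x| ^ (1 - p) * |x| ^ p := by
          rw [← Real.rpow_add hx]; simp
      _ ≤ _ := by gcongr

/-- Truncation of a centred variable shifts its mean by at most the tail moment. -/
theorem abs_integral_truncAt_le {Ω : Type*} [MeasurableSpace Ω] {P : Measure Ω}
    [IsProbabilityMeasure P] {X : Ω → ℝ} (hX : Measurable X) {p : ℝ} (hp : 1 ≤ p) {C : ℝ≥0}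
    (h : ∫⁻ ω, ‖X ω‖ₑ ^ p ∂P ≤ C) (hmean : ∫ ω, X ω ∂P = 0) {τ : ℝ} (hτ : 0 < τ) :
    |∫ ω, truncAt τ (X ω) ∂P| ≤ C * τ ^ (1 - p) := by
  obtain ⟨hi, hle⟩ := integrable_rpow_of_lintegral_le hX (by linarith) h
  have hXi := (integrable_of_lintegral_rpow_le hX hp h).1
  have htm : Measurable fun ω => truncAt τ (X ω) := (measurable_truncAt τ).comp hX
  have hti : Integrable (fun ω => truncAt τ (X ω)) P :=
    integrable_of_measurable_of_abs_le htm τ fun ω => abs_truncAt_le hτ.le _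
  have h1 : ∫ ω, truncAt τ (X ω) ∂P = -∫ ω, (X ω - truncAt τ (X ω)) ∂P := by
    rw [integral_sub hXi hti, hmean]; ring
  rw [h1, abs_neg]
  calc |∫ ω, (X ω - truncAt τ (X ω)) ∂P| ≤ ∫ ω, |X ω - truncAt τ (X ω)| ∂P :=
        abs_integral_le_integral_abs
    _ ≤ ∫ ω, τ ^ (1 - p) * |X ω| ^ p ∂P :=
        integral_mono (hXi.sub hti).abs (hi.const_mul _) fun ω => abs_sub_truncAt_le hτ _ hp
    _ = τ ^ (1 - p) * ∫ ω, |X ω| ^ p ∂P := integral_const_mul _ _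
    _ ≤ τ ^ (1 - p) * C := by gcongr
    _ = _ := mul_comm _ _

/-! ### Uniform stochastic orders -/

/-- `sup_{x ∈ [0,1]} |Z T x| = O_p(r T)`. The exceptional sets need not be measurable: `P` is
applied to them as an outer measure. -/
def UniformBigOInProb {Ω : Type*} [MeasurableSpace Ω] (P : Measure Ω) (Z : ℕ → ℝ → Ω → ℝ)
    (r : ℕ → ℝ) : Prop :=
  ∀ ε : ℝ, 0 < ε → ∃ M : ℝ, 0 < M ∧ ∀ᶠ T in atTop,
    P {ω | ∃ x ∈ Set.Icc (0 : ℝ) 1, M * r T < |Z T x ω|} ≤ ENNReal.ofReal ε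

namespace UniformBigOInProb

variable {Ω : Type*} [MeasurableSpace Ω] {P : Measure Ω} {Z Z' : ℕ → ℝ → Ω → ℝ} {r r' : ℕ → ℝ}

theorem mono (h : UniformBigOInProb P Z r) (C : ℝ) (hC : 0 < C)
    (hZ : ∀ᶠ T in atTop, ∀ x ∈ Set.Icc (0 : ℝ) 1, ∀ ω, |Z' T x ω| ≤ C * |Z T x ω|) :
    UniformBigOInProb P Z' r := by
  intro ε hε
  obtain ⟨M, hM, hT⟩ := h ε hε
  refine ⟨C * M, by positivity, ?_⟩
  filter_upwards [hT, hZ] with T h1 h2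
  refine (measure_mono ?_).trans h1
  rintro ω ⟨x, hx, hlt⟩
  refine ⟨x, hx, ?_⟩
  have := hlt.trans_le (h2 x hx ω)
  rw [mul_assoc] at this
  exact lt_of_mul_lt_mul_left this hC.le

theorem congr (h : UniformBigOInProb P Z r)
    (hZ : ∀ᶠ T in atTop, ∀ x ∈ Set.Icc (0 : ℝ) 1, ∀ ω, Z' T x ω = Z T x ω) :
    UniformBigOInProb P Z' r := by
  refine h.mono 1 one_pos ?_
  filter_upwards [hZ] with T hT x hx ω
  rw [hT x hx ω, one_mul]

theorem rate_mono (h : UniformBigOInProb P Z r) (C : ℝ) (hC : 0 < C)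
    (hr : ∀ᶠ T in atTop, r T ≤ C * r' T) : UniformBigOInProb P Z r' := by
  intro ε hε
  obtain ⟨M, hM, hT⟩ := h ε hε
  refine ⟨M * C, by positivity, ?_⟩
  filter_upwards [hT, hr] with T h1 h2
  refine (measure_mono ?_).trans h1
  rintro ω ⟨x, hx, hlt⟩
  refine ⟨x, hx, lt_of_le_of_lt ?_ hlt⟩
  rw [mul_assoc]
  gcongr

theorem add (h : UniformBigOInProb P Z r) (h' : UniformBigOInProb P Z' r) :
    UniformBigOInProb P (fun T x ω => Z T x ω + Z' T x ω) r := by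
  intro ε hε
  obtain ⟨M, hM, hT⟩ := h (ε / 2) (by positivity)
  obtain ⟨M', hM', hT'⟩ := h' (ε / 2) (by positivity)
  refine ⟨M + M', by positivity, ?_⟩
  filter_upwards [hT, hT'] with T h1 h2
  refine (measure_mono (t := {ω | ∃ x ∈ Set.Icc (0 : ℝ) 1, M * r T < |Z T x ω|} ∪
    {ω | ∃ x ∈ Set.Icc (0 : ℝ) 1, M' * r T < |Z' T x ω|}) ?_).trans
    ((measure_union_le _ _).trans ((add_le_add h1 h2).trans ?_))
  · rintro ω ⟨x, hx, hlt⟩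
    by_contra hcon
    simp only [Set.mem_union, Set.mem_ofPred_eq, not_or, not_exists, not_and, not_lt] at hcon
    have h3 := hcon.1 x hx
    have h4 := hcon.2 x hx
    have h5 := abs_add_le (Z T x ω) (Z' T x ω)
    linarith
  · rw [← ENNReal.ofReal_add (by positivity) (by positivity), add_halves]

theorem of_bounded (C : ℝ) (hr : ∀ᶠ T in atTop, 0 ≤ r T)
    (hZ : ∀ᶠ T in atTop, ∀ x ∈ Set.Icc (0 : ℝ) 1, ∀ ω, |Z T x ω| ≤ C * r T) :
    UniformBigOInProb P Z r := by
  intro ε hε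
  refine ⟨max C 1, by positivity, ?_⟩
  filter_upwards [hZ, hr] with T h1 h2
  rw [show {ω | ∃ x ∈ Set.Icc (0 : ℝ) 1, max C 1 * r T < |Z T x ω|} = ∅ from ?_]
  · simp
  · ext ω
    simp only [Set.mem_ofPred_eq, Set.mem_empty_iff_false, iff_false, not_exists, not_and, not_lt]
    intro x hx
    exact (h1 x hx ω).trans (mul_le_mul_of_nonneg_right (le_max_left _ _) h2)

/-- A single random variable with uniformly bounded first absolute moments, times a deterministic
factor of order `r`. -/
theorem of_moment {U : ℕ → Ω → ℝ} {c : ℕ → ℝ → ℝ} (C D : ℝ) (hC : 0 < C)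
    (hr : ∀ᶠ T in atTop, 0 ≤ r T)
    (hc : ∀ᶠ T in atTop, ∀ x ∈ Set.Icc (0 : ℝ) 1, |c T x| ≤ C * r T)
    (hU : ∀ᶠ T in atTop, Integrable (U T) P ∧ ∫ ω, |U T ω| ∂P ≤ D) [IsFiniteMeasure P] :
    UniformBigOInProb P (fun T x ω => c T x * U T ω) r := by
  intro ε hε
  set M := (|D| + 1) / ε with hM
  have hMpos : 0 < M := by positivity
  refine ⟨C * M, by positivity, ?_⟩
  filter_upwards [hr, hc, hU] with T h1 h2 h3
  have hmk := mul_meas_ge_le_integral_of_nonneg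
    (Eventually.of_forall fun ω => abs_nonneg (U T ω)) h3.1.abs M
  refine (measure_mono (t := {ω | M ≤ |U T ω|}) ?_).trans ?_
  · rintro ω ⟨x, hx, hlt⟩
    rw [abs_mul] at hlt
    by_contra hcon
    simp only [Set.mem_ofPred_eq, not_le] at hcon
    have h4 : |c T x| * |U T ω| ≤ (C * r T) * M :=
      mul_le_mul (h2 x hx) hcon.le (abs_nonneg _) (mul_nonneg hC.le h1)
    linarith
  · rw [← ENNReal.ofReal_toReal (measure_ne_top P {ω | M ≤ |U T ω|})]
    apply ENNReal.ofReal_le_ofReal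
    have h5 : M * (P {ω | M ≤ |U T ω|}).toReal ≤ M * ε := by
      have h6 : M * ε = |D| + 1 := by rw [hM]; field_simp
      rw [h6]
      exact hmk.trans (h3.2.trans (by linarith [le_abs_self D]))
    exact le_of_mul_le_mul_left h5 hMpos

/-- If the rate tends to zero, the supremum is eventually below any `δ > 0`, up to small
probability. -/
theorem eventually_le (h : UniformBigOInProb P Z r) (hr : Tendsto r atTop (𝓝 0)) {ε δ : ℝ}
    (hε : 0 < ε) (hδ : 0 < δ) :
    ∀ᶠ T in atTop, P {ω | ∃ x ∈ Set.Icc (0 : ℝ) 1, δ < |Z T x ω|} ≤ ENNReal.ofReal ε := by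
  obtain ⟨M, hM, hT⟩ := h ε hε
  have h1 : ∀ᶠ T in atTop, M * r T < δ := by
    have := hr.const_mul M
    rw [mul_zero] at this
    exact this.eventually (gt_mem_nhds hδ)
  filter_upwards [hT, h1] with T h2 h3
  refine (measure_mono ?_).trans h2
  rintro ω ⟨x, hx, hlt⟩
  exact ⟨x, hx, h3.trans hlt⟩

end UniformBigOInProb

/-- Union bound for the maximum of `T` variables with uniformly bounded `p`-th moments. -/
theorem measure_exists_lt_abs_le {Ω : Type*} [MeasurableSpace Ω] {P : Measure Ω}
    {Z : ℕ → ℕ → Ω → ℝ} {p : ℝ} (hp : 0 < p) {C : ℝ≥0}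
    (hZm : ∀ T : ℕ, 1 ≤ T → ∀ i ∈ Finset.Icc 2 T, Measurable (Z T i))
    (hZ : ∀ T : ℕ, 1 ≤ T → ∀ i ∈ Finset.Icc 2 T, ∫⁻ ω, ‖Z T i ω‖ₑ ^ p ∂P ≤ C) {ε : ℝ} (hε : 0 < ε) :
    ∃ M : ℝ, 1 ≤ M ∧ ∀ T : ℕ, 1 ≤ T →
      P {ω | ∃ i ∈ Finset.Icc 2 T, M * (T : ℝ) ^ (1 / p) < |Z T i ω|} ≤ ENNReal.ofReal ε := by
  -- each variable exceeds the level with probability at most `C / (M ^ p * T)`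
  set D : ℝ := C / ε + 1 with hD
  have hD1 : 1 ≤ D := by rw [hD]; have : 0 ≤ (C : ℝ) / ε := by positivity
                         linarith
  refine ⟨D ^ (1 / p), Real.one_le_rpow hD1 (by positivity), fun T hT => ?_⟩
  have hTpos : (0 : ℝ) < T := by exact_mod_cast hT
  set τ := D ^ (1 / p) * (T : ℝ) ^ (1 / p) with hτ
  have hτpos : 0 < τ := by positivity
  have hτp : τ ^ p = D * T := by
    rw [hτ, ← Real.mul_rpow (by linarith) hTpos.le, ← Real.rpow_mul (by positivity)]
    rw [one_div, inv_mul_cancel₀ hp.ne', Real.rpow_one]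
  have hsub : {ω | ∃ i ∈ Finset.Icc 2 T, τ < |Z T i ω|} ⊆
      ⋃ i ∈ Finset.Icc 2 T, {ω | τ < |Z T i ω|} := by
    intro ω hω
    simpa using hω
  refine (measure_mono hsub).trans ((measure_biUnion_finset_le _ _).trans ?_)
  calc ∑ i ∈ Finset.Icc 2 T, P {ω | τ < |Z T i ω|}
      ≤ ∑ i ∈ Finset.Icc 2 T, ENNReal.ofReal (C / (D * T)) := by
        refine Finset.sum_le_sum fun i hi => ?_
        rw [← hτp]
        exact measure_lt_abs_le (hZm T hT i hi) hp.le (hZ T hT i hi) hτpos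
    _ ≤ T * ENNReal.ofReal (C / (D * T)) := by
        rw [Finset.sum_const, nsmul_eq_mul]
        gcongr
        simp
    _ = ENNReal.ofReal (C / D) := by
        rw [← ENNReal.ofReal_natCast, ← ENNReal.ofReal_mul hTpos.le]
        congr 1
        field_simp
    _ ≤ ENNReal.ofReal ε := by
        apply ENNReal.ofReal_le_ofReal
        rw [div_le_iff₀ (by linarith), hD, mul_add, mul_div_cancel₀ _ hε.ne']
        linarith

/-! ### Bandwidth asymptotics -/

theorem IsBandwidth.eventually_basic {θ : ℝ} {h : ℕ → ℝ} (hh : IsBandwidth θ h) :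
    ∀ᶠ T : ℕ in atTop, 3 ≤ T ∧ 1 ≤ Real.log T ∧ 0 < h T ∧ h T ≤ 1 ∧ 1 ≤ (T : ℝ) * h T := by
  have h1 : ∀ᶠ T : ℕ in atTop, 1 ≤ Real.log T :=
    (Real.tendsto_log_atTop.comp tendsto_natCast_atTop_atTop).eventually_ge_atTop 1
  filter_upwards [eventually_ge_atTop 3, h1, hh.tendsto_zero.eventually (ge_mem_nhds one_pos),
    hh.tendsto_mul.eventually_ge_atTop 1] with T a1 a2 a3 a4
  exact ⟨a1, a2, hh.pos T (by omega), a3, a4⟩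

theorem stochasticRate_nonneg (h : ℕ → ℝ) (T : ℕ) : 0 ≤ stochasticRate h T := Real.sqrt_nonneg _

theorem stochasticRate_sq {h : ℕ → ℝ} {T : ℕ} (hT : 1 ≤ T) (hh : 0 < h T) :
    stochasticRate h T ^ 2 = Real.log T / ((T : ℝ) * h T) := by
  have hT' : (1 : ℝ) ≤ T := by exact_mod_cast hT
  exact Real.sq_sqrt (div_nonneg (Real.log_nonneg hT') (by positivity))

theorem IsBandwidth.rpow_neg_half_le {θ : ℝ} {h : ℕ → ℝ} (hh : IsBandwidth θ h) :
    ∀ᶠ T : ℕ in atTop, (T : ℝ) ^ (-(1 / 2) : ℝ) ≤ stochasticRate h T := by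
  filter_upwards [hh.eventually_basic] with T ⟨h3, hlog, hpos, hle, hN⟩
  have hT : (0 : ℝ) < T := by positivity
  rw [Real.rpow_neg hT.le, ← Real.sqrt_eq_rpow, ← Real.sqrt_inv]
  apply Real.sqrt_le_sqrt
  rw [inv_eq_one_div, div_le_div_iff₀ hT (by positivity), one_mul]
  calc (T : ℝ) * h T ≤ T * 1 := by gcongr
    _ ≤ T * Real.log T := by gcongr
    _ = Real.log T * T := mul_comm _ _

theorem IsBandwidth.inv_le {θ : ℝ} {h : ℕ → ℝ} (hh : IsBandwidth θ h) :
    ∀ᶠ T : ℕ in atTop, 1 / ((T : ℝ) * h T) ≤ stochasticRate h T := by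
  filter_upwards [hh.eventually_basic] with T ⟨h3, hlog, hpos, hle, hN⟩
  apply Real.le_sqrt_of_sq_le
  rw [div_pow, one_pow, div_le_div_iff₀ (by positivity) (by positivity), one_mul, sq]
  calc (T : ℝ) * h T = 1 * (1 * (T * h T)) := by ring
    _ ≤ Real.log T * ((T * h T) * (T * h T)) := by gcongr

/-- The bandwidth condition makes the stochastic rate negligible against `T ^ (-κ)`. -/
theorem IsBandwidth.tendsto_rpow_mul_rate {θ κ : ℝ} {h : ℕ → ℝ} (hh : IsBandwidth θ h)
    (hκ : θ ≤ 1 - 2 * κ) :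
    Tendsto (fun T : ℕ => (T : ℝ) ^ κ * stochasticRate h T) atTop (𝓝 0) := by
  have h1 : Tendsto (fun T : ℕ => Real.sqrt (Real.log T / ((T : ℝ) ^ θ * h T))) atTop (𝓝 0) := by
    have := (Real.continuous_sqrt.tendsto 0).comp hh.rate
    simpa [Function.comp_def] using this
  refine tendsto_of_tendsto_of_tendsto_of_le_of_le' tendsto_const_nhds h1
    (Eventually.of_forall fun T => mul_nonneg (Real.rpow_nonneg (Nat.cast_nonneg _) _)
      (stochasticRate_nonneg h T)) ?_
  filter_upwards [hh.eventually_basic] with T ⟨h3, hlog, hpos, hle, hN⟩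
  have hT : (0 : ℝ) < T := by positivity
  have hT1 : (1 : ℝ) ≤ T := by exact_mod_cast (by omega : 1 ≤ T)
  have h2 : (T : ℝ) ^ κ = Real.sqrt ((T : ℝ) ^ (2 * κ)) := by
    rw [Real.sqrt_eq_rpow, ← Real.rpow_mul hT.le]; congr 1; ring
  rw [stochasticRate, h2, ← Real.sqrt_mul (by positivity)]
  apply Real.sqrt_le_sqrt
  rw [mul_div_assoc', div_le_div_iff₀ (by positivity) (by positivity)]
  have h4 : (T : ℝ) ^ (2 * κ) * (T : ℝ) ^ θ ≤ T := by
    rw [← Real.rpow_add hT]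
    calc (T : ℝ) ^ (2 * κ + θ) ≤ (T : ℝ) ^ (1 : ℝ) :=
          Real.rpow_le_rpow_of_exponent_le hT1 (by linarith)
      _ = T := Real.rpow_one _
  calc (T : ℝ) ^ (2 * κ) * Real.log T * ((T : ℝ) ^ θ * h T)
      = ((T : ℝ) ^ (2 * κ) * (T : ℝ) ^ θ) * (Real.log T * h T) := by ring
    _ ≤ T * (Real.log T * h T) := by gcongr
    _ = Real.log T * (T * h T) := by ring

theorem IsBandwidth.tendsto_rate {θ : ℝ} {h : ℕ → ℝ} (hh : IsBandwidth θ h) (hθ : θ ≤ 1) :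
    Tendsto (stochasticRate h) atTop (𝓝 0) := by
  simpa using hh.tendsto_rpow_mul_rate (κ := 0) (by linarith)

/-- The condition on the bandwidth exponent leaves room for truncating at the size `T ^ (1 / s)` of
the maximum of `T` variables with bounded `s`-th moments. -/
theorem bandwidthExponent_le {s β : ℝ} (hs : 2 < s) (hβ : (2 * s - 1) / (s - 2) < β) :
    bandwidthExponent β s ≤ 1 - 2 * (1 / s) := by
  have hβ0 : 0 < β := lt_of_le_of_lt (div_nonneg (by linarith) (by linarith)) hβ
  have h1 : 1 - 2 * (1 / s) = (s - 2) / s := by field_simp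
  rw [bandwidthExponent, h1, div_le_div_iff₀ (by positivity) (by linarith)]
  nlinarith

/-! ### Weight arrays -/

/-- Deterministic weights `c T i x`, `1 ≤ i ≤ T`, of local-averaging type with bandwidth `h`: each
weight is `O(1 / (T h))`, their absolute sum is `O(1)`, and they are Lipschitz in `x` with constant
`O(T)`, all uniformly in `x`. -/
def IsWeightArray (h : ℕ → ℝ) (c : ℕ → ℕ → ℝ → ℝ) : Prop :=
  ∃ C : ℝ, 0 < C ∧ ∀ᶠ T : ℕ in atTop, ∀ x : ℝ,
    (∀ i ∈ Finset.Icc 1 T, |c T i x| ≤ C / (T * h T)) ∧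
    (∑ i ∈ Finset.Icc 1 T, |c T i x| ≤ C) ∧
    ∀ x', ∀ i ∈ Finset.Icc 1 T, |c T i x - c T i x'| ≤ C * T * |x - x'|

theorem Finset.Icc_two_subset_Icc_one (T : ℕ) : Finset.Icc 2 T ⊆ Finset.Icc 1 T :=
  Finset.Icc_subset_Icc_left one_le_two

namespace IsWeightArray

variable {h : ℕ → ℝ} {c : ℕ → ℕ → ℝ → ℝ}

theorem abs (hc : IsWeightArray h c) : IsWeightArray h (fun T i x => |c T i x|) := by
  obtain ⟨C, hC, hT⟩ := hc
  refine ⟨C, hC, ?_⟩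
  filter_upwards [hT] with T h1 x
  obtain ⟨a1, a2, a3⟩ := h1 x
  refine ⟨fun i hi => by rw [abs_abs]; exact a1 i hi, by simpa only [abs_abs] using a2,
    fun x' i hi => (abs_abs_sub_abs_le _ _).trans (a3 x' i hi)⟩

theorem mul_bounded (hc : IsWeightArray h c) {b : ℕ → ℕ → ℝ} {D : ℝ} (hD : 0 < D)
    (hb : ∀ T, ∀ i ∈ Finset.Icc 1 T, |b T i| ≤ D) :
    IsWeightArray h (fun T i x => c T i x * b T i) := by
  obtain ⟨C, hC, hT⟩ := hc
  refine ⟨C * D, by positivity, ?_⟩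
  filter_upwards [hT] with T h1 x
  obtain ⟨a1, a2, a3⟩ := h1 x
  refine ⟨fun i hi => ?_, ?_, fun x' i hi => ?_⟩
  · rw [abs_mul, mul_div_right_comm]
    exact mul_le_mul (a1 i hi) (hb T i hi) (abs_nonneg _) ((abs_nonneg _).trans (a1 i hi))
  · calc ∑ i ∈ Finset.Icc 1 T, |c T i x * b T i| ≤ ∑ i ∈ Finset.Icc 1 T, |c T i x| * D := by
          refine Finset.sum_le_sum fun i hi => ?_
          rw [abs_mul]
          exact mul_le_mul_of_nonneg_left (hb T i hi) (abs_nonneg _)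
      _ ≤ C * D := by rw [← Finset.sum_mul]; gcongr
  · rw [← sub_mul, abs_mul]
    calc |c T i x - c T i x'| * |b T i| ≤ (C * T * |x - x'|) * D :=
          mul_le_mul (a3 x' i hi) (hb T i hi) (abs_nonneg _) (by positivity)
      _ = _ := by ring

/-- Weights moved by one place to the left, padded with zero. -/
theorem shift (hc : IsWeightArray h c) (hh : ∀ᶠ T in atTop, 0 < h T) :
    IsWeightArray h (fun T i x => if i + 1 ≤ T then c T (i + 1) x else 0) := by
  obtain ⟨C, hC, hT⟩ := hc
  refine ⟨C, hC, ?_⟩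
  filter_upwards [hT, hh] with T h1 hpos x
  obtain ⟨a1, a2, a3⟩ := h1 x
  refine ⟨fun i hi => ?_, ?_, fun x' i hi => ?_⟩
  · split_ifs with h2
    · exact a1 _ (Finset.mem_Icc.2 ⟨by omega, h2⟩)
    · rw [abs_zero]; positivity
  · refine le_trans ?_ a2
    calc ∑ i ∈ Finset.Icc 1 T, |if i + 1 ≤ T then c T (i + 1) x else 0|
        = ∑ i ∈ (Finset.Icc 1 T).filter (fun i => i + 1 ≤ T), |c T (i + 1) x| := by
          rw [Finset.sum_filter]
          exact Finset.sum_congr rfl fun i _ => by split_ifs <;> simp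
      _ = ∑ j ∈ ((Finset.Icc 1 T).filter (fun i => i + 1 ≤ T)).image (· + 1), |c T j x| := by
          rw [Finset.sum_image fun a _ b _ hab => by simpa using hab]
      _ ≤ ∑ i ∈ Finset.Icc 1 T, |c T i x| := by
          refine Finset.sum_le_sum_of_subset_of_nonneg ?_ fun _ _ _ => abs_nonneg _
          intro j hj
          simp only [Finset.mem_image, Finset.mem_filter, Finset.mem_Icc] at hj ⊢
          omega
  · split_ifs with h2
    · exact a3 x' _ (Finset.mem_Icc.2 ⟨by omega, h2⟩)
    · rw [sub_zero, abs_zero]; positivity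

end IsWeightArray

/-! ### Uniform rate for weighted sums with predictable multipliers -/

/-- Deviation bound on a finite set of parameters for weighted sums of bounded variables `X i`
multiplied by bounded predictable `A i`. -/
theorem measure_exists_grid_le {Ω : Type*} {mΩ : MeasurableSpace Ω} {P : Measure Ω}
    [IsProbabilityMeasure P] {F : ℕ → MeasurableSpace Ω} (hF : ∀ i, F i ≤ mΩ) (hmono : Monotone F)
    {X A : ℕ → Ω → ℝ} {c : ℕ → ℝ → ℝ} {C σ2 τX τA N ρ Q : ℝ} {T : ℕ} (G : Finset ℝ)
    (hX : ∀ i ∈ Finset.Icc 2 T, Measurable[F i] (X i))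
    (hind : ∀ i ∈ Finset.Icc 2 T,
      Indep (MeasurableSpace.comap (X i) inferInstance) (F (i - 1)) P)
    (hmean : ∀ i ∈ Finset.Icc 2 T, ∫ ω, X i ω ∂P = 0)
    (hXB : ∀ i ∈ Finset.Icc 2 T, ∀ ω, |X i ω| ≤ τX)
    (hvar : ∀ i ∈ Finset.Icc 2 T, ∫ ω, X i ω ^ 2 ∂P ≤ σ2)
    (hA : ∀ i ∈ Finset.Icc 2 T, Measurable[F (i - 1)] (A i))
    (hAB : ∀ i ∈ Finset.Icc 2 T, ∀ ω, |A i ω| ≤ τA)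
    (hc : ∀ i ∈ Finset.Icc 2 T, ∀ x, |c i x| ≤ C / N)
    (hσ : 0 ≤ σ2) (hτA : 0 ≤ τA) (hC : 0 < C) (hN : 0 < N) (hρ : 0 < ρ)
    (hsmall : ρ * C * τA * τX ≤ 1) :
    P {ω | ∃ x ∈ G, (∑ i ∈ Finset.Icc 2 T, |c i x| * A i ω ^ 2 ≤ Q) ∧
        (5 + σ2 * C * Q) * ρ < |∑ i ∈ Finset.Icc 2 T, c i x * A i ω * X i ω|}
      ≤ G.card * ENNReal.ofReal (2 * Real.exp (-(5 * N * ρ ^ 2))) := by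
  -- the exponential inequality with multipliers `l * c i x * A i`, `l = N ρ`
  set l := N * ρ with hl
  have hl0 : 0 < l := by positivity
  have hca : ∀ i ∈ Finset.Icc 2 T, ∀ x ω, |l * c i x * A i ω| ≤ ρ * C * τA := by
    intro i hi x ω
    rw [abs_mul, abs_mul, abs_of_pos hl0]
    calc l * |c i x| * |A i ω| ≤ l * (C / N) * τA := by
          gcongr
          · exact hc i hi x
          · exact hAB i hi ω
      _ = ρ * C * τA := by rw [hl]; field_simp
  have hsub : {ω | ∃ x ∈ G, (∑ i ∈ Finset.Icc 2 T, |c i x| * A i ω ^ 2 ≤ Q) ∧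
      (5 + σ2 * C * Q) * ρ < |∑ i ∈ Finset.Icc 2 T, c i x * A i ω * X i ω|} ⊆
      ⋃ x ∈ G, {ω | 5 * N * ρ ^ 2 + σ2 * ∑ i ∈ Finset.Icc 2 T, (l * c i x * A i ω) ^ 2 <
        |∑ i ∈ Finset.Icc 2 T, (l * c i x * A i ω) * X i ω|} := by
    rintro ω ⟨x, hx, hQ, hlt⟩
    simp only [Set.mem_iUnion, Set.mem_ofPred_eq, exists_prop]
    refine ⟨x, hx, ?_⟩
    have h1 : ∑ i ∈ Finset.Icc 2 T, (l * c i x * A i ω) * X i ω =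
        l * ∑ i ∈ Finset.Icc 2 T, c i x * A i ω * X i ω := by
      rw [Finset.mul_sum]
      exact Finset.sum_congr rfl fun i _ => by ring
    have h2 : ∑ i ∈ Finset.Icc 2 T, (l * c i x * A i ω) ^ 2 ≤ l ^ 2 * (C / N) * Q := by
      calc ∑ i ∈ Finset.Icc 2 T, (l * c i x * A i ω) ^ 2
          ≤ ∑ i ∈ Finset.Icc 2 T, l ^ 2 * (C / N) * (|c i x| * A i ω ^ 2) := by
            refine Finset.sum_le_sum fun i hi => ?_
            have h3 : c i x ^ 2 ≤ (C / N) * |c i x| := by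
              rw [← sq_abs, sq]
              exact mul_le_mul_of_nonneg_right (hc i hi x) (abs_nonneg _)
            calc (l * c i x * A i ω) ^ 2 = l ^ 2 * A i ω ^ 2 * c i x ^ 2 := by ring
              _ ≤ l ^ 2 * A i ω ^ 2 * ((C / N) * |c i x|) := by gcongr
              _ = _ := by ring
        _ ≤ _ := by
            rw [← Finset.mul_sum]
            gcongr
    rw [h1, abs_mul, abs_of_pos hl0]
    calc 5 * N * ρ ^ 2 + σ2 * ∑ i ∈ Finset.Icc 2 T, (l * c i x * A i ω) ^ 2
        ≤ 5 * N * ρ ^ 2 + σ2 * (l ^ 2 * (C / N) * Q) := by gcongr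
      _ = l * ((5 + σ2 * C * Q) * ρ) := by rw [hl]; field_simp
      _ < _ := by gcongr
  refine (measure_mono hsub).trans ((measure_biUnion_finset_le _ _).trans ?_)
  rw [← nsmul_eq_mul, ← Finset.sum_const]
  refine Finset.sum_le_sum fun x _ => ?_
  refine measure_lt_sum_le_exp hF hmono (B := max τX (ρ * C * τA)) hX hind hmean
    (fun i hi ω => (hXB i hi ω).trans (le_max_left _ _)) hvar
    (fun i hi => (hA i hi).const_mul _)
    (fun i hi ω => (hca i hi x ω).trans (le_max_right _ _)) (fun i hi ω => ?_) hσ _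
  rw [abs_mul]
  exact (mul_le_mul (hca i hi x ω) (hXB i hi ω) (abs_nonneg _) (by positivity)).trans hsmall

/-- Passage from a grid to all of `[0,1]`, and from truncated centred to original variables, for
one realization. -/
theorem abs_sum_le_of_grid {X A m : ℕ → ℝ} {c : ℕ → ℝ → ℝ} {C τX τA μ B : ℝ} {T : ℕ}
    {x x' δ : ℝ}
    (hX : ∀ i ∈ Finset.Icc 2 T, |X i| ≤ τX) (hA : ∀ i ∈ Finset.Icc 2 T, |A i| ≤ τA)
    (hm : ∀ i ∈ Finset.Icc 2 T, |m i| ≤ μ) (hm' : ∀ i ∈ Finset.Icc 2 T, |m i| ≤ τX)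
    (hsum : ∑ i ∈ Finset.Icc 2 T, |c i x| ≤ C)
    (hlip : ∀ i ∈ Finset.Icc 2 T, |c i x - c i x'| ≤ δ)
    (hgrid : |∑ i ∈ Finset.Icc 2 T, c i x' * A i * (X i - m i)| ≤ B)
    (hδ : 0 ≤ δ) (hτX : 0 ≤ τX) (hτA : 0 ≤ τA) (hμ : 0 ≤ μ) :
    |∑ i ∈ Finset.Icc 2 T, c i x * A i * X i| ≤ B + T * (δ * τA * (2 * τX)) + C * τA * μ := by
  have e : ∑ i ∈ Finset.Icc 2 T, c i x * A i * X i =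
      ∑ i ∈ Finset.Icc 2 T, c i x' * A i * (X i - m i) +
      ∑ i ∈ Finset.Icc 2 T, (c i x - c i x') * A i * (X i - m i) +
      ∑ i ∈ Finset.Icc 2 T, c i x * A i * m i := by
    rw [← Finset.sum_add_distrib, ← Finset.sum_add_distrib]
    exact Finset.sum_congr rfl fun i _ => by ring
  have h2 : |∑ i ∈ Finset.Icc 2 T, (c i x - c i x') * A i * (X i - m i)| ≤
      T * (δ * τA * (2 * τX)) := by
    calc |∑ i ∈ Finset.Icc 2 T, (c i x - c i x') * A i * (X i - m i)|
        ≤ ∑ i ∈ Finset.Icc 2 T, |(c i x - c i x') * A i * (X i - m i)| :=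
          Finset.abs_sum_le_sum_abs _ _
      _ ≤ ∑ i ∈ Finset.Icc 2 T, δ * τA * (2 * τX) := by
          refine Finset.sum_le_sum fun i hi => ?_
          rw [abs_mul, abs_mul]
          have h3 : |X i - m i| ≤ 2 * τX := by
            have := abs_sub (X i) (m i)
            linarith [hX i hi, hm' i hi]
          have h4 := hlip i hi
          have h5 := hA i hi
          gcongr
      _ ≤ T * (δ * τA * (2 * τX)) := by
          rw [Finset.sum_const, nsmul_eq_mul]
          gcongr
          simp
  have h3 : |∑ i ∈ Finset.Icc 2 T, c i x * A i * m i| ≤ C * τA * μ := by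
    calc |∑ i ∈ Finset.Icc 2 T, c i x * A i * m i|
        ≤ ∑ i ∈ Finset.Icc 2 T, |c i x * A i * m i| := Finset.abs_sum_le_sum_abs _ _
      _ ≤ ∑ i ∈ Finset.Icc 2 T, |c i x| * (τA * μ) := by
          refine Finset.sum_le_sum fun i hi => ?_
          rw [abs_mul, abs_mul, mul_assoc]
          have h4 := hm i hi
          have h5 := hA i hi
          gcongr
      _ ≤ C * (τA * μ) := by
          rw [← Finset.sum_mul]
          gcongr
      _ = _ := by ring
  rw [e]
  refine (abs_add_three _ _ _).trans ?_
  linarith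

theorem exists_grid_point {N : ℕ} (hN : 0 < N) {x : ℝ} (hx : x ∈ Set.Icc (0 : ℝ) 1) :
    ∃ x' ∈ (Finset.range (N + 1)).image (fun j : ℕ => (j : ℝ) / N), |x - x'| ≤ 1 / N := by
  have hN' : (0 : ℝ) < N := by exact_mod_cast hN
  have h0 : 0 ≤ x * N := mul_nonneg hx.1 hN'.le
  refine ⟨(⌊x * N⌋₊ : ℝ) / N, Finset.mem_image.2 ⟨⌊x * N⌋₊, ?_, rfl⟩, ?_⟩
  · rw [Finset.mem_range, Nat.lt_succ_iff]
    apply Nat.floor_le_of_le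
    nlinarith [hx.2]
  · have h1 := Nat.floor_le h0
    have h2 := Nat.lt_floor_add_one (x * N)
    rw [show x - (⌊x * N⌋₊ : ℝ) / N = (x * N - ⌊x * N⌋₊) / N by field_simp, abs_div,
      abs_of_pos hN']
    gcongr
    rw [abs_le]
    constructor <;> linarith

/-- The uniform rate: the `X T i` are independent of the past and centred with bounded `p`-th
moments, the multipliers `A T i` are predictable with `max_i |A T i| = O_p(T ^ b)`, and the
weighted quadratic sums of the multipliers are uniformly `O_p(1)`. Both factors are truncated at
their maximal size, and the exponential inequality is applied on a grid of `T ^ 4` points. -/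
theorem uniformBigOInProb_sum {Ω : Type*} {mΩ : MeasurableSpace Ω} {P : Measure Ω}
    [IsProbabilityMeasure P] {F : ℕ → ℕ → MeasurableSpace Ω}
    (hF : ∀ T : ℕ, 1 ≤ T → ∀ i, F T i ≤ mΩ)
    (hmono : ∀ T, Monotone (F T)) {X A : ℕ → ℕ → Ω → ℝ} {c : ℕ → ℕ → ℝ → ℝ} {h : ℕ → ℝ}
    {θ p b : ℝ} {CX : ℝ≥0}
    (hX : ∀ T : ℕ, 1 ≤ T → ∀ i ∈ Finset.Icc 2 T, Measurable[F T i] (X T i))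
    (hind : ∀ T : ℕ, 1 ≤ T → ∀ i ∈ Finset.Icc 2 T,
      Indep (MeasurableSpace.comap (X T i) inferInstance) (F T (i - 1)) P)
    (hmean : ∀ T : ℕ, 1 ≤ T → ∀ i ∈ Finset.Icc 2 T, ∫ ω, X T i ω ∂P = 0)
    (hp : 2 ≤ p)
    (hmom : ∀ T : ℕ, 1 ≤ T → ∀ i ∈ Finset.Icc 2 T, ∫⁻ ω, ‖X T i ω‖ₑ ^ p ∂P ≤ CX)
    (hA : ∀ T : ℕ, 1 ≤ T → ∀ i ∈ Finset.Icc 2 T, Measurable[F T (i - 1)] (A T i))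
    (hAtail : ∀ ε : ℝ, 0 < ε → ∃ M : ℝ, 1 ≤ M ∧ ∀ T : ℕ, 1 ≤ T →
      P {ω | ∃ i ∈ Finset.Icc 2 T, M * (T : ℝ) ^ b < |A T i ω|} ≤ ENNReal.ofReal ε)
    (hκ : 1 / p + b ≤ 1 / 2) (hθ : θ ≤ 1 - 2 * (1 / p + b))
    (hh : IsBandwidth θ h) (hc : IsWeightArray h c)
    (hQ : UniformBigOInProb P
      (fun T x ω => ∑ i ∈ Finset.Icc 2 T, |c T i x| * A T i ω ^ 2) (fun _ => 1)) :
    UniformBigOInProb P (fun T x ω => ∑ i ∈ Finset.Icc 2 T, c T i x * A T i ω * X T i ω)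
      (stochasticRate h) := by
  intro ε hε
  obtain ⟨C, hC, hcT⟩ := hc
  obtain ⟨MX, hMX, hXtail⟩ := measure_exists_lt_abs_le (Z := X) (p := p) (by linarith)
    (fun T hT i hi => (hX T hT i hi).mono (hF T hT i) le_rfl) hmom (ε := ε / 4) (by positivity)
  obtain ⟨MA, hMA, hAt⟩ := hAtail (ε / 4) (by positivity)
  obtain ⟨Q, hQ0, hQT⟩ := hQ (ε / 4) (by positivity)
  set σ2 : ℝ := 1 + CX with hσ2
  have hσ0 : 0 ≤ σ2 := by positivity
  set M : ℝ := (5 + σ2 * C * Q) + C * MA * (2 * MX) + C * MA * CX with hM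
  have hM0 : 0 < M := by positivity
  refine ⟨M, hM0, ?_⟩
  have hsmall : ∀ᶠ T : ℕ in atTop,
      (2 * C * MA * MX) * ((T : ℝ) ^ (1 / p + b) * stochasticRate h T) ≤ 1 := by
    have := (hh.tendsto_rpow_mul_rate hθ).const_mul (2 * C * MA * MX)
    rw [mul_zero] at this
    exact this.eventually (ge_mem_nhds one_pos)
  have hinv : ∀ᶠ T : ℕ in atTop, 4 / (T : ℝ) ≤ ε / 4 :=
    (tendsto_const_div_atTop_nhds_zero_nat 4).eventually (ge_mem_nhds (by positivity))
  filter_upwards [hcT, hQT, hsmall, hinv, hh.eventually_basic, hh.rpow_neg_half_le] with T hcT hQT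
    hsmall hinv ⟨hT3, hlog, hpos, hle1, hN1⟩ hρlow
  have hT1 : 1 ≤ T := by omega
  have hTpos : (0 : ℝ) < T := by positivity
  have hT1' : (1 : ℝ) ≤ T := by exact_mod_cast hT1
  set ρ := stochasticRate h T with hρ
  have hρ0 : 0 < ρ := lt_of_lt_of_le (by positivity) hρlow
  set N := (T : ℝ) * h T with hN
  have hN0 : 0 < N := by positivity
  have hNρ : N * ρ ^ 2 = Real.log T := by
    rw [hρ, stochasticRate_sq hT1 hpos, hN, mul_div_cancel₀ _ (by positivity)]
  set τX := MX * (T : ℝ) ^ (1 / p) with hτX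
  set τA := MA * (T : ℝ) ^ b with hτA
  have hτX0 : 0 < τX := by positivity
  have hτA0 : 0 < τA := by positivity
  have hττ : τA * τX = MA * MX * (T : ℝ) ^ (1 / p + b) := by
    rw [hτX, hτA, Real.rpow_add hTpos]; ring
  -- the truncated variables
  set m : ℕ → ℝ := fun i => ∫ ω, truncAt τX (X T i ω) ∂P with hm
  set X' : ℕ → Ω → ℝ := fun i ω => truncAt τX (X T i ω) - m i with hX'
  set A' : ℕ → Ω → ℝ := fun i ω => truncAt τA (A T i ω) with hA'
  have hXm : ∀ i ∈ Finset.Icc 2 T, Measurable (X T i) :=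
    fun i hi => (hX T hT1 i hi).mono (hF T hT1 i) le_rfl
  have htrm : ∀ i ∈ Finset.Icc 2 T, Measurable fun ω => truncAt τX (X T i ω) :=
    fun i hi => (measurable_truncAt τX).comp (hXm i hi)
  have htri : ∀ i ∈ Finset.Icc 2 T, Integrable (fun ω => truncAt τX (X T i ω)) P := fun i hi =>
    integrable_of_measurable_of_abs_le (htrm i hi) τX fun ω => abs_truncAt_le hτX0.le _
  have hmτ : ∀ i ∈ Finset.Icc 2 T, |m i| ≤ τX := by
    intro i hi
    calc |m i| ≤ ∫ ω, |truncAt τX (X T i ω)| ∂P := abs_integral_le_integral_abs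
      _ ≤ ∫ _, τX ∂P := integral_mono (htri i hi).abs (integrable_const _)
          fun ω => abs_truncAt_le hτX0.le _
      _ = τX := by simp
  have hmμ : ∀ i ∈ Finset.Icc 2 T, |m i| ≤ CX * τX ^ (1 - p) := fun i hi =>
    abs_integral_truncAt_le (hXm i hi) (by linarith) (hmom T hT1 i hi) (hmean T hT1 i hi) hτX0
  have hX'B : ∀ i ∈ Finset.Icc 2 T, ∀ ω, |X' i ω| ≤ 2 * τX := by
    intro i hi ω
    have h1 := abs_sub (truncAt τX (X T i ω)) (m i)
    have h2 := abs_truncAt_le hτX0.le (X T i ω)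
    have h3 := hmτ i hi
    simp only [hX']
    linarith
  have hX'mean : ∀ i ∈ Finset.Icc 2 T, ∫ ω, X' i ω ∂P = 0 := by
    intro i hi
    simp only [hX']
    rw [integral_sub (htri i hi) (integrable_const _)]
    simp [hm]
  have hX'var : ∀ i ∈ Finset.Icc 2 T, ∫ ω, X' i ω ^ 2 ∂P ≤ σ2 := by
    intro i hi
    obtain ⟨hi2, hle2⟩ := integrable_sq_of_lintegral_rpow_le (hXm i hi) hp (hmom T hT1 i hi)
    have hit2 : Integrable (fun ω => truncAt τX (X T i ω) ^ 2) P :=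
      integrable_of_measurable_of_abs_le ((htrm i hi).pow_const 2) (τX ^ 2) fun ω => by
        rw [abs_pow]
        exact pow_le_pow_left₀ (abs_nonneg _) (abs_truncAt_le hτX0.le _) 2
    have h1 : ∫ ω, X' i ω ^ 2 ∂P = ∫ ω, truncAt τX (X T i ω) ^ 2 ∂P - m i ^ 2 := by
      have h2 : ∀ ω, X' i ω ^ 2 =
          truncAt τX (X T i ω) ^ 2 - (2 * m i) * truncAt τX (X T i ω) + m i ^ 2 := by
        intro ω; simp only [hX']; ring
      simp only [h2]
      have e1 := integral_sub hit2 ((htri i hi).const_mul (2 * m i))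
      have e2 := integral_add (hit2.sub ((htri i hi).const_mul (2 * m i)))
        (integrable_const (m i ^ 2))
      simp only [Pi.sub_apply] at e2
      rw [e2, e1, integral_const_mul]
      simp only [integral_const, probReal_univ, one_smul]
      change _ - 2 * m i * m i + _ = _
      ring
    have h3 : ∫ ω, truncAt τX (X T i ω) ^ 2 ∂P ≤ ∫ ω, X T i ω ^ 2 ∂P :=
      integral_mono hit2 hi2 fun ω => sq_le_sq.2 (abs_truncAt_le_abs _ _)
    linarith [sq_nonneg (m i)]
  have hX'F : ∀ i ∈ Finset.Icc 2 T, Measurable[F T i] (X' i) := fun i hi =>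
    ((measurable_truncAt τX).comp (hX T hT1 i hi)).sub_const _
  have hX'ind : ∀ i ∈ Finset.Icc 2 T,
      Indep (MeasurableSpace.comap (X' i) inferInstance) (F T (i - 1)) P := by
    intro i hi
    refine indep_of_indep_of_le_left (hind T hT1 i hi) (Measurable.comap_le ?_)
    exact ((measurable_truncAt τX).comp (comap_measurable (X T i))).sub_const _
  have hA'F : ∀ i ∈ Finset.Icc 2 T, Measurable[F T (i - 1)] (A' i) := fun i hi =>
    (measurable_truncAt τA).comp (hA T hT1 i hi)
  set G := (Finset.range (T ^ 4 + 1)).image (fun j : ℕ => (j : ℝ) / (T ^ 4 : ℕ)) with hG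
  have hgrid := measure_exists_grid_le (hF T hT1) (hmono T) (c := fun i x => c T i x) (C := C)
    (σ2 := σ2) (τX := 2 * τX) (τA := τA) (N := N) (ρ := ρ) (Q := Q) G hX'F hX'ind hX'mean hX'B
    hX'var hA'F (fun i _ ω => abs_truncAt_le hτA0.le _)
    (fun i hi x => (hcT x).1 i (Finset.Icc_two_subset_Icc_one T hi)) hσ0 hτA0.le
    hC hN0 hρ0 (by
      calc ρ * C * τA * (2 * τX) = 2 * C * ρ * (τA * τX) := by ring
        _ = (2 * C * MA * MX) * ((T : ℝ) ^ (1 / p + b) * ρ) := by rw [hττ]; ring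
        _ ≤ 1 := hsmall)
  -- the four exceptional events
  refine (measure_mono (t := {ω | ∃ i ∈ Finset.Icc 2 T, τX < |X T i ω|} ∪
    {ω | ∃ i ∈ Finset.Icc 2 T, τA < |A T i ω|} ∪
    {ω | ∃ x ∈ Set.Icc (0 : ℝ) 1, Q * 1 < |∑ i ∈ Finset.Icc 2 T, |c T i x| * A T i ω ^ 2|} ∪
    {ω | ∃ x ∈ G, (∑ i ∈ Finset.Icc 2 T, |c T i x| * A' i ω ^ 2 ≤ Q) ∧
      (5 + σ2 * C * Q) * ρ < |∑ i ∈ Finset.Icc 2 T, c T i x * A' i ω * X' i ω|}) ?_).trans ?_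
  · rintro ω ⟨x, hx, hlt⟩
    by_contra hcon
    simp only [Set.mem_union, Set.mem_ofPred_eq, not_or, not_exists, not_and, not_lt] at hcon
    obtain ⟨⟨⟨g1, g2⟩, g3⟩, g4⟩ := hcon
    obtain ⟨x', hx'G, hxx'⟩ := exists_grid_point (N := T ^ 4) (by positivity) hx
    have hx'I : x' ∈ Set.Icc (0 : ℝ) 1 := by
      obtain ⟨j, hj, rfl⟩ := Finset.mem_image.1 hx'G
      rw [Finset.mem_range, Nat.lt_succ_iff] at hj
      refine ⟨by positivity, ?_⟩
      rw [div_le_one (by positivity)]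
      exact_mod_cast hj
    have eA : ∀ i ∈ Finset.Icc 2 T, A' i ω = A T i ω := fun i hi => truncAt_of_abs_le (g2 i hi)
    have eX : ∀ i ∈ Finset.Icc 2 T, X' i ω = X T i ω - m i := fun i hi => by
      simp only [hX', truncAt_of_abs_le (g1 i hi)]
    have hQ' : ∑ i ∈ Finset.Icc 2 T, |c T i x'| * A' i ω ^ 2 ≤ Q := by
      have h1 := (le_abs_self _).trans (g3 x' hx'I)
      rw [mul_one] at h1
      refine le_trans (le_of_eq (Finset.sum_congr rfl fun i hi => ?_)) h1
      rw [eA i hi]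
    have hb := g4 x' hx'G hQ'
    rw [Finset.sum_congr rfl fun i hi => by rw [eA i hi, eX i hi]] at hb
    have hfin := abs_sum_le_of_grid (X := fun i => X T i ω) (A := fun i => A T i ω) (m := m)
      (c := fun i x => c T i x) (C := C) (τX := τX) (τA := τA) (μ := CX * τX ^ (1 - p))
      (δ := C * T * (1 / (T ^ 4 : ℕ))) (x := x) (x' := x') g1 g2 hmμ hmτ
      (((Finset.sum_le_sum_of_subset_of_nonneg (Finset.Icc_two_subset_Icc_one T)
        fun _ _ _ => abs_nonneg _)).trans (hcT x).2.1)
      (fun i hi => ((hcT x).2.2 x' i (Finset.Icc_two_subset_Icc_one T hi)).trans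
        (by gcongr)) hb (by positivity) hτX0.le hτA0.le (by positivity)
    have hT2 : (T : ℝ) ^ (1 / p + b - 1) ≤ ρ := by
      refine le_trans ?_ hρlow
      exact Real.rpow_le_rpow_of_exponent_le hT1' (by linarith)
    -- the cost of moving to the grid point
    have t1 : (T : ℝ) * (C * T * (1 / (T ^ 4 : ℕ)) * τA * (2 * τX)) ≤ C * MA * (2 * MX) * ρ := by
      calc (T : ℝ) * (C * T * (1 / (T ^ 4 : ℕ)) * τA * (2 * τX))
          = 2 * C * (1 / (T : ℝ) ^ 2) * (τA * τX) := by
            push_cast; field_simp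
        _ = 2 * C * MA * MX * ((1 / (T : ℝ)) * ((1 / (T : ℝ)) * (T : ℝ) ^ (1 / p + b))) := by
            rw [hττ]; field_simp
        _ ≤ 2 * C * MA * MX * (1 * ρ) := by
            have h1 : (1 / (T : ℝ)) * (T : ℝ) ^ (1 / p + b) ≤ ρ := by
              rw [Real.rpow_sub_one hTpos.ne'] at hT2
              calc _ = (T : ℝ) ^ (1 / p + b) / T := by ring
                _ ≤ _ := hT2
            have h2 : 1 / (T : ℝ) ≤ 1 := by rw [div_le_one hTpos]; exact hT1'
            gcongr
        _ = _ := by ring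
    -- the cost of centring the truncated variables
    have t2 : C * τA * (CX * τX ^ (1 - p)) ≤ C * MA * CX * ρ := by
      have h1 : τX ^ (1 - p) ≤ (T : ℝ) ^ (1 / p - 1) := by
        rw [hτX, Real.mul_rpow (by linarith) (by positivity), ← Real.rpow_mul hTpos.le]
        have h2 : MX ^ (1 - p) ≤ 1 := Real.rpow_le_one_of_one_le_of_nonpos hMX (by linarith)
        have h3 : 1 / p * (1 - p) = 1 / p - 1 := by field_simp
        rw [h3]
        exact mul_le_of_le_one_left (by positivity) h2
      calc C * τA * (CX * τX ^ (1 - p))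
          ≤ C * τA * (CX * (T : ℝ) ^ (1 / p - 1)) := by gcongr
        _ = C * MA * CX * ((T : ℝ) ^ b * (T : ℝ) ^ (1 / p - 1)) := by rw [hτA]; ring
        _ = C * MA * CX * (T : ℝ) ^ (1 / p + b - 1) := by
            rw [← Real.rpow_add hTpos]; congr 2; ring
        _ ≤ _ := by gcongr
    have : M * ρ < M * ρ := hlt.trans_le (hfin.trans (by
      rw [hM, add_mul, add_mul]
      linarith))
    exact lt_irrefl _ this
  · have hgrid' : (G.card : ℝ≥0∞) * ENNReal.ofReal (2 * Real.exp (-(5 * N * ρ ^ 2))) ≤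
        ENNReal.ofReal (ε / 4) := by
      have hcard : G.card ≤ T ^ 4 + 1 := by
        refine Finset.card_image_le.trans ?_
        simp
      calc (G.card : ℝ≥0∞) * ENNReal.ofReal (2 * Real.exp (-(5 * N * ρ ^ 2)))
          ≤ ((T ^ 4 + 1 : ℕ) : ℝ≥0∞) * ENNReal.ofReal (2 * Real.exp (-(5 * N * ρ ^ 2))) := by
            gcongr
        _ = ENNReal.ofReal ((T ^ 4 + 1 : ℕ) * (2 * Real.exp (-(5 * N * ρ ^ 2)))) := by
            rw [ENNReal.ofReal_mul (Nat.cast_nonneg _), ENNReal.ofReal_natCast]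
        _ ≤ ENNReal.ofReal (ε / 4) := by
            apply ENNReal.ofReal_le_ofReal
            refine le_trans ?_ hinv
            -- the constant `5` beats the `T ^ 4 + 1` grid points
            have h1 : Real.exp (-(5 * N * ρ ^ 2)) = 1 / (T : ℝ) ^ 5 := by
              rw [mul_assoc, hNρ, Real.exp_neg, mul_comm, Real.exp_mul, Real.exp_log hTpos]
              norm_num
            rw [h1]
            push_cast
            rw [mul_one_div, mul_div_assoc', div_le_div_iff₀ (by positivity) hTpos]
            have h2 : (1 : ℝ) ≤ (T : ℝ) ^ 4 := one_le_pow₀ hT1'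
            calc ((T : ℝ) ^ 4 + 1) * 2 * T ≤ ((T : ℝ) ^ 4 + (T : ℝ) ^ 4) * 2 * T := by gcongr
              _ = 4 * (T : ℝ) ^ 5 := by ring
    calc _ ≤ ENNReal.ofReal (ε / 4) + ENNReal.ofReal (ε / 4) + ENNReal.ofReal (ε / 4) +
          ENNReal.ofReal (ε / 4) := by
          refine (measure_union_le _ _).trans (add_le_add ((measure_union_le _ _).trans
            (add_le_add ((measure_union_le _ _).trans (add_le_add ?_ ?_)) ?_)) ?_)
          · exact hXtail T hT1
          · exact hAt T hT1
          · exact hQT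
          · exact hgrid.trans hgrid'
      _ = ENNReal.ofReal ε := by
          have h4 : 0 ≤ ε / 4 := by positivity
          rw [← ENNReal.ofReal_add h4 h4, ← ENNReal.ofReal_add (by positivity) h4,
            ← ENNReal.ofReal_add (by positivity) h4]
          congr 1
          ring

/-! ### Moving-average weights of an autoregression -/

/-- The weight with which the innovation at time `i` enters `∑_{t ≤ T} w t * Q t` when
`Q t = a t * Q (t - 1) + ξ t`. -/
noncomputable def arTransfer (a w : ℕ → ℝ) (T i : ℕ) : ℝ :=
  ∑ t ∈ Finset.Icc i T, w t * ∏ r ∈ Finset.Ioc i t, a r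

/-- Solving the recursion and interchanging the sums turns a weighted sum of the states into a
weighted sum of the innovations; the state at time `1` plays the role of an initial value. -/
theorem sum_mul_eq_arTransfer (a w Q ξ : ℕ → ℝ) {T : ℕ} (hT : 1 ≤ T)
    (hQ : ∀ t ∈ Finset.Icc 2 T, Q t = a t * Q (t - 1) + ξ t) :
    ∑ t ∈ Finset.Icc 1 T, w t * Q t =
      arTransfer a w T 1 * Q 1 + ∑ i ∈ Finset.Icc 2 T, arTransfer a w T i * ξ i := by
  set η : ℕ → ℝ := fun i => if i = 1 then Q 1 else ξ i with hη
  have hsol : ∀ t, 1 ≤ t → t ≤ T →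
      Q t = ∑ i ∈ Finset.Icc 1 t, (∏ r ∈ Finset.Ioc i t, a r) * η i := by
    intro t ht
    induction t, ht using Nat.le_induction with
    | base => intro _; simp [hη]
    | succ t ht ih =>
      intro htT
      rw [hQ (t + 1) (Finset.mem_Icc.2 ⟨by omega, htT⟩), Nat.add_sub_cancel, ih (by omega),
        Finset.sum_Icc_succ_top (by omega), Finset.mul_sum]
      congr 1
      · refine Finset.sum_congr rfl fun i hi => ?_
        have hit : i ≤ t := (Finset.mem_Icc.1 hi).2
        rw [Finset.prod_Ioc_succ_top hit]
        ring
      · simp [hη, show t ≠ 0 by omega]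
  have h1 : ∑ t ∈ Finset.Icc 1 T, w t * Q t = ∑ i ∈ Finset.Icc 1 T, arTransfer a w T i * η i := by
    calc ∑ t ∈ Finset.Icc 1 T, w t * Q t
        = ∑ t ∈ Finset.Icc 1 T, ∑ i ∈ Finset.Icc 1 t,
            w t * (∏ r ∈ Finset.Ioc i t, a r) * η i := by
          refine Finset.sum_congr rfl fun t ht => ?_
          obtain ⟨h1, h2⟩ := Finset.mem_Icc.1 ht
          rw [hsol t h1 h2, Finset.mul_sum]
          exact Finset.sum_congr rfl fun i _ => by ring
      _ = ∑ i ∈ Finset.Icc 1 T, ∑ t ∈ Finset.Icc i T,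
            w t * (∏ r ∈ Finset.Ioc i t, a r) * η i := by
          refine Finset.sum_comm' fun t i => ?_
          simp only [Finset.mem_Icc]
          omega
      _ = _ := by
          refine Finset.sum_congr rfl fun i _ => ?_
          rw [arTransfer, Finset.sum_mul]
  have hη1 : η 1 = Q 1 := if_pos rfl
  have h2 : Finset.Ioc 1 T = Finset.Icc 2 T := by
    ext; simp only [Finset.mem_Ioc, Finset.mem_Icc]; omega
  rw [h1, ← Finset.add_sum_Ioc_eq_sum_Icc hT, hη1, h2]
  refine congrArg _ (Finset.sum_congr rfl fun i hi => ?_)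
  have : i ≠ 1 := by have := (Finset.mem_Icc.1 hi).1; omega
  simp only [hη, if_neg this]

theorem sum_pow_le_of_injOn {q : ℝ} (hq0 : 0 ≤ q) (hq1 : q < 1) (S : Finset ℕ) (f : ℕ → ℕ)
    (hf : Set.InjOn f S) : ∑ i ∈ S, q ^ f i ≤ 1 / (1 - q) := by
  rw [← Finset.sum_image (f := fun n => q ^ n) hf, one_div, ← tsum_geometric_of_lt_one hq0 hq1]
  exact (summable_geometric_of_lt_one hq0 hq1).sum_le_tsum _ fun i _ => by positivity

theorem abs_prod_Ioc_le {a : ℕ → ℝ} {q : ℝ} {T i t : ℕ} (hi : 1 ≤ i) (ht : t ≤ T)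
    (ha : ∀ r ∈ Finset.Icc 2 T, |a r| ≤ q) : |∏ r ∈ Finset.Ioc i t, a r| ≤ q ^ (t - i) := by
  rw [Finset.abs_prod]
  calc ∏ r ∈ Finset.Ioc i t, |a r| ≤ ∏ _r ∈ Finset.Ioc i t, q := by
        refine Finset.prod_le_prod (fun _ _ => abs_nonneg _) fun r hr => ha r ?_
        simp only [Finset.mem_Ioc, Finset.mem_Icc] at hr ⊢
        omega
    _ = q ^ (t - i) := by simp

theorem abs_arTransfer_le_sum {a w : ℕ → ℝ} {q : ℝ} {T i : ℕ} (hi : 1 ≤ i)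
    (ha : ∀ r ∈ Finset.Icc 2 T, |a r| ≤ q) :
    |arTransfer a w T i| ≤ ∑ t ∈ Finset.Icc i T, |w t| * q ^ (t - i) := by
  refine (Finset.abs_sum_le_sum_abs _ _).trans (Finset.sum_le_sum fun t ht => ?_)
  rw [abs_mul]
  exact mul_le_mul_of_nonneg_left (abs_prod_Ioc_le hi (Finset.mem_Icc.1 ht).2 ha) (abs_nonneg _)

theorem abs_arTransfer_le {a w : ℕ → ℝ} {q B : ℝ} {T i : ℕ} (hq0 : 0 ≤ q) (hq1 : q < 1)
    (hi : 1 ≤ i) (ha : ∀ r ∈ Finset.Icc 2 T, |a r| ≤ q) (hw : ∀ t ∈ Finset.Icc 1 T, |w t| ≤ B)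
    (hB : 0 ≤ B) : |arTransfer a w T i| ≤ B / (1 - q) := by
  calc |arTransfer a w T i| ≤ ∑ t ∈ Finset.Icc i T, |w t| * q ^ (t - i) :=
        abs_arTransfer_le_sum hi ha
    _ ≤ ∑ t ∈ Finset.Icc i T, B * q ^ (t - i) := by
        refine Finset.sum_le_sum fun t ht => ?_
        have h1 := Finset.mem_Icc.1 ht
        have := hw t (Finset.mem_Icc.2 ⟨by omega, h1.2⟩)
        gcongr
    _ ≤ B * (1 / (1 - q)) := by
        rw [← Finset.mul_sum]
        refine mul_le_mul_of_nonneg_left (sum_pow_le_of_injOn hq0 hq1 _ _ ?_) hB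
        intro x hx y hy hxy
        simp only [Finset.coe_Icc, Set.mem_Icc] at hx hy hxy
        omega
    _ = _ := by ring

theorem sum_abs_arTransfer_le {a w : ℕ → ℝ} {q : ℝ} {T : ℕ} (hq0 : 0 ≤ q) (hq1 : q < 1)
    (ha : ∀ r ∈ Finset.Icc 2 T, |a r| ≤ q) :
    ∑ i ∈ Finset.Icc 1 T, |arTransfer a w T i| ≤ (∑ t ∈ Finset.Icc 1 T, |w t|) / (1 - q) := by
  calc ∑ i ∈ Finset.Icc 1 T, |arTransfer a w T i|
      ≤ ∑ i ∈ Finset.Icc 1 T, ∑ t ∈ Finset.Icc i T, |w t| * q ^ (t - i) :=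
        Finset.sum_le_sum fun i hi => abs_arTransfer_le_sum (Finset.mem_Icc.1 hi).1 ha
    _ = ∑ t ∈ Finset.Icc 1 T, ∑ i ∈ Finset.Icc 1 t, |w t| * q ^ (t - i) := by
        refine Finset.sum_comm' fun t i => ?_
        simp only [Finset.mem_Icc]
        omega
    _ ≤ ∑ t ∈ Finset.Icc 1 T, |w t| * (1 / (1 - q)) := by
        refine Finset.sum_le_sum fun t _ => ?_
        rw [← Finset.mul_sum]
        refine mul_le_mul_of_nonneg_left (sum_pow_le_of_injOn hq0 hq1 _ _ ?_) (abs_nonneg _)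
        intro x hx y hy hxy
        simp only [Finset.coe_Icc, Set.mem_Icc] at hx hy hxy
        omega
    _ = _ := by rw [← Finset.sum_mul]; ring

theorem arTransfer_sub (a w w' : ℕ → ℝ) (T i : ℕ) :
    arTransfer a w T i - arTransfer a w' T i = arTransfer a (fun t => w t - w' t) T i := by
  simp only [arTransfer, sub_mul, Finset.sum_sub_distrib]

theorem arTransfer_nonneg {a w : ℕ → ℝ} {T i : ℕ} (hi : 1 ≤ i) (ha : ∀ r, 0 ≤ a r)
    (hw : ∀ t ∈ Finset.Icc 1 T, 0 ≤ w t) : 0 ≤ arTransfer a w T i := by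
  refine Finset.sum_nonneg fun t ht => mul_nonneg (hw t ?_) (Finset.prod_nonneg fun r _ => ha r)
  have h1 := Finset.mem_Icc.1 ht
  exact Finset.mem_Icc.2 ⟨by omega, h1.2⟩

/-- Weights of local-averaging type remain so under the transfer, by geometric summation. -/
theorem IsWeightArray.arTransfer {h : ℕ → ℝ} {c : ℕ → ℕ → ℝ → ℝ} (hc : IsWeightArray h c)
    (hh : ∀ᶠ T in atTop, 0 < h T) {a : ℕ → ℕ → ℝ} {q : ℝ} (hq0 : 0 ≤ q) (hq1 : q < 1)
    (ha : ∀ T, ∀ r ∈ Finset.Icc 2 T, |a T r| ≤ q) :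
    IsWeightArray h (fun T i x => _root_.arTransfer (a T) (fun t => c T t x) T i) := by
  obtain ⟨C, hC, hT⟩ := hc
  have hq : 0 < 1 - q := by linarith
  refine ⟨C / (1 - q), by positivity, ?_⟩
  filter_upwards [hT, hh] with T h1 hpos x
  obtain ⟨a1, a2, a3⟩ := h1 x
  refine ⟨fun i hi => ?_, ?_, fun x' i hi => ?_⟩
  · refine (abs_arTransfer_le hq0 hq1 (Finset.mem_Icc.1 hi).1 (ha T) a1 (by positivity)).trans ?_
    rw [div_right_comm]
  · refine (sum_abs_arTransfer_le hq0 hq1 (ha T)).trans ?_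
    gcongr
  · rw [arTransfer_sub]
    refine (abs_arTransfer_le hq0 hq1 (Finset.mem_Icc.1 hi).1 (ha T) (a3 x')
      (by positivity)).trans (le_of_eq ?_)
    ring

theorem sum_Icc_two_eq_shift (c f : ℕ → ℝ) (T : ℕ) :
    ∑ i ∈ Finset.Icc 2 T, c i * f (i - 1) =
      ∑ j ∈ Finset.Icc 1 T, (if j + 1 ≤ T then c (j + 1) else 0) * f j := by
  simp only [ite_mul, zero_mul]
  rw [← Finset.sum_filter]
  refine Finset.sum_nbij' (fun i => i - 1) (fun j => j + 1) ?_ ?_ ?_ ?_ ?_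
  all_goals
    intro i hi
    simp only [Finset.mem_Icc, Finset.mem_filter] at hi ⊢
  · omega
  · omega
  · omega
  · omega
  · rw [Nat.sub_add_cancel (by omega)]

/-! ### The past of the autoregression -/

theorem designPt_mem {T t : ℕ} (ht : t ≤ T) : designPt T t ∈ Set.Icc (0 : ℝ) 1 := by
  refine ⟨by unfold designPt; positivity, ?_⟩
  unfold designPt
  exact div_le_one_of_le₀ (by exact_mod_cast ht) (by positivity)

/-- The σ-algebra generated by the initial value and the innovations up to time `i`. -/
abbrev noisePast {Ω : Type*} (V e : ℕ → ℕ → Ω → ℝ) (T i : ℕ) : MeasurableSpace Ω :=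
  MeasurableSpace.comap (V T 0) inferInstance ⊔
    ⨆ t : Finset.Icc 1 T, ⨆ _ : (t : ℕ) ≤ i, MeasurableSpace.comap (e T t) inferInstance

theorem noisePast_mono {Ω : Type*} (V e : ℕ → ℕ → Ω → ℝ) (T : ℕ) :
    Monotone (noisePast V e T) := by
  intro i j hij
  exact sup_le_sup_left (biSup_mono fun t ht => ht.trans hij) _

theorem measurable_noise_past {Ω : Type*} (V e : ℕ → ℕ → Ω → ℝ) {T t : ℕ}
    (ht : t ∈ Finset.Icc 1 T) : Measurable[noisePast V e T t] (e T t) := by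
  have h1 : MeasurableSpace.comap (e T t) inferInstance ≤ noisePast V e T t := by
    refine le_trans ?_ (le_sup_right (α := MeasurableSpace Ω))
    exact le_iSup_of_le (⟨t, ht⟩ : Finset.Icc 1 T) (le_iSup_of_le le_rfl le_rfl)
  exact (comap_measurable (e T t)).mono h1 le_rfl

namespace IsTimeVaryingARModel

variable {Ω : Type*} [mΩ : MeasurableSpace Ω] {P : Measure Ω} {g φ : ℝ → ℝ}
  {Y V e : ℕ → ℕ → Ω → ℝ}

theorem noisePast_le (hm : IsTimeVaryingARModel P g φ Y V e) {T : ℕ} (hT : 1 ≤ T) (i : ℕ) :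
    noisePast V e T i ≤ mΩ := by
  refine sup_le (hm.measurable_init T hT).comap_le (iSup_le fun t => iSup_le fun _ => ?_)
  exact (hm.measurable_noise T hT t t.2).comap_le

theorem measurable_state_past (hm : IsTimeVaryingARModel P g φ Y V e) {T : ℕ} (hT : 1 ≤ T) :
    ∀ t ≤ T, Measurable[noisePast V e T t] (V T t) := by
  intro t
  induction t with
  | zero =>
    intro _
    have h1 : MeasurableSpace.comap (V T 0) inferInstance ≤ noisePast V e T 0 := le_sup_left
    exact (comap_measurable (V T 0)).mono h1 le_rfl
  | succ t ih =>
    intro ht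
    have hmem : t + 1 ∈ Finset.Icc 1 T := Finset.mem_Icc.2 ⟨by omega, ht⟩
    have h1 : V T (t + 1) = fun ω => φ (designPt T (t + 1)) * V T t ω + e T (t + 1) ω :=
      funext fun ω => hm.autoregression T hT _ hmem ω
    rw [h1]
    exact (((ih (by omega)).mono (noisePast_mono V e T (Nat.le_succ t)) le_rfl).const_mul _).add
      (measurable_noise_past V e hmem)

theorem measurable_state (hm : IsTimeVaryingARModel P g φ Y V e) {T t : ℕ} (hT : 1 ≤ T)
    (ht : t ≤ T) : Measurable (V T t) :=
  (hm.measurable_state_past hT t ht).mono (hm.noisePast_le hT t) le_rfl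

theorem indep_noise_past [IsProbabilityMeasure P] (hm : IsTimeVaryingARModel P g φ Y V e) {T i : ℕ}
    (hi : i ∈ Finset.Icc 1 T) :
    Indep (MeasurableSpace.comap (e T i) inferInstance) (noisePast V e T (i - 1)) P := by
  have hT : 1 ≤ T := (Finset.mem_Icc.1 hi).1.trans (Finset.mem_Icc.1 hi).2
  have hi1 := (Finset.mem_Icc.1 hi).1
  refine Indep.symm (indep_sup_left_of_indep_sup_right (hm.measurable_init T hT).comap_le
    (iSup_le fun t => iSup_le fun _ => (hm.measurable_noise T hT t t.2).comap_le)
    (hm.measurable_noise T hT i hi).comap_le ?_ ?_)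
  · have h1 := hm.noise_indep_init T hT
    rw [IndepFun_iff_Indep] at h1
    refine indep_of_indep_of_le_right h1 ?_
    have h2 : ∀ t : Finset.Icc 1 T, MeasurableSpace.comap (e T t) inferInstance ≤
        MeasurableSpace.comap (fun ω => fun t : Finset.Icc 1 T => e T t ω) inferInstance := by
      intro t
      exact Measurable.comap_le ((measurable_pi_apply t).comp
        (comap_measurable (fun ω => fun t : Finset.Icc 1 T => e T t ω)))
    exact sup_le (iSup_le fun t => iSup_le fun _ => h2 t) (h2 ⟨i, hi⟩)
  · have h1 := hm.noise_indep T hT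
    rw [iIndepFun_iff_iIndep] at h1
    have h2 := indep_iSup_of_disjoint
      (fun t : Finset.Icc 1 T => (hm.measurable_noise T hT t t.2).comap_le) h1
      (S := {t | (t : ℕ) ≤ i - 1}) (T := {⟨i, hi⟩}) (by
        rw [Set.disjoint_singleton_right]
        simp only [Set.mem_ofPred_eq]
        omega)
    simpa using h2

end IsTimeVaryingARModel

/-! ### Uniform rates for averages of the autoregression and its squares -/

theorem abs_coeff_designPt_le {φ : ℝ → ℝ} {q : ℝ} (hφ : ∀ u ∈ Set.Icc (0 : ℝ) 1, |φ u| ≤ q) (T : ℕ) :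
    ∀ r ∈ Finset.Icc 2 T, |φ (designPt T r)| ≤ q := fun _ hr =>
  hφ _ (designPt_mem (Finset.mem_Icc.1 hr).2)

theorem IsWeightArray.uniformBigOInProb_initial {Ω : Type*} [MeasurableSpace Ω] {P : Measure Ω}
    [IsFiniteMeasure P] {h : ℕ → ℝ} {c : ℕ → ℕ → ℝ → ℝ} {θ D : ℝ} (hc : IsWeightArray h c)
    (hh : IsBandwidth θ h) {U : ℕ → Ω → ℝ}
    (hU : ∀ T : ℕ, 1 ≤ T → Integrable (U T) P ∧ ∫ ω, |U T ω| ∂P ≤ D) :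
    UniformBigOInProb P (fun T x ω => c T 1 x * U T ω) (stochasticRate h) := by
  obtain ⟨C, hC, hT⟩ := hc
  refine UniformBigOInProb.of_moment C D hC
    (Eventually.of_forall fun T => stochasticRate_nonneg h T) ?_ ?_
  · filter_upwards [hT, hh.inv_le, eventually_ge_atTop 1] with T h1 h2 h3 x _
    refine ((h1 x).1 1 (Finset.mem_Icc.2 ⟨le_rfl, h3⟩)).trans ?_
    rw [div_eq_mul_one_div]
    gcongr
  · filter_upwards [eventually_ge_atTop 1] with T h1 using hU T h1

theorem IsWeightArray.uniformBigOInProb_total {Ω : Type*} [MeasurableSpace Ω] {P : Measure Ω}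
    {h : ℕ → ℝ} {c : ℕ → ℕ → ℝ → ℝ} (hc : IsWeightArray h c) :
    UniformBigOInProb P (fun T x _ => ∑ i ∈ Finset.Icc 2 T, |c T i x|) (fun _ => 1) := by
  obtain ⟨C, hC, hT⟩ := hc
  refine UniformBigOInProb.of_bounded C (Eventually.of_forall fun _ => zero_le_one) ?_
  filter_upwards [hT] with T h1 x _ ω
  rw [abs_of_nonneg (Finset.sum_nonneg fun _ _ => abs_nonneg _), mul_one]
  exact (Finset.sum_le_sum_of_subset_of_nonneg (Finset.Icc_two_subset_Icc_one T)
    fun _ _ _ => abs_nonneg _).trans (h1 x).2.1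

theorem UniformMomentBound.of_sq {Ω : Type*} [MeasurableSpace Ω] {P : Measure Ω} {s : ℝ} {t₀ : ℕ}
    {X : ℕ → ℕ → Ω → ℝ} (h : UniformMomentBound P s t₀ (fun T t ω => X T t ω ^ 2)) :
    UniformMomentBound P (2 * s) t₀ X := by
  obtain ⟨C, hC⟩ := h
  refine ⟨C, fun T hT t ht => (le_of_eq ?_).trans (hC T hT t ht)⟩
  refine lintegral_congr fun ω => ?_
  rw [enorm_pow, ENNReal.rpow_mul]
  norm_cast

theorem UniformMomentBound.sq_sub_one {Ω : Type*} [MeasurableSpace Ω] {P : Measure Ω}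
    [IsProbabilityMeasure P] {s : ℝ} (hs : 1 ≤ s) {X : ℕ → ℕ → Ω → ℝ} {t₀ : ℕ}
    (h : UniformMomentBound P (2 * s) t₀ X) :
    UniformMomentBound P s t₀ (fun T t ω => X T t ω ^ 2 - 1) := by
  obtain ⟨C, hC⟩ := h
  refine ⟨2 ^ (s - 1) * (C + 1), fun T hT t ht => ?_⟩
  calc ∫⁻ ω, ‖X T t ω ^ 2 - 1‖ₑ ^ s ∂P
      ≤ ∫⁻ ω, 2 ^ (s - 1) * (‖X T t ω‖ₑ ^ (2 * s) + 1) ∂P := by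
        refine lintegral_mono fun ω => ?_
        calc ‖X T t ω ^ 2 - 1‖ₑ ^ s ≤ (‖X T t ω‖ₑ ^ (2 : ℝ) + 1) ^ s := by
              refine ENNReal.rpow_le_rpow ?_ (by linarith)
              refine enorm_sub_le.trans (le_of_eq ?_)
              rw [enorm_pow]
              norm_num
          _ ≤ 2 ^ (s - 1) * ((‖X T t ω‖ₑ ^ (2 : ℝ)) ^ s + 1 ^ s) :=
              ENNReal.rpow_add_le_mul_rpow_add_rpow _ _ hs
          _ = _ := by rw [ENNReal.one_rpow, ← ENNReal.rpow_mul]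
    _ = 2 ^ (s - 1) * (∫⁻ ω, ‖X T t ω‖ₑ ^ (2 * s) ∂P + 1) := by
        rw [lintegral_const_mul' _ _ (ENNReal.rpow_ne_top_of_nonneg (by linarith) (by simp)),
          lintegral_add_right _ measurable_const]
        simp
    _ ≤ 2 ^ (s - 1) * ((C : ℝ≥0∞) + 1) := by
        gcongr
        exact hC T hT t ht
    _ = _ := by
        push_cast
        rw [ENNReal.coe_rpow_of_nonneg _ (by linarith)]
        norm_cast

namespace IsTimeVaryingARModel

variable {Ω : Type*} [mΩ : MeasurableSpace Ω] {P : Measure Ω} [IsProbabilityMeasure P]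
  {g φ : ℝ → ℝ} {Y V e : ℕ → ℕ → Ω → ℝ} {c : ℕ → ℕ → ℝ → ℝ} {h : ℕ → ℝ} {θ s q : ℝ}

/-- Weighted averages of a centred function of the innovations. -/
theorem uniformBigOInProb_sum_noise (hm : IsTimeVaryingARModel P g φ Y V e)
    (hh : IsBandwidth θ h) (hs : 2 < s) (hθ : θ ≤ 1 - 2 * (1 / s)) (hc : IsWeightArray h c)
    {ψ : ℝ → ℝ} (hψ : Measurable ψ)
    (hmean : ∀ T : ℕ, 1 ≤ T → ∀ t ∈ Finset.Icc 1 T, ∫ ω, ψ (e T t ω) ∂P = 0)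
    (hmom : UniformMomentBound P s 1 (fun T t ω => ψ (e T t ω))) :
    UniformBigOInProb P (fun T x ω => ∑ i ∈ Finset.Icc 2 T, c T i x * ψ (e T i ω))
      (stochasticRate h) := by
  obtain ⟨C, hC⟩ := hmom
  have h12 := Finset.Icc_two_subset_Icc_one
  have key := uniformBigOInProb_sum (P := P) (F := noisePast V e)
    (X := fun T i ω => ψ (e T i ω)) (A := fun _ _ _ => 1) (c := c) (h := h) (θ := θ) (p := s)
    (b := 0) (CX := C) (fun T hT i => hm.noisePast_le hT i) (noisePast_mono V e)
    (fun T _ i hi => hψ.comp (measurable_noise_past V e (h12 T hi)))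
    (fun T hT i hi => indep_of_indep_of_le_left (hm.indep_noise_past (h12 T hi))
      (Measurable.comap_le (hψ.comp (comap_measurable (e T i)))))
    (fun T hT i hi => hmean T hT i (h12 T hi)) hs.le (fun T hT i hi => hC T hT i (h12 T hi))
    (fun T _ i _ => measurable_const) (fun ε hε => ⟨1, le_rfl, fun T _ => by simp⟩)
    (by rw [add_zero]; exact one_div_le_one_div_of_le two_pos hs.le) (by simpa using hθ) hh hc
    (by simpa using hc.uniformBigOInProb_total)
  simpa using key

/-- Weighted averages of the states. The recursion is started at time `1`, since only the states
from that time on have uniform moment bounds. -/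
theorem uniformBigOInProb_sum_state (hm : IsTimeVaryingARModel P g φ Y V e)
    (hq0 : 0 ≤ q) (hq1 : q < 1) (hφ : ∀ u ∈ Set.Icc (0 : ℝ) 1, |φ u| ≤ q)
    (hh : IsBandwidth θ h) (hs : 2 < s) (hθ : θ ≤ 1 - 2 * (1 / s))
    (hV : UniformMomentBound P s 1 V) (he : UniformMomentBound P s 1 e)
    (hc : IsWeightArray h c) :
    UniformBigOInProb P (fun T x ω => ∑ t ∈ Finset.Icc 1 T, c T t x * V T t ω)
      (stochasticRate h) := by
  have hpos : ∀ᶠ T in atTop, 0 < h T := hh.eventually_basic.mono fun T hT => hT.2.2.1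
  have hc' := hc.arTransfer hpos hq0 hq1 (a := fun T t => φ (designPt T t))
    (abs_coeff_designPt_le hφ)
  obtain ⟨C, hC⟩ := hV
  have h1 := hc'.uniformBigOInProb_initial hh (U := fun T => V T 1) (P := P) (D := 1 + C)
    fun T hT => integrable_of_lintegral_rpow_le (hm.measurable_state hT hT) (by linarith)
      (hC T hT 1 (Finset.mem_Icc.2 ⟨le_rfl, hT⟩))
  have h2 := hm.uniformBigOInProb_sum_noise hh hs hθ hc' measurable_id hm.noise_mean he
  refine (h1.add h2).congr ?_
  filter_upwards [eventually_ge_atTop 1] with T hT x _ ω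
  exact sum_mul_eq_arTransfer (fun t => φ (designPt T t)) (fun t => c T t x) (fun t => V T t ω)
    (fun t => e T t ω) hT fun t ht =>
      hm.autoregression T hT t (Finset.Icc_two_subset_Icc_one T ht) ω

/-- Weighted averages of `V²` are uniformly bounded in probability: `V_t²` is dominated by a
linear recursion driven by the squared innovations. -/
theorem uniformBigOInProb_sum_sq (hm : IsTimeVaryingARModel P g φ Y V e)
    (hq0 : 0 < q) (hq1 : q < 1) (hφ : ∀ u ∈ Set.Icc (0 : ℝ) 1, |φ u| ≤ q)
    (hh : IsBandwidth θ h) (hs : 2 < s) (hθ : θ ≤ 1 - 2 * (1 / s))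
    (hV : UniformMomentBound P s 1 V)
    (he : UniformMomentBound P s 1 (fun T t ω => e T t ω ^ 2 - 1))
    (hvar : ∀ T : ℕ, 1 ≤ T → ∀ t ∈ Finset.Icc 1 T, ∫ ω, (e T t ω ^ 2 - 1) ∂P = 0)
    (hc : IsWeightArray h c) :
    UniformBigOInProb P (fun T x ω => ∑ t ∈ Finset.Icc 1 T, |c T t x| * V T t ω ^ 2)
      (fun _ => 1) := by
  have hpos : ∀ᶠ T in atTop, 0 < h T := hh.eventually_basic.mono fun T hT => hT.2.2.1
  have hc' := hc.abs.arTransfer hpos hq0.le hq1 (a := fun _ _ => q)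
    (fun _ _ _ => by rw [abs_of_pos hq0])
  set L : ℕ → ℕ → ℝ → ℝ := fun T i x => arTransfer (fun _ => q) (fun t => |c T t x|) T i with hL
  have hLnn : ∀ T i x, 1 ≤ i → 0 ≤ L T i x := fun T i x hi =>
    arTransfer_nonneg hi (fun _ => hq0.le) fun _ _ => abs_nonneg _
  obtain ⟨C, hC⟩ := hV
  have hone : ∀ᶠ T in atTop, stochasticRate h T ≤ 1 * 1 := by
    have h1s : 0 < 1 / s := by positivity
    have := hh.tendsto_rate (by linarith)
    simpa using this.eventually (ge_mem_nhds one_pos)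
  have h1 := (hc'.uniformBigOInProb_initial hh (U := fun T ω => V T 1 ω ^ 2) (P := P) (D := 1 + C)
    fun T hT => by
      have := integrable_sq_of_lintegral_rpow_le (hm.measurable_state hT hT) hs.le
        (hC T hT 1 (Finset.mem_Icc.2 ⟨le_rfl, hT⟩))
      simpa only [abs_pow, sq_abs] using this).rate_mono (r' := fun _ => 1) 1 one_pos hone
  have h2 := (hm.uniformBigOInProb_sum_noise hh hs hθ hc' (ψ := fun u => u ^ 2 - 1)
    (by fun_prop) hvar he).rate_mono (r' := fun _ => 1) 1 one_pos hone
  have h3 := hc'.uniformBigOInProb_total (P := P)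
  have hq : 0 < 1 - q := by linarith
  refine (h1.add ((h2.add h3).mono (Z' := fun T x ω =>
    (1 / (1 - q)) * ((∑ i ∈ Finset.Icc 2 T, L T i x * (e T i ω ^ 2 - 1)) +
      ∑ i ∈ Finset.Icc 2 T, |L T i x|)) (1 / (1 - q)) (by positivity)
    (Eventually.of_forall fun T x _ ω => ?_))).mono 1 one_pos ?_
  · rw [abs_mul, abs_of_pos (by positivity : 0 < 1 / (1 - q))]
  · filter_upwards [eventually_ge_atTop 1] with T hT x _ ω
    rw [one_mul, abs_of_nonneg (Finset.sum_nonneg fun _ _ =>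
      mul_nonneg (abs_nonneg _) (sq_nonneg _))]
    refine le_trans ?_ (le_abs_self _)
    rw [sum_mul_eq_arTransfer (fun _ => q) (fun t => |c T t x|) (fun t => V T t ω ^ 2)
      (fun t => V T t ω ^ 2 - q * V T (t - 1) ω ^ 2) hT fun t _ => by ring]
    refine add_le_add le_rfl ?_
    rw [← Finset.sum_add_distrib, Finset.mul_sum]
    refine Finset.sum_le_sum fun i hi => ?_
    have hi1 : 1 ≤ i := le_trans one_le_two (Finset.mem_Icc.1 hi).1
    have hL0 := hLnn T i x hi1
    rw [abs_of_nonneg hL0]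
    have hrec : V T i ω ^ 2 - q * V T (i - 1) ω ^ 2 ≤ 1 / (1 - q) * e T i ω ^ 2 := by
      have hi' := Finset.Icc_two_subset_Icc_one T hi
      rw [hm.autoregression T hT i hi' ω]
      have hf := hφ _ (designPt_mem (Finset.mem_Icc.1 hi).2)
      set f := φ (designPt T i)
      set v := V T (i - 1) ω
      set u := e T i ω
      -- convexity of the square with weights `q` and `1 - q`
      have hf2 : f ^ 2 ≤ q ^ 2 := sq_le_sq' (abs_le.1 hf).1 (abs_le.1 hf).2
      have h4 : (f * v + u) ^ 2 * (1 - q) ≤ q * v ^ 2 * (1 - q) + u ^ 2 := by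
        have h6 : q * ((f * v + u) ^ 2 * (1 - q)) ≤ q * (q * v ^ 2 * (1 - q) + u ^ 2) := by
          nlinarith [sq_nonneg ((1 - q) * (f * v) - q * u), mul_nonneg hq.le (mul_nonneg
            (sub_nonneg.2 hf2) (sq_nonneg v))]
        exact le_of_mul_le_mul_left h6 hq0
      rw [sub_le_iff_le_add, one_div, inv_mul_eq_div, ← sub_le_iff_le_add, le_div_iff₀ hq]
      linarith
    calc L T i x * (V T i ω ^ 2 - q * V T (i - 1) ω ^ 2)
        ≤ L T i x * (1 / (1 - q) * e T i ω ^ 2) := mul_le_mul_of_nonneg_left hrec hL0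
      _ = _ := by ring

/-- Weighted averages of the martingale differences `V_{t-1} e_t`. -/
theorem uniformBigOInProb_sum_cross (hm : IsTimeVaryingARModel P g φ Y V e)
    (hq0 : 0 < q) (hq1 : q < 1) (hφ : ∀ u ∈ Set.Icc (0 : ℝ) 1, |φ u| ≤ q)
    (hh : IsBandwidth θ h) (hs : 2 < s) (hθ : θ ≤ 1 - 2 * (1 / s))
    (hV : UniformMomentBound P s 1 V)
    (hV2 : UniformMomentBound P s 2 (fun T t ω => V T (t - 1) ω ^ 2))
    (he : UniformMomentBound P (2 * s) 1 e)
    (hvar : ∀ T : ℕ, 1 ≤ T → ∀ t ∈ Finset.Icc 1 T, ∫ ω, (e T t ω ^ 2 - 1) ∂P = 0)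
    (hc : IsWeightArray h c) :
    UniformBigOInProb P
      (fun T x ω => ∑ i ∈ Finset.Icc 2 T, c T i x * V T (i - 1) ω * e T i ω)
      (stochasticRate h) := by
  have hpos : ∀ᶠ T in atTop, 0 < h T := hh.eventually_basic.mono fun T hT => hT.2.2.1
  obtain ⟨CV, hCV⟩ := hV2.of_sq
  have h12 := Finset.Icc_two_subset_Icc_one
  have hVm : ∀ T : ℕ, 1 ≤ T → ∀ i ∈ Finset.Icc 2 T,
      Measurable[noisePast V e T (i - 1)] (V T (i - 1)) := fun T hT i hi =>
    hm.measurable_state_past hT _ (by have := (Finset.mem_Icc.1 hi).2; omega)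
  have hquad := hm.uniformBigOInProb_sum_sq hq0 hq1 hφ hh hs hθ hV (he.sq_sub_one (by linarith))
    hvar (hc.shift hpos)
  obtain ⟨C, hC⟩ := he
  have hsum : 1 / (2 * s) + 1 / (2 * s) = 1 / s := by field_simp; norm_num
  refine uniformBigOInProb_sum (P := P) (F := noisePast V e) (X := e)
    (A := fun T i => V T (i - 1)) (c := c) (h := h) (θ := θ) (p := 2 * s)
    (b := 1 / (2 * s)) (CX := C) (fun T hT i => hm.noisePast_le hT i) (noisePast_mono V e)
    (fun T _ i hi => measurable_noise_past V e (h12 T hi))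
    (fun T hT i hi => hm.indep_noise_past (h12 T hi))
    (fun T hT i hi => hm.noise_mean T hT i (h12 T hi)) (by linarith)
    (fun T hT i hi => hC T hT i (h12 T hi)) hVm
    (fun ε hε => measure_exists_lt_abs_le (by linarith)
      (fun T hT i hi => (hVm T hT i hi).mono (hm.noisePast_le hT _) le_rfl) hCV hε)
    (by rw [hsum]; exact one_div_le_one_div_of_le two_pos hs.le) (by rw [hsum]; exact hθ) hh hc ?_
  refine hquad.congr (Eventually.of_forall fun T x _ ω => ?_)
  rw [sum_Icc_two_eq_shift (fun i => |c T i x|) (fun j => V T j ω ^ 2)]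
  refine Finset.sum_congr rfl fun j _ => ?_
  split_ifs <;> simp

/-- Weighted averages of the centred squares. -/
theorem uniformBigOInProb_sum_sq_sub (hm : IsTimeVaryingARModel P g φ Y V e)
    (hq0 : 0 < q) (hq1 : q < 1) (hφ : ∀ u ∈ Set.Icc (0 : ℝ) 1, |φ u| ≤ q)
    (hh : IsBandwidth θ h) (hs : 2 < s) (hθ : θ ≤ 1 - 2 * (1 / s))
    (hV : UniformMomentBound P s 1 V)
    (hV2 : UniformMomentBound P s 2 (fun T t ω => V T (t - 1) ω ^ 2))
    (he : UniformMomentBound P (2 * s) 1 e)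
    (hvar : ∀ T : ℕ, 1 ≤ T → ∀ t ∈ Finset.Icc 1 T, ∫ ω, (e T t ω ^ 2 - 1) ∂P = 0)
    {m : ℕ → ℕ → ℝ} {D : ℝ} (hm1 : ∀ T : ℕ, 1 ≤ T → |m T 1| ≤ D)
    (hmrec : ∀ T : ℕ, 1 ≤ T → ∀ t ∈ Finset.Icc 2 T,
      m T t = φ (designPt T t) ^ 2 * m T (t - 1) + 1)
    (hc : IsWeightArray h c) :
    UniformBigOInProb P
      (fun T x ω => ∑ t ∈ Finset.Icc 2 T, c T t x * (V T (t - 1) ω ^ 2 - m T (t - 1)))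
      (stochasticRate h) := by
  have hpos : ∀ᶠ T in atTop, 0 < h T := hh.eventually_basic.mono fun T hT => hT.2.2.1
  have hqq : q ^ 2 < 1 := by nlinarith
  have hc' := (hc.shift hpos).arTransfer hpos (sq_nonneg q) hqq
    (a := fun T t => φ (designPt T t) ^ 2) fun T r hr => by
      rw [abs_pow]
      exact pow_le_pow_left₀ (abs_nonneg _) (abs_coeff_designPt_le hφ T r hr) 2
  set L : ℕ → ℕ → ℝ → ℝ := fun T i x => arTransfer (fun t => φ (designPt T t) ^ 2)
    (fun t => if t + 1 ≤ T then c T (t + 1) x else 0) T i with hL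
  obtain ⟨C, hC⟩ := id hV
  have h1 := hc'.uniformBigOInProb_initial hh (U := fun T ω => V T 1 ω ^ 2 - m T 1) (P := P)
    (D := 1 + C + D) fun T hT => by
      obtain ⟨hi, hle⟩ := integrable_sq_of_lintegral_rpow_le (hm.measurable_state hT hT) hs.le
        (hC T hT 1 (Finset.mem_Icc.2 ⟨le_rfl, hT⟩))
      have hi' : Integrable (fun ω => V T 1 ω ^ 2 - m T 1) P := hi.sub (integrable_const _)
      refine ⟨hi', ?_⟩
      calc ∫ ω, |V T 1 ω ^ 2 - m T 1| ∂P ≤ ∫ ω, (V T 1 ω ^ 2 + D) ∂P := by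
            refine integral_mono hi'.abs (hi.add (integrable_const _)) fun ω => ?_
            have := abs_sub (V T 1 ω ^ 2) (m T 1)
            rw [abs_of_nonneg (sq_nonneg (V T 1 ω))] at this
            have h2 := hm1 T hT
            simp only
            linarith
        _ ≤ 1 + C + D := by
            rw [integral_add hi (integrable_const _)]
            simpa using hle
  have h2 := hm.uniformBigOInProb_sum_noise hh hs hθ hc' (ψ := fun u => u ^ 2 - 1)
    (by fun_prop) hvar (he.sq_sub_one (by linarith))
  have h3 := (hm.uniformBigOInProb_sum_cross hq0 hq1 hφ hh hs hθ hV hV2 he hvar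
    (hc'.mul_bounded (b := fun T i => 2 * φ (designPt T i)) (D := 2) two_pos fun T i hi => by
      rw [abs_mul, abs_two]
      have := hφ _ (designPt_mem (Finset.mem_Icc.1 hi).2)
      linarith))
  refine (h1.add (h2.add h3)).congr ?_
  filter_upwards [eventually_ge_atTop 1] with T hT x _ ω
  rw [sum_Icc_two_eq_shift (fun i => c T i x) (fun j => V T j ω ^ 2 - m T j),
    sum_mul_eq_arTransfer (fun t => φ (designPt T t) ^ 2) _ _
      (fun t => (e T t ω ^ 2 - 1) + 2 * φ (designPt T t) * (V T (t - 1) ω * e T t ω)) hT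
      fun t ht => ?_, ← Finset.sum_add_distrib]
  · refine congrArg _ (Finset.sum_congr rfl fun i _ => ?_)
    ring
  · rw [hm.autoregression T hT t (Finset.Icc_two_subset_Icc_one T ht) ω, hmrec T hT t ht]
    ring

end IsTimeVaryingARModel

/-! ### Second moments of the autoregression -/

/-- First-order Taylor expansion with quadratic remainder on `[0,1]`, uniformly up to the endpoints,
where the derivative is one-sided. -/
theorem exists_taylor_bound {f : ℝ → ℝ} (hf : ContDiffOn ℝ 2 f (Set.Icc 0 1)) :
    ∃ (f' : ℝ → ℝ) (C : ℝ), 0 < C ∧ (∀ x ∈ Set.Icc (0 : ℝ) 1, |f' x| ≤ C) ∧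
      (∀ x ∈ Set.Icc (0 : ℝ) 1, ∀ y ∈ Set.Icc (0 : ℝ) 1,
        |f y - f x - f' x * (y - x)| ≤ C * (y - x) ^ 2) ∧
      ∀ x ∈ Set.Icc (0 : ℝ) 1, ∀ y ∈ Set.Icc (0 : ℝ) 1, |f y - f x| ≤ C * |y - x| := by
  have hu : UniqueDiffOn ℝ (Set.Icc (0 : ℝ) 1) := uniqueDiffOn_Icc one_pos
  set f' := derivWithin f (Set.Icc 0 1) with hf'
  have hf1 : ContDiffOn ℝ 1 f' (Set.Icc 0 1) := hf.derivWithin hu (by norm_num)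
  obtain ⟨C₁, hC₁⟩ := isCompact_Icc.exists_bound_of_continuousOn hf1.continuousOn
  obtain ⟨C₂, hC₂⟩ := isCompact_Icc.exists_bound_of_continuousOn
    (hf1.continuousOn_derivWithin hu (by norm_num))
  have hd : DifferentiableOn ℝ f (Set.Icc 0 1) := hf.differentiableOn (by norm_num)
  have hlip' : ∀ x ∈ Set.Icc (0 : ℝ) 1, ∀ y ∈ Set.Icc (0 : ℝ) 1, |f' y - f' x| ≤ C₂ * |y - x| :=
    fun x hx y hy => (convex_Icc (0 : ℝ) 1).norm_image_sub_le_of_norm_derivWithin_le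
      (hf1.differentiableOn (by norm_num)) hC₂ hx hy
  have hlip : ∀ x ∈ Set.Icc (0 : ℝ) 1, ∀ y ∈ Set.Icc (0 : ℝ) 1, |f y - f x| ≤ C₁ * |y - x| :=
    fun x hx y hy => (convex_Icc (0 : ℝ) 1).norm_image_sub_le_of_norm_derivWithin_le hd hC₁ hx hy
  have hle : C₁ ≤ max (max C₁ C₂) 1 := (le_max_left _ _).trans (le_max_left _ _)
  have hle2 : C₂ ≤ max (max C₁ C₂) 1 := (le_max_right _ _).trans (le_max_left _ _)
  refine ⟨f', max (max C₁ C₂) 1, by positivity, fun x hx => (hC₁ x hx).trans hle,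
    fun x hx y hy => ?_, fun x hx y hy => (hlip x hx y hy).trans (by gcongr)⟩
  -- mean value inequality on the segment for `z ↦ f z - f' x * z`
  have hsub : Set.uIcc x y ⊆ Set.Icc (0 : ℝ) 1 := Set.uIcc_subset_Icc hx hy
  have hC2 : 0 ≤ C₂ := (norm_nonneg _).trans (hC₂ x hx)
  have hder : ∀ z ∈ Set.uIcc x y, HasDerivWithinAt (fun z => f z - f' x * z) (f' z - f' x * 1)
      (Set.uIcc x y) z := by
    intro z hz
    have h1 := ((hd z (hsub hz)).hasDerivWithinAt).mono hsub
    exact h1.sub ((hasDerivWithinAt_id z _).const_mul (f' x))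
  have hb : ∀ z ∈ Set.uIcc x y, ‖f' z - f' x * 1‖ ≤ C₂ * |y - x| := by
    intro z hz
    rw [mul_one]
    refine (hlip' x hx z (hsub hz)).trans ?_
    exact mul_le_mul_of_nonneg_left (Set.abs_sub_left_of_mem_uIcc hz) hC2
  have := (convex_uIcc x y).norm_image_sub_le_of_norm_hasDerivWithin_le hder hb
    Set.left_mem_uIcc Set.right_mem_uIcc
  rw [Real.norm_eq_abs, Real.norm_eq_abs] at this
  calc |f y - f x - f' x * (y - x)| = |f y - f' x * y - (f x - f' x * x)| := by congr 1; ring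
    _ ≤ C₂ * |y - x| * |y - x| := this
    _ = C₂ * (y - x) ^ 2 := by rw [mul_assoc, abs_mul_abs_self, sq]
    _ ≤ _ := by gcongr

/-- The second-moment recursion of a slowly varying autoregression stays within `O(1 / t)` of the
variance `1 / (1 - φ(t / T)²)` of the stationary approximation. -/
theorem exists_secondMoment_approx {φ : ℝ → ℝ} {q : ℝ} (hq0 : 0 < q) (hq1 : q < 1)
    (hφ : ∀ u ∈ Set.Icc (0 : ℝ) 1, |φ u| ≤ q) {Lφ : ℝ} (hLφ : 0 < Lφ)
    (hlip : ∀ x ∈ Set.Icc (0 : ℝ) 1, ∀ y ∈ Set.Icc (0 : ℝ) 1, |φ y - φ x| ≤ Lφ * |y - x|)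
    {m : ℕ → ℕ → ℝ} {D : ℝ} (hm1 : ∀ T : ℕ, 1 ≤ T → |m T 1| ≤ D)
    (hmrec : ∀ T : ℕ, 1 ≤ T → ∀ t ∈ Finset.Icc 2 T,
      m T t = φ (designPt T t) ^ 2 * m T (t - 1) + 1) :
    ∃ C : ℝ, 0 < C ∧
      (∀ x ∈ Set.Icc (0 : ℝ) 1, |1 / (1 - φ x ^ 2)| ≤ C) ∧
      (∀ x ∈ Set.Icc (0 : ℝ) 1, ∀ y ∈ Set.Icc (0 : ℝ) 1,
        |1 / (1 - φ y ^ 2) - 1 / (1 - φ x ^ 2)| ≤ C * |y - x|) ∧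
      ∀ T : ℕ, 1 ≤ T → ∀ t ∈ Finset.Icc 1 T,
        |m T t - 1 / (1 - φ (designPt T t) ^ 2)| ≤ C / t := by
  set r := q ^ 2 with hr
  have hr0 : 0 < r := by positivity
  have hr1 : r < 1 := by rw [hr]; nlinarith
  have h1r : 0 < 1 - r := by linarith
  have hφ2 : ∀ u ∈ Set.Icc (0 : ℝ) 1, φ u ^ 2 ≤ r := fun u hu =>
    sq_le_sq' (abs_le.1 (hφ u hu)).1 (abs_le.1 (hφ u hu)).2
  set S : ℝ → ℝ := fun u => 1 / (1 - φ u ^ 2) with hS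
  have hSb : ∀ u ∈ Set.Icc (0 : ℝ) 1, |S u| ≤ 1 / (1 - r) := by
    intro u hu
    have h1 := hφ2 u hu
    have h2 : 0 < 1 - φ u ^ 2 := by linarith
    rw [hS, abs_of_pos (by positivity)]
    exact one_div_le_one_div_of_le h1r (by linarith)
  set K := 2 * Lφ / (1 - r) ^ 2 with hK
  have hK0 : 0 < K := by positivity
  have hSl : ∀ x ∈ Set.Icc (0 : ℝ) 1, ∀ y ∈ Set.Icc (0 : ℝ) 1, |S y - S x| ≤ K * |y - x| := by
    intro x hx y hy
    have h1 := hφ2 x hx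
    have h2 := hφ2 y hy
    have h1' : 0 < 1 - φ x ^ 2 := by linarith
    have h2' : 0 < 1 - φ y ^ 2 := by linarith
    have e : S y - S x = (φ y - φ x) * (φ y + φ x) / ((1 - φ y ^ 2) * (1 - φ x ^ 2)) := by
      rw [hS]; field_simp; ring
    have h3 : |φ y + φ x| ≤ 2 := by
      have := abs_add_le (φ y) (φ x)
      linarith [hφ x hx, hφ y hy]
    rw [e, abs_div, abs_mul, abs_of_pos (mul_pos h2' h1')]
    calc |φ y - φ x| * |φ y + φ x| / ((1 - φ y ^ 2) * (1 - φ x ^ 2))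
        ≤ (Lφ * |y - x|) * 2 / ((1 - r) * (1 - r)) := by
          have := hlip x hx y hy
          gcongr
      _ = _ := by rw [hK]; ring
  set D0 := |D| + 1 / (1 - r) with hD0
  have hD00 : 0 < D0 := by positivity
  -- `S` solves the stationary equation and moves by `K / T` per step, so that the error contracts
  -- by the factor `r`
  have hrec : ∀ T : ℕ, 1 ≤ T → ∀ t, 1 ≤ t → t ≤ T →
      |m T t - S (designPt T t)| ≤ r ^ (t - 1) * D0 + (K / T) / (1 - r) := by
    intro T hT t ht
    induction t, ht using Nat.le_induction with
    | base =>
      intro _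
      have h1 := abs_sub (m T 1) (S (designPt T 1))
      have h2 := hSb _ (designPt_mem hT)
      have h3 : |m T 1| ≤ |D| := (hm1 T hT).trans (le_abs_self _)
      have h4 : 0 ≤ (K / T) / (1 - r) := by positivity
      simp only [le_refl, tsub_eq_zero_of_le, pow_zero, one_mul]
      linarith
    | succ t ht ih =>
      intro htT
      have ih := ih (by omega)
      have hxt := designPt_mem htT
      have hxt' := designPt_mem (show t ≤ T by omega)
      have hf := hφ2 _ hxt
      have hne : 1 - φ (designPt T (t + 1)) ^ 2 ≠ 0 := by linarith
      have e : m T (t + 1) - S (designPt T (t + 1)) = φ (designPt T (t + 1)) ^ 2 *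
          ((m T t - S (designPt T t)) + (S (designPt T t) - S (designPt T (t + 1)))) := by
        rw [hmrec T hT (t + 1) (Finset.mem_Icc.2 ⟨by omega, htT⟩), Nat.add_sub_cancel]
        have : S (designPt T (t + 1)) =
            φ (designPt T (t + 1)) ^ 2 * S (designPt T (t + 1)) + 1 := by
          simp only [hS]; field_simp; ring
        linear_combination -this
      have hstep : |S (designPt T t) - S (designPt T (t + 1))| ≤ K / T := by
        refine (hSl _ hxt _ hxt').trans (le_of_eq ?_)
        have : designPt T t - designPt T (t + 1) = -(1 / T) := by
          unfold designPt; push_cast; ring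
        rw [this, abs_neg, abs_of_nonneg (by positivity)]
        ring
      have hKT : 0 ≤ K / T := by positivity
      rw [e, abs_mul, abs_of_nonneg (sq_nonneg _), Nat.add_sub_cancel]
      calc φ (designPt T (t + 1)) ^ 2 *
            |(m T t - S (designPt T t)) + (S (designPt T t) - S (designPt T (t + 1)))|
          ≤ r * ((r ^ (t - 1) * D0 + (K / T) / (1 - r)) + K / T) := by
            gcongr
            exact (abs_add_le _ _).trans (add_le_add ih hstep)
        _ = r ^ t * D0 + (K / T) * (r * (1 / (1 - r) + 1)) := by
            obtain ⟨k, rfl⟩ : ∃ k, t = k + 1 := ⟨t - 1, by omega⟩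
            rw [Nat.add_sub_cancel, pow_succ]
            ring
        _ ≤ r ^ t * D0 + (K / T) * (1 / (1 - r)) := by
            gcongr
            rw [← sub_nonneg, show 1 / (1 - r) - r * (1 / (1 - r) + 1) = 1 - r by
              field_simp; ring]
            exact h1r.le
        _ = _ := by ring
  refine ⟨D0 / (1 - r) + K / (1 - r) + 1 / (1 - r) + K, by positivity,
    fun x hx => (hSb x hx).trans ?_, fun x hx y hy => (hSl x hx y hy).trans ?_,
    fun T hT t ht => ?_⟩
  · have : 0 ≤ D0 / (1 - r) + K / (1 - r) := by positivity
    linarith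
  · refine mul_le_mul_of_nonneg_right ?_ (abs_nonneg _)
    have : 0 ≤ D0 / (1 - r) + K / (1 - r) + 1 / (1 - r) := by positivity
    linarith
  · obtain ⟨h1, h2⟩ := Finset.mem_Icc.1 ht
    have htpos : (0 : ℝ) < t := by exact_mod_cast h1
    refine (hrec T hT t h1 h2).trans ?_
    have hgeo : (t : ℝ) * r ^ (t - 1) ≤ 1 / (1 - r) := by
      calc (t : ℝ) * r ^ (t - 1) = ∑ _k ∈ Finset.range t, r ^ (t - 1) := by simp
        _ ≤ ∑ k ∈ Finset.range t, r ^ k := by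
            refine Finset.sum_le_sum fun k hk => ?_
            have := Finset.mem_range.1 hk
            exact pow_le_pow_of_le_one hr0.le hr1.le (by omega)
        _ ≤ 1 / (1 - r) := sum_pow_le_of_injOn hr0.le hr1 _ (fun k => k) fun _ _ _ _ h => h
    have hTt : K / T ≤ K / t := by
      have : (t : ℝ) ≤ T := by exact_mod_cast h2
      gcongr
    rw [le_div_iff₀ htpos]
    calc (r ^ (t - 1) * D0 + (K / T) / (1 - r)) * t
        ≤ (r ^ (t - 1) * D0 + (K / t) / (1 - r)) * t := by gcongr
      _ = D0 * (t * r ^ (t - 1)) + K / (1 - r) := by field_simp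
      _ ≤ D0 * (1 / (1 - r)) + K / (1 - r) := by gcongr
      _ ≤ _ := by
          have : 0 ≤ 1 / (1 - r) + K := by positivity
          rw [mul_one_div]
          linarith

namespace IsTimeVaryingARModel

variable {Ω : Type*} [mΩ : MeasurableSpace Ω] {P : Measure Ω}
  {g φ : ℝ → ℝ} {Y V e : ℕ → ℕ → Ω → ℝ} {s : ℝ}

/-- Since all innovations have the same density, it suffices to bound one moment. For `T = 3` the
innovation at time `2` is a combination of the states at times `1` and `2`, whose squares have
bounded `s`-th moments. -/
theorem noise_moment_two_mul (hm : IsTimeVaryingARModel P g φ Y V e)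
    (har : AutoregressiveConditions P φ e s) (hs : 2 < s)
    (hV2 : UniformMomentBound P s 2 (fun T t ω => V T (t - 1) ω ^ 2)) :
    UniformMomentBound P (2 * s) 1 e := by
  obtain ⟨f, -, -, hlaw, -⟩ := har.noise_density
  obtain ⟨C, hC⟩ := hV2.of_sq
  obtain ⟨q, hq0, hq1, hφ⟩ := har.coeff_bound
  have hs0 : 0 ≤ 2 * s := by linarith
  -- `V T (t - 1)` with `2 ≤ t ≤ T` covers the times `1`, `2` only if `T ≥ 3`
  have heq : ∀ T ≥ 1, ∀ t ∈ Finset.Icc 1 T, ∫⁻ ω, ‖e T t ω‖ₑ ^ (2 * s) ∂P =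
      ∫⁻ ω, ‖e 3 2 ω‖ₑ ^ (2 * s) ∂P := by
    intro T hT t ht
    have h1 : ∀ T ≥ 1, ∀ t ∈ Finset.Icc 1 T, ∫⁻ ω, ‖e T t ω‖ₑ ^ (2 * s) ∂P =
        ∫⁻ u, ‖u‖ₑ ^ (2 * s) ∂(volume.withDensity (fun u => ENNReal.ofReal (f u))) := by
      intro T hT t ht
      rw [← hlaw T hT t ht, lintegral_map (by fun_prop) (hm.measurable_noise T hT t ht)]
    rw [h1 T hT t ht, h1 3 (by norm_num) 2 (by simp)]
  refine ⟨2 ^ (2 * s - 1) * (C + C), fun T hT t ht => ?_⟩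
  rw [heq T hT t ht]
  have he : ∀ ω, e 3 2 ω = V 3 2 ω - φ (designPt 3 2) * V 3 1 ω := fun ω => by
    have := hm.autoregression 3 (by norm_num) 2 (by simp) ω
    rw [this]; ring
  have hm1 : Measurable fun ω => ‖V 3 1 ω‖ₑ ^ (2 * s) :=
    ((hm.measurable_state (T := 3) (t := 1) (by norm_num) (by norm_num)).enorm).pow_const _
  calc ∫⁻ ω, ‖e 3 2 ω‖ₑ ^ (2 * s) ∂P
      ≤ ∫⁻ ω, 2 ^ (2 * s - 1) * (‖V 3 2 ω‖ₑ ^ (2 * s) + ‖V 3 1 ω‖ₑ ^ (2 * s)) ∂P := by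
        refine lintegral_mono fun ω => ?_
        calc ‖e 3 2 ω‖ₑ ^ (2 * s) ≤ (‖V 3 2 ω‖ₑ + ‖V 3 1 ω‖ₑ) ^ (2 * s) := by
              refine ENNReal.rpow_le_rpow ?_ hs0
              rw [he]
              refine enorm_sub_le.trans (add_le_add le_rfl ?_)
              rw [enorm_mul]
              refine mul_le_of_le_one_left (zero_le) ?_
              rw [Real.enorm_eq_ofReal_abs, ENNReal.ofReal_le_one]
              exact (hφ _ (designPt_mem (by norm_num))).trans hq1.le
          _ ≤ _ := ENNReal.rpow_add_le_mul_rpow_add_rpow _ _ (by linarith)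
    _ = 2 ^ (2 * s - 1) * (∫⁻ ω, ‖V 3 2 ω‖ₑ ^ (2 * s) ∂P + ∫⁻ ω, ‖V 3 1 ω‖ₑ ^ (2 * s) ∂P) := by
        rw [lintegral_const_mul' _ _ (ENNReal.rpow_ne_top_of_nonneg (by linarith) (by simp)),
          lintegral_add_right _ hm1]
    _ ≤ 2 ^ (2 * s - 1) * ((C : ℝ≥0∞) + C) := by
        gcongr
        · exact hC 3 (by norm_num) 3 (by simp)
        · exact hC 3 (by norm_num) 2 (by simp)
    _ = _ := by
        push_cast
        rw [ENNReal.coe_rpow_of_nonneg _ (by linarith)]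
        norm_cast

theorem integral_noise_sq_sub_one [IsProbabilityMeasure P]
    (hm : IsTimeVaryingARModel P g φ Y V e)
    (har : AutoregressiveConditions P φ e s) (hs : 2 < s) {T t : ℕ} (hT : 1 ≤ T)
    (ht : t ∈ Finset.Icc 1 T) :
    Integrable (fun ω => e T t ω ^ 2) P ∧ ∫ ω, e T t ω ^ 2 ∂P = 1 ∧
      ∫ ω, (e T t ω ^ 2 - 1) ∂P = 0 := by
  obtain ⟨C, hC⟩ := har.noise_moment
  have hmeas := hm.measurable_noise T hT t ht
  have hi := (integrable_sq_of_lintegral_rpow_le hmeas hs.le (hC T hT t ht)).1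
  have hv := har.noise_variance T hT t ht
  rw [variance_of_integral_eq_zero hmeas.aemeasurable (hm.noise_mean T hT t ht)] at hv
  have hv' : ∫ ω, e T t ω ^ 2 ∂P = 1 := hv
  refine ⟨hi, hv', ?_⟩
  rw [integral_sub hi (integrable_const _), hv']
  simp

/-- The cross term vanishes because the innovation is centred and independent of the past. -/
theorem integral_state_sq [IsProbabilityMeasure P]
    (hm : IsTimeVaryingARModel P g φ Y V e)
    (har : AutoregressiveConditions P φ e s) (hs : 2 < s) (hV : UniformMomentBound P s 1 V)
    {T t : ℕ} (hT : 1 ≤ T) (ht : t ∈ Finset.Icc 2 T) :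
    ∫ ω, V T t ω ^ 2 ∂P = φ (designPt T t) ^ 2 * ∫ ω, V T (t - 1) ω ^ 2 ∂P + 1 := by
  obtain ⟨C, hC⟩ := hV
  have ht1 := Finset.Icc_two_subset_Icc_one T ht
  have htm : t - 1 ∈ Finset.Icc 1 T := by
    have := Finset.mem_Icc.1 ht
    exact Finset.mem_Icc.2 ⟨by omega, by omega⟩
  obtain ⟨hei, he1, -⟩ := hm.integral_noise_sq_sub_one har hs hT ht1
  have hVm := hm.measurable_state hT (Finset.mem_Icc.1 htm).2
  have hem := hm.measurable_noise T hT t ht1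
  have hVi := (integrable_sq_of_lintegral_rpow_le hVm hs.le (hC T hT _ htm)).1
  have hcr : ∫ ω, V T (t - 1) ω * e T t ω ∂P = 0 := by
    have := integral_mul_of_indep (hm.noisePast_le hT (t - 1))
      (hm.measurable_state_past hT (t - 1) (Finset.mem_Icc.1 htm).2) hem
      (hm.indep_noise_past ht1)
    rw [this, hm.noise_mean T hT t ht1, mul_zero]
  have hcri : Integrable (fun ω => V T (t - 1) ω * e T t ω) P := by
    refine (hVi.add hei).mono' (hVm.mul hem).aestronglyMeasurable
      (Eventually.of_forall fun ω => ?_)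
    simp only [Pi.add_apply]
    rw [Real.norm_eq_abs, abs_le]
    constructor <;> nlinarith [sq_nonneg (V T (t - 1) ω + e T t ω),
      sq_nonneg (V T (t - 1) ω - e T t ω), sq_nonneg (V T (t - 1) ω), sq_nonneg (e T t ω)]
  set f := φ (designPt T t) with hf
  have e1 : ∀ ω, V T t ω ^ 2 =
      f ^ 2 * V T (t - 1) ω ^ 2 + (2 * f) * (V T (t - 1) ω * e T t ω) + e T t ω ^ 2 := by
    intro ω
    rw [hm.autoregression T hT t ht1 ω]
    ring
  have i1 := integral_add (hVi.const_mul (f ^ 2)) (hcri.const_mul (2 * f))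
  have i2 := integral_add ((hVi.const_mul (f ^ 2)).add (hcri.const_mul (2 * f))) hei
  simp only [Pi.add_apply] at i2
  simp only [e1]
  rw [i2, i1, integral_const_mul, integral_const_mul, hcr, he1]
  ring

theorem exists_state_sq_le [IsProbabilityMeasure P]
    (hm : IsTimeVaryingARModel P g φ Y V e) (hs : 2 < s)
    (hV : UniformMomentBound P s 1 V) :
    ∃ D : ℝ, ∀ T : ℕ, 1 ≤ T → |∫ ω, V T 1 ω ^ 2 ∂P| ≤ D := by
  obtain ⟨C, hC⟩ := hV
  refine ⟨1 + C, fun T hT => ?_⟩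
  rw [abs_of_nonneg (integral_nonneg fun ω => sq_nonneg _)]
  exact (integrable_sq_of_lintegral_rpow_le (hm.measurable_state hT hT) hs.le
    (hC T hT 1 (Finset.mem_Icc.2 ⟨le_rfl, hT⟩))).2

end IsTimeVaryingARModel

/-! ### Kernel weights on the equidistant design -/

/-- Lipschitz functions with compact support. -/
def IsCompactLipschitz (k : ℝ → ℝ) : Prop :=
  ∃ B Λ L : ℝ, 0 < B ∧ 0 < Λ ∧ 1 ≤ L ∧ (∀ u, |k u| ≤ B) ∧ (∀ u, L < |u| → k u = 0) ∧
    ∀ u u', |k u - k u'| ≤ Λ * |u - u'|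

theorem IsLipschitzKernel.isCompactLipschitz {K : ℝ → ℝ} (hK : IsLipschitzKernel K) :
    IsCompactLipschitz K := by
  obtain ⟨B, hB⟩ := hK.bounded
  obtain ⟨Λ, L, hΛ, hL, hsupp, hlip⟩ := hK.support_lipschitz
  exact ⟨max B 1, Λ, L, by positivity, by linarith, hL, fun u => (hB u).trans (le_max_left _ _),
    hsupp, hlip⟩

theorem IsCompactLipschitz.mul_id {k : ℝ → ℝ} (hk : IsCompactLipschitz k) :
    IsCompactLipschitz (fun u => k u * u) := by
  obtain ⟨B, Λ, L, hB, hΛ, hL, hb, hsupp, hlip⟩ := hk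
  have key : ∀ u u', |u| ≤ L → |k u * u - k u' * u'| ≤ (Λ * L + B) * |u - u'| := by
    intro u u' hu
    have e : k u * u - k u' * u' = (k u - k u') * u + k u' * (u - u') := by ring
    rw [e]
    refine (abs_add_le _ _).trans ?_
    rw [abs_mul, abs_mul]
    have h1 := hlip u u'
    have h2 := hb u'
    calc |k u - k u'| * |u| + |k u'| * |u - u'| ≤ Λ * |u - u'| * L + B * |u - u'| := by gcongr
      _ = _ := by ring
  refine ⟨B * L, Λ * L + B, L, by positivity, by positivity, hL, fun u => ?_, fun u hu => ?_,
    fun u u' => ?_⟩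
  · rcases le_or_gt |u| L with h | h
    · rw [abs_mul]
      have := hb u
      gcongr
    · simp only [hsupp u h, zero_mul, abs_zero]
      positivity
  · simp only [hsupp u hu, zero_mul]
  · rcases le_or_gt |u| L with h | h
    · exact key u u' h
    · rcases le_or_gt |u'| L with h' | h'
      · have := key u' u h'
        rwa [abs_sub_comm, abs_sub_comm u' u] at this
      · simp only [hsupp u h, hsupp u' h', zero_mul, sub_zero, abs_zero]
        positivity

/-- The weight `k((t/T - x)/h) / (T h)`. -/
noncomputable def kernelWeight (k : ℝ → ℝ) (h : ℕ → ℝ) (T t : ℕ) (x : ℝ) : ℝ :=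
  k ((designPt T t - x) / h T) / (T * h T)

theorem card_filter_abs_sub_le (S : Finset ℕ) (a r : ℝ) (hr : 0 ≤ r) :
    ((S.filter fun t : ℕ => |(t : ℝ) - a| ≤ r).card : ℝ) ≤ 2 * r + 1 := by
  have h1 : (S.filter fun t : ℕ => |(t : ℝ) - a| ≤ r).card ≤
      (Finset.Icc ⌈a - r⌉ ⌊a + r⌋).card := by
    refine Finset.card_le_card_of_injOn (fun t : ℕ => (t : ℤ)) ?_ ?_
    · intro t ht
      simp only [Finset.coe_filter, Set.mem_ofPred_eq] at ht
      have := abs_le.1 ht.2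
      simp only [Finset.coe_Icc, Set.mem_Icc]
      constructor
      · rw [Int.ceil_le]; push_cast; linarith
      · rw [Int.le_floor]; push_cast; linarith
    · intro x _ y _ hxy
      simpa using hxy
  calc ((S.filter fun t : ℕ => |(t : ℝ) - a| ≤ r).card : ℝ)
      ≤ ((Finset.Icc ⌈a - r⌉ ⌊a + r⌋).card : ℝ) := by exact_mod_cast h1
    _ ≤ 2 * r + 1 := by
        rw [Int.card_Icc]
        rcases le_total (⌊a + r⌋ + 1 - ⌈a - r⌉) 0 with h | h
        · rw [Int.toNat_of_nonpos h]
          simp only [Nat.cast_zero]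
          positivity
        · have h2 : (((⌊a + r⌋ + 1 - ⌈a - r⌉).toNat : ℤ) : ℝ) =
              ((⌊a + r⌋ + 1 - ⌈a - r⌉ : ℤ) : ℝ) := by rw [Int.toNat_of_nonneg h]
          rw [← Int.cast_natCast, h2]
          push_cast
          have h3 := Int.floor_le (a + r)
          have h4 := Int.le_ceil (a - r)
          linarith

theorem designPt_sub_div {T : ℕ} {h x : ℝ} (hT : 1 ≤ T) (t : ℕ) :
    (designPt T t - x) / h = ((t : ℝ) - T * x) / (T * h) := by
  have hT' : (0 : ℝ) < T := by exact_mod_cast hT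
  unfold designPt
  rw [← mul_div_mul_left _ _ hT'.ne', mul_sub, mul_div_cancel₀ _ hT'.ne']

theorem IsCompactLipschitz.isWeightArray {k : ℝ → ℝ} (hk : IsCompactLipschitz k) {h : ℕ → ℝ}
    {θ : ℝ} (hh : IsBandwidth θ h) : IsWeightArray h (kernelWeight k h) := by
  obtain ⟨B, Λ, L, hB, hΛ, hL, hb, hsupp, hlip⟩ := hk
  refine ⟨B + B * (2 * L + 1) + Λ, by positivity, ?_⟩
  filter_upwards [hh.eventually_basic] with T ⟨h3, hlog, hpos, hle, hN⟩ x
  have hT : (0 : ℝ) < T := by positivity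
  have hN0 : 0 < (T : ℝ) * h T := by positivity
  refine ⟨fun t _ => ?_, ?_, fun x' t _ => ?_⟩
  · rw [kernelWeight, abs_div, abs_of_pos hN0]
    have h1 : 0 ≤ B * (2 * L + 1) + Λ := by positivity
    gcongr
    linarith [hb ((designPt T t - x) / h T)]
  · have h1 : ∑ t ∈ Finset.Icc 1 T, |kernelWeight k h T t x| ≤
        ∑ t ∈ (Finset.Icc 1 T).filter (fun t : ℕ => |(t : ℝ) - T * x| ≤ L * (T * h T)),
          B / (T * h T) := by
      rw [Finset.sum_filter]
      refine Finset.sum_le_sum fun t _ => ?_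
      rw [kernelWeight, abs_div, abs_of_pos hN0]
      split_ifs with h2
      · gcongr
        exact hb _
      · rw [hsupp, abs_zero, zero_div]
        rw [designPt_sub_div (by omega), abs_div, abs_of_pos hN0, lt_div_iff₀ hN0]
        exact not_le.1 h2
    refine h1.trans ?_
    rw [Finset.sum_const, nsmul_eq_mul]
    have h2 := card_filter_abs_sub_le (Finset.Icc 1 T) (T * x) (L * (T * h T)) (by positivity)
    calc _ ≤ (2 * (L * (T * h T)) + 1) * (B / (T * h T)) := by gcongr
      _ ≤ (2 * (L * (T * h T)) + T * h T) * (B / (T * h T)) := by gcongr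
      _ = B * (2 * L + 1) := by field_simp
      _ ≤ _ := by linarith
  · rw [kernelWeight, kernelWeight, ← sub_div, abs_div, abs_of_pos hN0]
    have h1 := hlip ((designPt T t - x) / h T) ((designPt T t - x') / h T)
    have h2 : |(designPt T t - x) / h T - (designPt T t - x') / h T| = |x - x'| / h T := by
      rw [← sub_div, abs_div, abs_of_pos hpos, abs_sub_comm x x']
      congr 2; ring
    rw [h2] at h1
    have h4 : 1 / (h T * (T * h T)) ≤ T := by
      rw [div_le_iff₀ (by positivity)]
      calc (1 : ℝ) ≤ (T * h T) * (T * h T) := one_le_mul_of_one_le_of_one_le hN hN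
        _ = _ := by ring
    calc |k ((designPt T t - x) / h T) - k ((designPt T t - x') / h T)| / (T * h T)
        ≤ Λ * (|x - x'| / h T) / (T * h T) := by gcongr
      _ = Λ * |x - x'| * (1 / (h T * (T * h T))) := by field_simp
      _ ≤ Λ * |x - x'| * T := by gcongr
      _ = Λ * T * |x - x'| := by ring
      _ ≤ _ := by
        gcongr
        have : 0 ≤ B + B * (2 * L + 1) := by positivity
        linarith

/-- Positivity on a set of positive measure, continuity and symmetry give a pair of symmetric
intervals away from the origin on which the kernel is bounded below. -/
theorem IsLipschitzKernel.exists_pos_interval {K : ℝ → ℝ} (hK : IsLipschitzKernel K)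
    (hK' : IsRegularKernel K) :
    ∃ κ a b : ℝ, 0 < κ ∧ 0 < a ∧ a < b ∧ b < 1 ∧ ∀ u, a ≤ |u| → |u| ≤ b → κ ≤ K u := by
  obtain ⟨B, Λ, L, hB, hΛ, hL, hb, hsupp, hlip⟩ := hK.isCompactLipschitz
  obtain ⟨u₀, hu₀, hpos⟩ : ∃ u₀ ∈ Set.Ioo (0 : ℝ) 1, 0 < K u₀ := by
    by_contra hcon
    push Not at hcon
    have hsub : {u ∈ Set.Icc (0 : ℝ) 1 | 0 < K u} ⊆ {0, 1} := by
      rintro u ⟨hu, hKu⟩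
      by_contra hne
      simp only [Set.mem_insert_iff, Set.mem_singleton_iff, not_or] at hne
      exact absurd hKu (not_lt.2 (hcon u ⟨lt_of_le_of_ne hu.1 (Ne.symm hne.1),
        lt_of_le_of_ne hu.2 hne.2⟩))
    have h0 : volume ({0, 1} : Set ℝ) = 0 := (Set.toFinite _).measure_zero _
    exact (hK'.pos_left.trans_le (measure_mono hsub)).ne' h0
  set d := min (K u₀ / 2 / Λ) (min (u₀ / 2) ((1 - u₀) / 2)) with hd
  have h0 := hu₀.1
  have h1 := hu₀.2
  have hd0 : 0 < d := lt_min (by positivity) (lt_min (by linarith) (by linarith))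
  have hd1 : d ≤ K u₀ / 2 / Λ := min_le_left _ _
  have hd2 : d ≤ u₀ / 2 := (min_le_right _ _).trans (min_le_left _ _)
  have hd3 : d ≤ (1 - u₀) / 2 := (min_le_right _ _).trans (min_le_right _ _)
  refine ⟨K u₀ / 2, u₀ - d, u₀ + d, by positivity, by linarith, by linarith, by linarith,
    fun u hu1 hu2 => ?_⟩
  have hKabs : K |u| = K u := by
    rcases abs_choice u with h | h
    · rw [h]
    · rw [h, hK'.symm]
  rw [← hKabs]
  have h2 : |K |u| - K u₀| ≤ K u₀ / 2 := by
    refine (hlip _ _).trans ?_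
    rw [le_div_iff₀ hΛ] at hd1
    have : |(|u| - u₀)| ≤ d := abs_le.2 ⟨by linarith, by linarith⟩
    calc Λ * |(|u| - u₀)| ≤ Λ * d := by gcongr
      _ ≤ _ := by linarith
  linarith [(abs_le.1 h2).1]

theorem le_card_filter_Icc {T : ℕ} {p r : ℝ} (hp : 0 < p) (hr : r ≤ T) :
    r - p - 1 ≤ (((Finset.Icc 1 T).filter fun t : ℕ => p ≤ t ∧ (t : ℝ) ≤ r).card : ℝ) := by
  rcases le_or_gt (r - p - 1) 0 with h | h
  · exact h.trans (Nat.cast_nonneg _)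
  have hr0 : 0 ≤ r := by linarith
  have hsub : Finset.Icc ⌈p⌉₊ ⌊r⌋₊ ⊆
      (Finset.Icc 1 T).filter fun t : ℕ => p ≤ t ∧ (t : ℝ) ≤ r := by
    intro t ht
    obtain ⟨h1, h2⟩ := Finset.mem_Icc.1 ht
    have h3 : p ≤ t := Nat.ceil_le.1 h1
    have h4 : (t : ℝ) ≤ r := (Nat.le_floor_iff hr0).1 h2
    rw [Finset.mem_filter, Finset.mem_Icc]
    refine ⟨⟨?_, ?_⟩, h3, h4⟩
    · have : (0 : ℝ) < t := hp.trans_le h3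
      exact_mod_cast this
    · exact_mod_cast h4.trans hr
  refine le_trans ?_ (Nat.cast_le.2 (Finset.card_le_card hsub))
  rw [Nat.card_Icc]
  have h2 : ⌈p⌉₊ ≤ ⌊r⌋₊ + 1 := by
    have h3 := Nat.ceil_lt_add_one hp.le
    have h4 := Nat.lt_floor_add_one r
    have : ((⌈p⌉₊ : ℕ) : ℝ) < ((⌊r⌋₊ + 1 : ℕ) : ℝ) := by push_cast; linarith
    exact_mod_cast this.le
  rw [Nat.cast_sub h2]
  push_cast
  linarith [Nat.ceil_lt_add_one hp.le, Nat.lt_floor_add_one r]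

/-- A weighted sum over the design is bounded below by the design points whose rescaled position
lies in an interval `[p, r]` on which the kernel and the summand are bounded below. -/
theorem le_sum_kernelWeight_mul {K f : ℝ → ℝ} {h : ℕ → ℝ} {T : ℕ} {x p r κ δ : ℝ} (hT : 1 ≤ T)
    (hpos : 0 < h T) (hK0 : ∀ u, 0 ≤ K u) (hf0 : ∀ u, 0 ≤ f u) (hκ : 0 ≤ κ) (hδ : 0 ≤ δ)
    (hKκ : ∀ u ∈ Set.Icc p r, κ ≤ K u) (hfδ : ∀ u ∈ Set.Icc p r, δ ≤ f u)
    (hp : 0 < x + h T * p) (hr : x + h T * r ≤ 1) (hN : 2 ≤ T * h T * (r - p)) :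
    κ * δ * (r - p) / 2 ≤
      ∑ t ∈ Finset.Icc 1 T, kernelWeight K h T t x * f ((designPt T t - x) / h T) := by
  have hT' : (0 : ℝ) < T := by exact_mod_cast hT
  have hN0 : 0 < (T : ℝ) * h T := by positivity
  have hcard := le_card_filter_Icc (T := T) (p := T * (x + h T * p)) (r := T * (x + h T * r))
    (by positivity) (mul_le_of_le_one_right hT'.le hr)
  calc κ * δ * (r - p) / 2 = (T * h T * (r - p) / 2) * (κ / (T * h T) * δ) := by field_simp
    _ ≤ (((Finset.Icc 1 T).filter fun t : ℕ => T * (x + h T * p) ≤ t ∧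
          (t : ℝ) ≤ T * (x + h T * r)).card : ℝ) * (κ / (T * h T) * δ) := by
        gcongr
        refine le_trans ?_ hcard
        have : T * (x + h T * r) - T * (x + h T * p) = T * h T * (r - p) := by ring
        linarith
    _ = ∑ t ∈ (Finset.Icc 1 T).filter fun t : ℕ => T * (x + h T * p) ≤ t ∧
          (t : ℝ) ≤ T * (x + h T * r), κ / (T * h T) * δ := by
        rw [Finset.sum_const, nsmul_eq_mul]
    _ ≤ ∑ t ∈ Finset.Icc 1 T, kernelWeight K h T t x * f ((designPt T t - x) / h T) := by
        rw [Finset.sum_filter]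
        refine Finset.sum_le_sum fun t _ => ?_
        have hw : 0 ≤ kernelWeight K h T t x := div_nonneg (hK0 _) hN0.le
        split_ifs with hcond
        · have hmem : (designPt T t - x) / h T ∈ Set.Icc p r := by
            rw [designPt_sub_div hT, Set.mem_Icc, le_div_iff₀ hN0, div_le_iff₀ hN0]
            constructor
            · linarith [hcond.1]
            · linarith [hcond.2]
          refine mul_le_mul ?_ (hfδ _ hmem) hδ hw
          unfold kernelWeight
          have := hKκ _ hmem
          gcongr
        · exact mul_nonneg hw (hf0 _)

/-- Lower bounds for the local design, uniform on `[0,1]` including the boundary. For `x ≤ 1/2`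
the design points to the right of `x` are used, for `x > 1/2` those to the left. -/
theorem IsLipschitzKernel.exists_design_lower_bound {K : ℝ → ℝ} (hK : IsLipschitzKernel K)
    (hK' : IsRegularKernel K) {h : ℕ → ℝ} {θ : ℝ} (hh : IsBandwidth θ h) :
    ∃ c : ℝ, 0 < c ∧ ∀ᶠ T : ℕ in atTop, ∀ x ∈ Set.Icc (0 : ℝ) 1,
      c ≤ ∑ t ∈ Finset.Icc 1 T, kernelWeight K h T t x ∧
      ∀ z : ℝ, c ≤ ∑ t ∈ Finset.Icc 1 T,
        kernelWeight K h T t x * ((designPt T t - x) / h T - z) ^ 2 := by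
  obtain ⟨κ, a, b, hκ, ha, hab, hb, hKκ⟩ := hK.exists_pos_interval hK'
  set l := (b - a) / 3 with hl
  have hl0 : 0 < l := by rw [hl]; linarith
  have hl1 : l ≤ 1 := by rw [hl]; linarith
  refine ⟨κ * (l / 2) ^ 2 * l / 2, by positivity, ?_⟩
  have hhalf : ∀ᶠ T in atTop, h T ≤ 1 / 2 :=
    hh.tendsto_zero.eventually (ge_mem_nhds (by norm_num))
  filter_upwards [hh.eventually_basic, hhalf, hh.tendsto_mul.eventually_ge_atTop (2 / l)] with T
    ⟨h3, hlog, hpos, hle, hN⟩ hhalf hlarge x hx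
  have hT : 1 ≤ T := by omega
  rw [div_le_iff₀ hl0] at hlarge
  -- the general bound on a subinterval of length `l`
  have key : ∀ (f : ℝ → ℝ) (δ p : ℝ), (∀ u, 0 ≤ f u) → 0 ≤ δ →
      (∀ u ∈ Set.Icc p (p + l), a ≤ |u| ∧ |u| ≤ b) → (∀ u ∈ Set.Icc p (p + l), δ ≤ f u) →
      0 < x + h T * p → x + h T * (p + l) ≤ 1 → κ * δ * l / 2 ≤
        ∑ t ∈ Finset.Icc 1 T, kernelWeight K h T t x * f ((designPt T t - x) / h T) := by
    intro f δ p hf hδ hp hfδ h1 h2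
    have := le_sum_kernelWeight_mul (K := K) (f := f) (h := h) (T := T) (x := x) (p := p)
      (r := p + l) (κ := κ) (δ := δ) hT hpos hK'.nonneg hf hκ.le hδ
      (fun u hu => hKκ u (hp u hu).1 (hp u hu).2) hfδ h1 h2 (by simpa using hlarge)
    simpa using this
  -- a left endpoint `p₀` such that `[p₀, p₀ + 3 l]` is admissible
  obtain ⟨p₀, hp1, hp2, hp3⟩ : ∃ p₀ : ℝ, (∀ u, p₀ ≤ u → u ≤ p₀ + 3 * l → a ≤ |u| ∧ |u| ≤ b) ∧
      0 < x + h T * p₀ ∧ x + h T * (p₀ + 3 * l) ≤ 1 := by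
    have h3l : 3 * l = b - a := by rw [hl]; ring
    rcases le_or_gt x (1 / 2) with hx2 | hx2
    · refine ⟨a, fun u h1 h2 => ?_, ?_, ?_⟩
      · rw [abs_of_nonneg (by linarith)]
        exact ⟨h1, by linarith⟩
      · have := mul_pos hpos ha
        linarith [hx.1]
      · have : h T * (a + 3 * l) ≤ 1 / 2 * 1 := by
          apply mul_le_mul hhalf (by linarith) (by linarith) (by norm_num)
        linarith
    · refine ⟨-b, fun u h1 h2 => ?_, ?_, ?_⟩
      · rw [abs_of_nonpos (by linarith)]
        constructor <;> linarith
      · have : h T * b ≤ 1 / 2 * 1 := by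
          apply mul_le_mul hhalf (by linarith) (by linarith) (by norm_num)
        linarith
      · have h4 : h T * (-b + 3 * l) ≤ 0 := mul_nonpos_of_nonneg_of_nonpos hpos.le (by linarith)
        linarith [hx.2]
  have mono1 : h T * (p₀ + l) ≤ h T * (p₀ + 3 * l) := by gcongr; linarith
  constructor
  · have h1 := key (fun _ => 1) 1 p₀ (fun _ => zero_le_one) zero_le_one
      (fun u hu => hp1 u hu.1 (by linarith [hu.2])) (fun _ _ => le_rfl) hp2 (by linarith)
    simp only [mul_one] at h1
    refine le_trans ?_ h1
    have : (l / 2) ^ 2 ≤ 1 := by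
      apply pow_le_one₀ <;> linarith
    calc κ * (l / 2) ^ 2 * l / 2 ≤ κ * 1 * l / 2 := by gcongr
      _ = _ := by ring
  · intro z
    rcases le_total z (p₀ + 3 * l / 2) with hz | hz
    · refine key (fun u => (u - z) ^ 2) ((l / 2) ^ 2) (p₀ + 2 * l) (fun u => sq_nonneg _)
        (sq_nonneg _) (fun u hu => hp1 u (by linarith [hu.1]) (by linarith [hu.2])) ?_ ?_ ?_
      · intro u hu
        apply pow_le_pow_left₀ (by positivity)
        linarith [hu.1]
      · have : h T * p₀ ≤ h T * (p₀ + 2 * l) := by gcongr; linarith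
        linarith
      · rw [show p₀ + 2 * l + l = p₀ + 3 * l by ring]
        exact hp3
    · refine key (fun u => (u - z) ^ 2) ((l / 2) ^ 2) p₀ (fun u => sq_nonneg _)
        (sq_nonneg _) (fun u hu => hp1 u hu.1 (by linarith [hu.2])) ?_ hp2 (by linarith)
      intro u hu
      rw [← neg_sub z u, neg_sq]
      apply pow_le_pow_left₀ (by positivity)
      linarith [hu.2]

/-! ### The local linear estimator -/

theorem kernelMoment_eq {K : ℝ → ℝ} {h : ℕ → ℝ} {T : ℕ} (j : ℕ) (x : ℝ) :
    kernelMoment K (h T) T j x =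
      ∑ t ∈ Finset.Icc 1 T, kernelWeight K h T t x * ((designPt T t - x) / h T) ^ j := by
  rw [kernelMoment, Finset.mul_sum]
  refine Finset.sum_congr rfl fun t _ => ?_
  rw [kernelWeight, scaledKernel, mul_comm (T : ℝ), ← div_div]
  ring

theorem kernelDataMoment_eq {K : ℝ → ℝ} {h : ℕ → ℝ} {T : ℕ} (j : ℕ) (y : ℕ → ℝ) (x : ℝ) :
    kernelDataMoment K (h T) T j y x =
      ∑ t ∈ Finset.Icc 1 T, kernelWeight K h T t x * ((designPt T t - x) / h T) ^ j * y t := by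
  rw [kernelDataMoment, Finset.mul_sum]
  refine Finset.sum_congr rfl fun t _ => ?_
  rw [kernelWeight, scaledKernel, mul_comm (T : ℝ), ← div_div]
  ring

/-- Cramer's rule for the first coordinate. When the determinant vanishes, both sides are zero. -/
theorem localLinearEstimator_eq (K : ℝ → ℝ) (h : ℝ) (T : ℕ) (y : ℕ → ℝ) (x : ℝ) :
    localLinearEstimator K h T y x =
      (kernelMoment K h T 2 x * kernelDataMoment K h T 0 y x -
        kernelMoment K h T 1 x * kernelDataMoment K h T 1 y x) /
      (kernelMoment K h T 0 x * kernelMoment K h T 2 x - kernelMoment K h T 1 x ^ 2) := by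
  rw [localLinearEstimator, localLinearMatrix, localLinearVector, Matrix.inv_def,
    Matrix.adjugate_fin_two_of, Matrix.det_fin_two_of, Ring.inverse_eq_inv']
  simp [Matrix.mulVec, dotProduct, Fin.sum_univ_two]
  ring

theorem localLinearEstimator_add (K : ℝ → ℝ) (h : ℝ) (T : ℕ) {y y₁ y₂ : ℕ → ℝ} (x : ℝ)
    (hy : ∀ t ∈ Finset.Icc 1 T, y t = y₁ t + y₂ t) :
    localLinearEstimator K h T y x =
      localLinearEstimator K h T y₁ x + localLinearEstimator K h T y₂ x := by
  have hd : ∀ j, kernelDataMoment K h T j y x =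
      kernelDataMoment K h T j y₁ x + kernelDataMoment K h T j y₂ x := by
    intro j
    simp only [kernelDataMoment]
    rw [← mul_add, ← Finset.sum_add_distrib]
    refine congrArg _ (Finset.sum_congr rfl fun t ht => ?_)
    rw [hy t ht]
    ring
  simp only [localLinearEstimator_eq, hd]
  ring

/-- Uniform control of the local linear fit: it is bounded by the two data moments, and its bias
for a regression function with quadratic Taylor remainder is `O(h²)`. -/
theorem exists_localLinearEstimator_bounds {K g : ℝ → ℝ} (hK : IsLipschitzKernel K)
    (hK' : IsRegularKernel K) (hg : ContDiffOn ℝ 2 g (Set.Icc 0 1)) {h : ℕ → ℝ} {θ : ℝ}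
    (hh : IsBandwidth θ h) :
    ∃ C : ℝ, 0 < C ∧ ∀ᶠ T : ℕ in atTop, ∀ x ∈ Set.Icc (0 : ℝ) 1,
      (∀ y : ℕ → ℝ, |localLinearEstimator K (h T) T y x| ≤
        C * (|∑ t ∈ Finset.Icc 1 T, kernelWeight K h T t x * y t| +
          |∑ t ∈ Finset.Icc 1 T, kernelWeight (fun u => K u * u) h T t x * y t|)) ∧
      |localLinearEstimator K (h T) T (fun t => g (designPt T t)) x - g x| ≤ C * h T ^ 2 := by
  obtain ⟨c, hc, hlow⟩ := hK.exists_design_lower_bound hK' hh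
  have k0 := hK.isCompactLipschitz
  obtain ⟨C₀, hC₀, w0⟩ := k0.isWeightArray hh
  obtain ⟨C₁, hC₁, w1⟩ := k0.mul_id.isWeightArray hh
  obtain ⟨C₂, hC₂, w2⟩ := k0.mul_id.mul_id.isWeightArray hh
  obtain ⟨C₃, hC₃, w3⟩ := k0.mul_id.mul_id.mul_id.isWeightArray hh
  obtain ⟨g', Cg, hCg, -, htaylor, -⟩ := exists_taylor_bound hg
  refine ⟨max ((C₁ + C₂) / c ^ 2) ((C₂ * (Cg * C₂) + C₁ * (Cg * C₃)) / c ^ 2), by positivity, ?_⟩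
  filter_upwards [hlow, w0, w1, w2, w3, hh.eventually_basic] with T hlow w0 w1 w2 w3
    ⟨h3, hlog, hpos, hle, hN⟩ x hx
  obtain ⟨hs0, hvar⟩ := hlow x hx
  set u : ℕ → ℝ := fun t => (designPt T t - x) / h T with hu
  set w : ℕ → ℝ := fun t => kernelWeight K h T t x with hw
  have e1 : ∀ t, kernelWeight (fun u => K u * u) h T t x = w t * u t := fun t => by
    simp only [hw, hu, kernelWeight]; ring
  have e2 : ∀ t, kernelWeight (fun u => K u * u * u) h T t x = w t * u t ^ 2 := fun t => by
    simp only [hw, hu, kernelWeight]; ring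
  have e3 : ∀ t, kernelWeight (fun u => K u * u * u * u) h T t x = w t * u t ^ 3 := fun t => by
    simp only [hw, hu, kernelWeight]; ring
  set s0 := kernelMoment K (h T) T 0 x with hs0def
  set s1 := kernelMoment K (h T) T 1 x with hs1def
  set s2 := kernelMoment K (h T) T 2 x with hs2def
  have hs0e : s0 = ∑ t ∈ Finset.Icc 1 T, w t := by rw [hs0def, kernelMoment_eq]; simp [hw]
  have hs1e : s1 = ∑ t ∈ Finset.Icc 1 T, w t * u t := by
    rw [hs1def, kernelMoment_eq]; simp [hw, hu]
  have hs2e : s2 = ∑ t ∈ Finset.Icc 1 T, w t * u t ^ 2 := by rw [hs2def, kernelMoment_eq]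
  have hs0c : c ≤ s0 := by rw [hs0e]; exact hs0
  have hs0p : 0 < s0 := hc.trans_le hs0c
  have a2 := (w2 x).2.1
  have a3 := (w3 x).2.1
  simp only [e2] at a2
  simp only [e3] at a3
  have hs1b : |s1| ≤ C₁ := by
    have := (w1 x).2.1
    simp only [e1] at this
    rw [hs1e]
    exact (Finset.abs_sum_le_sum_abs _ _).trans this
  have hs2b : |s2| ≤ C₂ := by
    rw [hs2e]
    exact (Finset.abs_sum_le_sum_abs _ _).trans a2
  -- the determinant is `s0` times the weighted variance of the rescaled design
  have hdet : c ^ 2 ≤ s0 * s2 - s1 ^ 2 := by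
    have h1 := hvar (s1 / s0)
    have h2 : ∑ t ∈ Finset.Icc 1 T, w t * (u t - s1 / s0) ^ 2 =
        s2 - 2 * (s1 / s0) * s1 + (s1 / s0) ^ 2 * s0 := by
      rw [hs2e, hs1e, hs0e, Finset.mul_sum, Finset.mul_sum, ← Finset.sum_sub_distrib,
        ← Finset.sum_add_distrib]
      exact Finset.sum_congr rfl fun t _ => by ring
    have h3 : s0 * (s2 - 2 * (s1 / s0) * s1 + (s1 / s0) ^ 2 * s0) = s0 * s2 - s1 ^ 2 := by
      field_simp
      ring
    rw [← h3, ← h2, sq]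
    exact mul_le_mul hs0c h1 hc.le hs0p.le
  have hdetp : 0 < s0 * s2 - s1 ^ 2 := lt_of_lt_of_le (by positivity) hdet
  have hd0 : ∀ y, kernelDataMoment K (h T) T 0 y x = ∑ t ∈ Finset.Icc 1 T, w t * y t := by
    intro y; rw [kernelDataMoment_eq]; simp [hw]
  have hd1 : ∀ y, kernelDataMoment K (h T) T 1 y x = ∑ t ∈ Finset.Icc 1 T, w t * u t * y t := by
    intro y; rw [kernelDataMoment_eq]; simp [hw, hu]
  constructor
  · intro y
    simp only [e1]
    rw [localLinearEstimator_eq, hd0, hd1, abs_div, abs_of_pos hdetp]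
    set d0 := ∑ t ∈ Finset.Icc 1 T, w t * y t
    set d1 := ∑ t ∈ Finset.Icc 1 T, w t * u t * y t
    calc |s2 * d0 - s1 * d1| / (s0 * s2 - s1 ^ 2) ≤ ((C₁ + C₂) * (|d0| + |d1|)) / c ^ 2 := by
          gcongr
          calc |s2 * d0 - s1 * d1| ≤ |s2| * |d0| + |s1| * |d1| := by
                rw [← abs_mul, ← abs_mul]; exact abs_sub _ _
            _ ≤ C₂ * |d0| + C₁ * |d1| := by gcongr
            _ ≤ _ := by nlinarith [mul_nonneg hC₁.le (abs_nonneg d0),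
                  mul_nonneg hC₂.le (abs_nonneg d1)]
      _ = (C₁ + C₂) / c ^ 2 * (|d0| + |d1|) := by ring
      _ ≤ _ := by
        gcongr
        exact le_max_left _ _
  · -- the fit reproduces affine functions, so only the Taylor remainder contributes
    set R : ℕ → ℝ := fun t => g (designPt T t) - g x - g' x * (designPt T t - x) with hR
    set r0 := ∑ t ∈ Finset.Icc 1 T, w t * R t with hr0
    set r1 := ∑ t ∈ Finset.Icc 1 T, w t * u t * R t with hr1
    have hxu : ∀ t, designPt T t - x = h T * u t := fun t => by
      simp only [hu]; field_simp
    have hRb : ∀ t ∈ Finset.Icc 1 T, |R t| ≤ Cg * h T ^ 2 * u t ^ 2 := by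
      intro t ht
      refine (htaylor x hx _ (designPt_mem (Finset.mem_Icc.1 ht).2)).trans (le_of_eq ?_)
      rw [hxu]; ring
    have hd0g : ∑ t ∈ Finset.Icc 1 T, w t * g (designPt T t) =
        g x * s0 + g' x * h T * s1 + r0 := by
      rw [hs0e, hs1e, hr0, Finset.mul_sum, Finset.mul_sum, ← Finset.sum_add_distrib,
        ← Finset.sum_add_distrib]
      refine Finset.sum_congr rfl fun t _ => ?_
      have : g (designPt T t) = g x + g' x * (h T * u t) + R t := by
        rw [← hxu]; simp only [hR]; ring
      rw [this]; ring
    have hd1g : ∑ t ∈ Finset.Icc 1 T, w t * u t * g (designPt T t) =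
        g x * s1 + g' x * h T * s2 + r1 := by
      rw [hs1e, hs2e, hr1, Finset.mul_sum, Finset.mul_sum, ← Finset.sum_add_distrib,
        ← Finset.sum_add_distrib]
      refine Finset.sum_congr rfl fun t _ => ?_
      have : g (designPt T t) = g x + g' x * (h T * u t) + R t := by
        rw [← hxu]; simp only [hR]; ring
      rw [this]; ring
    have hr0b : |r0| ≤ Cg * C₂ * h T ^ 2 := by
      calc |r0| ≤ ∑ t ∈ Finset.Icc 1 T, |w t * R t| := Finset.abs_sum_le_sum_abs _ _
        _ ≤ ∑ t ∈ Finset.Icc 1 T, Cg * h T ^ 2 * |w t * u t ^ 2| := by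
            refine Finset.sum_le_sum fun t ht => ?_
            rw [abs_mul, abs_mul, abs_of_nonneg (sq_nonneg (u t))]
            calc |w t| * |R t| ≤ |w t| * (Cg * h T ^ 2 * u t ^ 2) :=
                  mul_le_mul_of_nonneg_left (hRb t ht) (abs_nonneg _)
              _ = _ := by ring
        _ ≤ Cg * h T ^ 2 * C₂ := by rw [← Finset.mul_sum]; gcongr
        _ = _ := by ring
    have hr1b : |r1| ≤ Cg * C₃ * h T ^ 2 := by
      calc |r1| ≤ ∑ t ∈ Finset.Icc 1 T, |w t * u t * R t| := Finset.abs_sum_le_sum_abs _ _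
        _ ≤ ∑ t ∈ Finset.Icc 1 T, Cg * h T ^ 2 * |w t * u t ^ 3| := by
            refine Finset.sum_le_sum fun t ht => ?_
            rw [abs_mul, abs_mul, abs_mul, abs_pow]
            calc |w t| * |u t| * |R t| ≤ |w t| * |u t| * (Cg * h T ^ 2 * u t ^ 2) :=
                  mul_le_mul_of_nonneg_left (hRb t ht) (by positivity)
              _ = |w t| * |u t| * (Cg * h T ^ 2 * |u t| ^ 2) := by rw [sq_abs]
              _ = _ := by ring
        _ ≤ Cg * h T ^ 2 * C₃ := by rw [← Finset.mul_sum]; gcongr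
        _ = _ := by ring
    have hbias : localLinearEstimator K (h T) T (fun t => g (designPt T t)) x - g x =
        (s2 * r0 - s1 * r1) / (s0 * s2 - s1 ^ 2) := by
      rw [localLinearEstimator_eq, hd0, hd1, hd0g, hd1g, eq_div_iff hdetp.ne', sub_mul,
        div_mul_cancel₀ _ hdetp.ne']
      ring
    rw [hbias, abs_div, abs_of_pos hdetp]
    calc |s2 * r0 - s1 * r1| / (s0 * s2 - s1 ^ 2)
        ≤ (C₂ * (Cg * C₂ * h T ^ 2) + C₁ * (Cg * C₃ * h T ^ 2)) / c ^ 2 := by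
          gcongr
          calc |s2 * r0 - s1 * r1| ≤ |s2| * |r0| + |s1| * |r1| := by
                rw [← abs_mul, ← abs_mul]; exact abs_sub _ _
            _ ≤ _ := by gcongr
      _ = (C₂ * (Cg * C₂) + C₁ * (Cg * C₃)) / c ^ 2 * h T ^ 2 := by ring
      _ ≤ _ := by
        gcongr
        exact le_max_right _ _

theorem enorm_le_ofReal_iff_abs {a b : ℝ} (hb : 0 ≤ b) : ‖a‖ₑ ≤ ENNReal.ofReal b ↔ |a| ≤ b := by
  rw [Real.enorm_eq_ofReal_abs, ENNReal.ofReal_le_ofReal_iff hb]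

theorem supError_le_ofReal {S : Set ℝ} {f f₀ : ℝ → ℝ} {b : ℝ} (hb : ∀ x ∈ S, |f x - f₀ x| ≤ b) :
    supError S f f₀ ≤ ENNReal.ofReal b := by
  refine iSup₂_le fun x hx => ?_
  rw [Real.enorm_eq_ofReal_abs]
  exact ENNReal.ofReal_le_ofReal (hb x hx)

theorem abs_toReal_supError_sub_le {S : Set ℝ} {f f₁ f₀ : ℝ → ℝ} {b : ℝ} (hb0 : 0 ≤ b)
    (hb : ∀ x ∈ S, |f x - f₁ x| ≤ b) (hfin : supError S f f₀ ≠ ⊤)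
    (hfin₁ : supError S f₁ f₀ ≠ ⊤) :
    |(supError S f f₀).toReal - (supError S f₁ f₀).toReal| ≤ b := by
  have key : ∀ f f₁ : ℝ → ℝ, (∀ x ∈ S, |f x - f₁ x| ≤ b) → supError S f₁ f₀ ≠ ⊤ →
      (supError S f f₀).toReal ≤ (supError S f₁ f₀).toReal + b := by
    intro f f₁ hb hfin₁
    refine ENNReal.toReal_le_of_le_ofReal (by positivity) ?_
    rw [ENNReal.ofReal_add ENNReal.toReal_nonneg hb0, ENNReal.ofReal_toReal hfin₁]
    refine iSup₂_le fun x hx => ?_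
    have h1 : f x - f₀ x = (f₁ x - f₀ x) + (f x - f₁ x) := by ring
    rw [h1]
    refine (enorm_add_le _ _).trans (add_le_add ?_ ((enorm_le_ofReal_iff_abs hb0).2 (hb x hx)))
    exact le_iSup₂ (f := fun x (_ : x ∈ S) => ‖f₁ x - f₀ x‖ₑ) x hx
  have h1 := key f f₁ hb hfin₁
  have h2 := key f₁ f (fun x hx => by rw [abs_sub_comm]; exact hb x hx) hfin
  rw [abs_le]
  constructor <;> linarith

namespace IsTimeVaryingARModel

variable {Ω : Type*} [mΩ : MeasurableSpace Ω] {P : Measure Ω} [IsProbabilityMeasure P]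
  {g φ : ℝ → ℝ} {Y V e : ℕ → ℕ → Ω → ℝ} {K : ℝ → ℝ} {h : ℕ → ℝ} {θ s : ℝ}

theorem uniformBigOInProb_localLinear (hm : IsTimeVaryingARModel P g φ Y V e)
    (har : AutoregressiveConditions P φ e s) (hK : IsLipschitzKernel K) (hK' : IsRegularKernel K)
    (hg : ContDiffOn ℝ 2 g (Set.Icc 0 1)) (hh : IsBandwidth θ h) (hs : 2 < s)
    (hθ : θ ≤ 1 - 2 * (1 / s)) (hV : UniformMomentBound P s 1 V) :
    UniformBigOInProb P (fun T x ω => localLinearEstimator K (h T) T (fun t => V T t ω) x)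
      (stochasticRate h) := by
  obtain ⟨q, hq0, hq1, hφ⟩ := har.coeff_bound
  obtain ⟨C, hC, hT⟩ := exists_localLinearEstimator_bounds hK hK' hg hh
  have k0 := hK.isCompactLipschitz
  have h0 := hm.uniformBigOInProb_sum_state hq0.le hq1 hφ hh hs hθ hV har.noise_moment
    (k0.isWeightArray hh)
  have h1 := hm.uniformBigOInProb_sum_state hq0.le hq1 hφ hh hs hθ hV har.noise_moment
    (k0.mul_id.isWeightArray hh)
  have habs : ∀ {Z : ℕ → ℝ → Ω → ℝ}, UniformBigOInProb P Z (stochasticRate h) →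
      UniformBigOInProb P (fun T x ω => |Z T x ω|) (stochasticRate h) := fun hZ =>
    hZ.mono 1 one_pos (Eventually.of_forall fun T x _ ω => by rw [abs_abs, one_mul])
  refine ((habs h0).add (habs h1)).mono C hC ?_
  filter_upwards [hT] with T hT x hx ω
  exact ((hT x hx).1 _).trans (mul_le_mul_of_nonneg_left (le_abs_self _) hC.le)

/-- The deterministic term is the uniform bias, and the remainder is the difference between the
uniform error and the bias, which is at most the uniform size of the fit to the states. -/
theorem localLinear_decomposition (hm : IsTimeVaryingARModel P g φ Y V e)
    (har : AutoregressiveConditions P φ e s) (hK : IsLipschitzKernel K) (hK' : IsRegularKernel K)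
    (hg : ContDiffOn ℝ 2 g (Set.Icc 0 1)) (hh : IsBandwidth θ h) (hs : 2 < s)
    (hθ : θ ≤ 1 - 2 * (1 / s)) (hV : UniformMomentBound P s 1 V) :
    ∃ (B : ℕ → ℝ) (R : ℕ → Ω → ℝ),
      B =O[atTop] (fun T => h T ^ 2) ∧
      IsBigOInProb P (fun T ω => ‖R T ω‖ₑ) (stochasticRate h) ∧
      ∀ᶠ T in atTop, ∀ ω,
        ((supError (Set.Icc 0 1)
          (localLinearEstimator K (h T) T (fun t => Y T t ω)) g : ℝ≥0∞) : EReal)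
          = ((B T + R T ω : ℝ) : EReal) := by
  obtain ⟨C, hC, hT⟩ := exists_localLinearEstimator_bounds hK hK' hg hh
  have k0 := hK.isCompactLipschitz
  obtain ⟨C₀, hC₀, w0⟩ := k0.isWeightArray hh
  obtain ⟨C₁, hC₁, w1⟩ := k0.mul_id.isWeightArray hh
  have hstoch := hm.uniformBigOInProb_localLinear har hK hK' hg hh hs hθ hV
  set E : ℕ → ℝ≥0∞ := fun T => supError (Set.Icc 0 1)
    (localLinearEstimator K (h T) T (fun t => g (designPt T t))) g with hE
  set S : ℕ → Ω → ℝ≥0∞ := fun T ω => supError (Set.Icc 0 1)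
    (localLinearEstimator K (h T) T (fun t => Y T t ω)) g with hS
  have hlin : ∀ T : ℕ, 1 ≤ T → ∀ ω x, localLinearEstimator K (h T) T (fun t => Y T t ω) x =
      localLinearEstimator K (h T) T (fun t => g (designPt T t)) x +
        localLinearEstimator K (h T) T (fun t => V T t ω) x := fun T hT1 ω x =>
    localLinearEstimator_add K (h T) T x fun t ht => hm.observation T hT1 t ht ω
  have hEle : ∀ᶠ T in atTop, E T ≤ ENNReal.ofReal (C * h T ^ 2) := by
    filter_upwards [hT] with T hT
    exact supError_le_ofReal fun x hx => (hT x hx).2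
  -- finiteness for every `ω`, so that the uniform error is a real number
  have hSfin : ∀ᶠ T in atTop, ∀ ω, S T ω ≠ ⊤ := by
    filter_upwards [hT, w0, w1, eventually_ge_atTop 1, hh.eventually_basic] with T hT w0 w1 hT1
      ⟨h3, hlog, hpos, hle, hN⟩ ω
    have hb : ∀ (c : ℕ → ℝ) (D : ℝ), (∀ t ∈ Finset.Icc 1 T, |c t| ≤ D) →
        |∑ t ∈ Finset.Icc 1 T, c t * V T t ω| ≤ D * ∑ t ∈ Finset.Icc 1 T, |V T t ω| := by
      intro c D hc
      refine (Finset.abs_sum_le_sum_abs _ _).trans ?_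
      rw [Finset.mul_sum]
      refine Finset.sum_le_sum fun t ht => ?_
      rw [abs_mul]
      exact mul_le_mul_of_nonneg_right (hc t ht) (abs_nonneg _)
    refine ne_top_of_le_ne_top ENNReal.ofReal_ne_top (supError_le_ofReal
      (b := C * h T ^ 2 + C * (C₀ / (T * h T) * ∑ t ∈ Finset.Icc 1 T, |V T t ω| +
        C₁ / (T * h T) * ∑ t ∈ Finset.Icc 1 T, |V T t ω|)) fun x hx => ?_)
    rw [hlin T hT1 ω x, add_sub_right_comm]
    refine (abs_add_le _ _).trans (add_le_add (hT x hx).2 (((hT x hx).1 _).trans ?_))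
    gcongr
    · exact hb _ _ (w0 x).1
    · exact hb _ _ (w1 x).1
  refine ⟨fun T => (E T).toReal, fun T ω => (S T ω).toReal - (E T).toReal, ?_, ?_, ?_⟩
  · refine IsBigO.of_bound C ?_
    filter_upwards [hEle] with T h1
    rw [Real.norm_of_nonneg ENNReal.toReal_nonneg, Real.norm_of_nonneg (sq_nonneg _)]
    exact ENNReal.toReal_le_of_le_ofReal (by positivity) h1
  · intro ε hε
    obtain ⟨M, hM, hMT⟩ := hstoch ε hε
    refine ⟨M, hM, ?_⟩
    filter_upwards [hMT, hEle, hSfin, eventually_ge_atTop 1] with T h1 h2 h3 hT1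
    refine (measure_mono fun ω hω => ?_).trans h1
    have hr : 0 ≤ M * stochasticRate h T := mul_nonneg hM.le (stochasticRate_nonneg h T)
    by_contra hcon
    simp only [Set.mem_ofPred_eq, not_exists, not_and, not_lt] at hcon hω
    rw [← not_le, enorm_le_ofReal_iff_abs hr] at hω
    refine hω (abs_toReal_supError_sub_le hr (fun x hx => ?_) (h3 ω)
      (ne_top_of_le_ne_top ENNReal.ofReal_ne_top h2))
    rw [hlin T hT1 ω x, add_sub_cancel_left]
    exact hcon x hx
  · filter_upwards [hSfin] with T h1 ω
    rw [add_sub_cancel]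
    exact (EReal.coe_ennreal_toReal (h1 ω)).symm

/-- The rate of the local linear estimator in the form used for the residuals. -/
theorem uniformBigOInProb_localLinear_sub (hm : IsTimeVaryingARModel P g φ Y V e)
    (har : AutoregressiveConditions P φ e s) (hK : IsLipschitzKernel K) (hK' : IsRegularKernel K)
    (hg : ContDiffOn ℝ 2 g (Set.Icc 0 1)) (hh : IsBandwidth θ h) (hs : 2 < s)
    (hθ : θ ≤ 1 - 2 * (1 / s)) (hV : UniformMomentBound P s 1 V) :
    UniformBigOInProb P
      (fun T x ω => localLinearEstimator K (h T) T (fun t => Y T t ω) x - g x)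
      (fun T => h T ^ 2 + stochasticRate h T) := by
  obtain ⟨C, hC, hT⟩ := exists_localLinearEstimator_bounds hK hK' hg hh
  have h1 := (hm.uniformBigOInProb_localLinear har hK hK' hg hh hs hθ hV).rate_mono
    (r' := fun T => h T ^ 2 + stochasticRate h T) 1 one_pos
    (Eventually.of_forall fun T => by rw [one_mul]; linarith [sq_nonneg (h T)])
  have h2 : UniformBigOInProb P (fun T x _ =>
      localLinearEstimator K (h T) T (fun t => g (designPt T t)) x - g x)
      (fun T => h T ^ 2 + stochasticRate h T) := by
    refine UniformBigOInProb.of_bounded C (Eventually.of_forall fun T =>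
      add_nonneg (sq_nonneg _) (stochasticRate_nonneg h T)) ?_
    filter_upwards [hT] with T hT x hx ω
    refine (hT x hx).2.trans (mul_le_mul_of_nonneg_left ?_ hC.le)
    linarith [stochasticRate_nonneg h T]
  refine (h2.add h1).congr ?_
  filter_upwards [eventually_ge_atTop 1] with T hT1 x _ ω
  rw [localLinearEstimator_add K (h T) T x fun t ht => hm.observation T hT1 t ht ω]
  ring

end IsTimeVaryingARModel

/-! ### Interior expansion of the two-step estimator -/

/-- For an odd `k`, the kernel sum at an interior point is `O(1 / (T v))`: it vanishes exactly when
`x` is a design point, by reflection, and moving `x` to the design point on its left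
costs `O(1 / (T v))`. -/
theorem IsCompactLipschitz.exists_abs_sum_odd_le {k : ℝ → ℝ} (hk : IsCompactLipschitz k)
    (hodd : ∀ u, k (-u) = -k u) {v : ℕ → ℝ} {θ : ℝ} (hv : IsBandwidth θ v) :
    ∃ C L : ℝ, 0 < C ∧ 1 ≤ L ∧ ∀ᶠ T : ℕ in atTop, ∀ x : ℝ, (L + 2) * v T ≤ x →
      x ≤ 1 - (L + 2) * v T →
      |∑ t ∈ Finset.Icc 1 T, kernelWeight k v T t x| ≤ C / (T * v T) := by
  obtain ⟨B, Λ, L, hB, hΛ, hL, hb, hsupp, hlip⟩ := hk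
  refine ⟨(2 * L + 3) * Λ, L, by positivity, hL, ?_⟩
  filter_upwards [hv.eventually_basic] with T ⟨h3, hlog, hpos, hle, hN1⟩ x hx1 hx2
  have hT : (0 : ℝ) < T := by positivity
  set N := (T : ℝ) * v T with hN
  have hN0 : 0 < N := by positivity
  set t₀ := ⌊T * x⌋₊ with ht₀
  have hTx : (L + 2) * N ≤ T * x := by
    calc (L + 2) * N = T * ((L + 2) * v T) := by rw [hN]; ring
      _ ≤ T * x := by gcongr
  have hTx2 : T * x + (L + 2) * N ≤ T := by
    calc T * x + (L + 2) * N = T * (x + (L + 2) * v T) := by rw [hN]; ring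
      _ ≤ T * 1 := by gcongr; linarith
      _ = T := mul_one _
  have hLN : 0 ≤ L * N := by positivity
  have hf1 : (t₀ : ℝ) ≤ T * x := Nat.floor_le (by nlinarith)
  have hf2 : T * x < t₀ + 1 := Nat.lt_floor_add_one _
  set x₀ := (t₀ : ℝ) / T with hx₀
  have hTx₀ : (T : ℝ) * x₀ = t₀ := by rw [hx₀]; field_simp
  have hw : ∀ t x, kernelWeight k v T t x = k (((t : ℝ) - T * x) / N) / N := fun t x => by
    rw [kernelWeight, designPt_sub_div (by omega)]
  -- the sum at the design point `x₀` vanishes by reflection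
  have hzero : ∑ t ∈ Finset.Icc 1 T, kernelWeight k v T t x₀ = 0 := by
    set F := (Finset.Icc 1 T).filter fun t : ℕ => |(t : ℝ) - t₀| ≤ L * N with hF
    have hrestr : ∑ t ∈ Finset.Icc 1 T, kernelWeight k v T t x₀ =
        ∑ t ∈ F, kernelWeight k v T t x₀ := by
      rw [hF, Finset.sum_filter]
      refine Finset.sum_congr rfl fun t _ => ?_
      split_ifs with h1
      · rfl
      · rw [hw, hTx₀, hsupp, zero_div]
        rw [abs_div, abs_of_pos hN0, lt_div_iff₀ hN0]
        exact not_le.1 h1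
    have hbnd : ∀ t ∈ F, (t : ℝ) ≤ 2 * t₀ - 1 ∧ (2 * t₀ - t : ℝ) ≤ T := by
      intro t ht
      have h1 := abs_le.1 (Finset.mem_filter.1 ht).2
      constructor <;> nlinarith
    have hcast : ∀ t ∈ F, ((2 * t₀ - t : ℕ) : ℝ) = 2 * t₀ - t := by
      intro t ht
      have h1 : t ≤ 2 * t₀ := by
        have : (t : ℝ) ≤ ((2 * t₀ : ℕ) : ℝ) := by push_cast; linarith [(hbnd t ht).1]
        exact_mod_cast this
      push_cast [Nat.cast_sub h1]
      ring
    have hmaps : ∀ t ∈ F, 2 * t₀ - t ∈ F := by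
      intro t ht
      have h1 := (Finset.mem_filter.1 ht).2
      have h2 := hcast t ht
      rw [hF, Finset.mem_filter, Finset.mem_Icc]
      refine ⟨⟨?_, ?_⟩, ?_⟩
      · have : (1 : ℝ) ≤ ((2 * t₀ - t : ℕ) : ℝ) := by rw [h2]; linarith [(hbnd t ht).1]
        exact_mod_cast this
      · have : ((2 * t₀ - t : ℕ) : ℝ) ≤ T := by rw [h2]; exact (hbnd t ht).2
        exact_mod_cast this
      · rw [h2, show (2 * t₀ - t - t₀ : ℝ) = -(t - t₀) by ring, abs_neg]
        exact h1
    have hinv : ∀ t ∈ F, 2 * t₀ - (2 * t₀ - t) = t := by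
      intro t ht
      have : (t : ℝ) ≤ ((2 * t₀ : ℕ) : ℝ) := by push_cast; linarith [(hbnd t ht).1]
      have h1 : t ≤ 2 * t₀ := by exact_mod_cast this
      omega
    have hneg : ∑ t ∈ F, kernelWeight k v T t x₀ = ∑ t ∈ F, -kernelWeight k v T t x₀ := by
      refine Finset.sum_nbij' (fun t => 2 * t₀ - t) (fun t => 2 * t₀ - t) hmaps hmaps hinv hinv ?_
      intro t ht
      rw [hw, hw, hcast t ht, hTx₀, ← neg_div, ← hodd]
      congr 2
      ring
    rw [Finset.sum_neg_distrib] at hneg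
    rw [hrestr]
    linarith
  have hdiff : ∑ t ∈ Finset.Icc 1 T, kernelWeight k v T t x =
      ∑ t ∈ Finset.Icc 1 T, (kernelWeight k v T t x - kernelWeight k v T t x₀) := by
    rw [Finset.sum_sub_distrib, hzero, sub_zero]
  rw [hdiff]
  calc |∑ t ∈ Finset.Icc 1 T, (kernelWeight k v T t x - kernelWeight k v T t x₀)|
      ≤ ∑ t ∈ Finset.Icc 1 T, |kernelWeight k v T t x - kernelWeight k v T t x₀| :=
        Finset.abs_sum_le_sum_abs _ _
    _ ≤ ∑ t ∈ (Finset.Icc 1 T).filter (fun t : ℕ => |(t : ℝ) - T * x| ≤ L * N + 1),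
          Λ * (1 / N) / N := by
        rw [Finset.sum_filter]
        refine Finset.sum_le_sum fun t _ => ?_
        rw [hw, hw, hTx₀]
        split_ifs with h1
        · rw [← sub_div, abs_div, abs_of_pos hN0]
          gcongr
          refine (hlip _ _).trans ?_
          gcongr
          rw [← sub_div, abs_div, abs_of_pos hN0]
          gcongr
          rw [abs_le]
          constructor <;> linarith
        · have h2 : L * N + 1 < |(t : ℝ) - T * x| := not_le.1 h1
          have h4 : L * N < |(t : ℝ) - t₀| := by
            have h5 := abs_sub_abs_le_abs_sub ((t : ℝ) - T * x) ((t : ℝ) - t₀)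
            have h6 : |(t : ℝ) - T * x - ((t : ℝ) - t₀)| ≤ 1 := by
              rw [abs_le]
              constructor <;> linarith
            linarith
          rw [hsupp, hsupp, sub_self, abs_zero]
          · rw [abs_div, abs_of_pos hN0, lt_div_iff₀ hN0]
            exact h4
          · rw [abs_div, abs_of_pos hN0, lt_div_iff₀ hN0]
            linarith
    _ ≤ (2 * (L * N + 1) + 1) * (Λ * (1 / N) / N) := by
        rw [Finset.sum_const, nsmul_eq_mul]
        gcongr
        exact card_filter_abs_sub_le _ _ _ (by positivity)
    _ ≤ ((2 * L + 3) * N) * (Λ * (1 / N) / N) := by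
        gcongr
        linarith
    _ = _ := by field_simp

/-- The algebra of the two-step estimator for one realization. The states are `V t`, their lags
`a t`, and `δ`, `δ'` are the errors of the residuals. -/
theorem abs_ratio_sub_le {S : Finset ℕ} {w V a e f δ δ' : ℕ → ℝ} {p W Q Δ E₁ E₂ c : ℝ}
    (hw : ∀ t ∈ S, 0 ≤ w t) (hV : ∀ t ∈ S, V t = f t * a t + e t)
    (hδ : ∀ t ∈ S, |δ t| ≤ Δ) (hδ' : ∀ t ∈ S, |δ' t| ≤ Δ) (hf : ∀ t ∈ S, |f t| ≤ 1)
    (hp : |p| ≤ 1) (hΔ1 : Δ ≤ 1) (hΔ0 : 0 ≤ Δ) (hW : ∑ t ∈ S, w t ≤ W)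
    (hQ : ∑ t ∈ S, w t * a t ^ 2 ≤ Q) (hQ' : ∑ t ∈ S, w t * V t ^ 2 ≤ Q)
    (hE₁ : |∑ t ∈ S, w t * a t * e t| ≤ E₁)
    (hE₂ : |∑ t ∈ S, w t * (f t - p) * a t ^ 2| ≤ E₂)
    (hc : 0 < c) (hlow : c ≤ ∑ t ∈ S, w t * a t ^ 2) (hWΔ : W * Δ ^ 2 ≤ c / 4) :
    |(∑ t ∈ S, w t * ((V t - δ t) * (a t - δ' t))) / (∑ t ∈ S, w t * (a t - δ' t) ^ 2) - p| ≤
      (E₁ + E₂ + Δ * (8 * W + 6 * Q)) / (c / 4) := by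
  set N := ∑ t ∈ S, w t * ((V t - δ t) * (a t - δ' t)) with hN
  set D := ∑ t ∈ S, w t * (a t - δ' t) ^ 2 with hD
  have hDlow : c / 4 ≤ D := by
    have h1 : ∑ t ∈ S, (1 / 2 * (w t * a t ^ 2) - w t * Δ ^ 2) ≤ D := by
      refine Finset.sum_le_sum fun t ht => ?_
      have h2 : δ' t ^ 2 ≤ Δ ^ 2 := sq_le_sq' (abs_le.1 (hδ' t ht)).1 (abs_le.1 (hδ' t ht)).2
      have h3 : 1 / 2 * a t ^ 2 - Δ ^ 2 ≤ (a t - δ' t) ^ 2 := by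
        nlinarith [sq_nonneg (a t - 2 * δ' t)]
      calc 1 / 2 * (w t * a t ^ 2) - w t * Δ ^ 2 = w t * (1 / 2 * a t ^ 2 - Δ ^ 2) := by ring
        _ ≤ _ := mul_le_mul_of_nonneg_left h3 (hw t ht)
    rw [Finset.sum_sub_distrib, ← Finset.mul_sum, ← Finset.sum_mul] at h1
    have h2 : (∑ t ∈ S, w t) * Δ ^ 2 ≤ W * Δ ^ 2 := by gcongr
    linarith
  have hD0 : 0 < D := by linarith
  set rem : ℕ → ℝ := fun t => w t * ((-δ t + p * δ' t) * a t - e t * δ' t -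
    (f t - p) * a t * δ' t - (-δ t + p * δ' t) * δ' t) with hrem
  -- the terms of `rem` all contain a residual error
  have hexp : N - p * D = ∑ t ∈ S, w t * a t * e t + ∑ t ∈ S, w t * (f t - p) * a t ^ 2 +
      ∑ t ∈ S, rem t := by
    rw [hN, hD, Finset.mul_sum, ← Finset.sum_sub_distrib, ← Finset.sum_add_distrib,
      ← Finset.sum_add_distrib]
    refine Finset.sum_congr rfl fun t ht => ?_
    rw [hV t ht]
    simp only [hrem]
    ring
  have hremb : |∑ t ∈ S, rem t| ≤ Δ * (8 * W + 6 * Q) := by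
    calc |∑ t ∈ S, rem t| ≤ ∑ t ∈ S, |rem t| := Finset.abs_sum_le_sum_abs _ _
      _ ≤ ∑ t ∈ S, Δ * (8 * w t + 5 * (w t * a t ^ 2) + w t * V t ^ 2) := by
          refine Finset.sum_le_sum fun t ht => ?_
          simp only [hrem]
          rw [abs_mul, abs_of_nonneg (hw t ht)]
          have h1 := hδ t ht
          have h2 := hδ' t ht
          have h3 := hf t ht
          have ha : |a t| ≤ 1 + a t ^ 2 := by
            have := sq_nonneg (|a t| - 1)
            nlinarith [sq_abs (a t), abs_nonneg (a t)]
          have hVa : |V t| ≤ 1 + V t ^ 2 := by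
            have := sq_nonneg (|V t| - 1)
            nlinarith [sq_abs (V t), abs_nonneg (V t)]
          have he : |e t| ≤ |V t| + |a t| := by
            have h4 : e t = V t - f t * a t := by rw [hV t ht]; ring
            rw [h4]
            refine (abs_sub _ _).trans (add_le_add le_rfl ?_)
            rw [abs_mul]
            exact mul_le_of_le_one_left (abs_nonneg _) h3
          have hη : |-δ t + p * δ' t| ≤ 2 * Δ := by
            refine (abs_add_le _ _).trans ?_
            rw [abs_neg, abs_mul]
            have : |p| * |δ' t| ≤ 1 * Δ := mul_le_mul hp h2 (abs_nonneg _) zero_le_one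
            linarith
          have hfp : |f t - p| ≤ 2 := (abs_sub _ _).trans (by linarith)
          have hb : |(-δ t + p * δ' t) * a t - e t * δ' t - (f t - p) * a t * δ' t -
              (-δ t + p * δ' t) * δ' t| ≤ Δ * (8 + 5 * a t ^ 2 + V t ^ 2) := by
            refine (abs_sub _ _).trans ((add_le_add ((abs_sub _ _).trans (add_le_add
              (abs_sub _ _) le_rfl)) le_rfl).trans ?_)
            rw [abs_mul, abs_mul, abs_mul, abs_mul, abs_mul]
            calc |-δ t + p * δ' t| * |a t| + |e t| * |δ' t| + |f t - p| * |a t| * |δ' t| +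
                  |-δ t + p * δ' t| * |δ' t|
                ≤ 2 * Δ * |a t| + (|V t| + |a t|) * Δ + 2 * |a t| * Δ + 2 * Δ * 1 := by
                  gcongr
                  exact h2.trans hΔ1
              _ = Δ * (2 + 5 * |a t| + |V t|) := by ring
              _ ≤ _ := mul_le_mul_of_nonneg_left (by linarith) hΔ0
          calc w t * _ ≤ w t * (Δ * (8 + 5 * a t ^ 2 + V t ^ 2)) :=
                mul_le_mul_of_nonneg_left hb (hw t ht)
            _ = _ := by ring
      _ = Δ * (8 * ∑ t ∈ S, w t + 5 * ∑ t ∈ S, w t * a t ^ 2 + ∑ t ∈ S, w t * V t ^ 2) := by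
          rw [← Finset.mul_sum, Finset.sum_add_distrib, Finset.sum_add_distrib, ← Finset.mul_sum,
            ← Finset.mul_sum]
      _ ≤ _ := mul_le_mul_of_nonneg_left (by linarith) hΔ0
  have hnum : |N - p * D| ≤ E₁ + E₂ + Δ * (8 * W + 6 * Q) := by
    rw [hexp]
    exact (abs_add_three _ _ _).trans (add_le_add (add_le_add hE₁ hE₂) hremb)
  -- `D` is positive, so the quotient is not degenerate
  have hquot : N / D - p = (N - p * D) / D := by field_simp
  rw [hquot, abs_div, abs_of_pos hD0]
  exact div_le_div₀ ((abs_nonneg _).trans hnum) hnum (by positivity) hDlow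

theorem arEstimator_eq (K G : ℝ → ℝ) (h : ℝ) (v : ℕ → ℝ) (T : ℕ) (y : ℕ → ℝ) (x : ℝ) :
    arEstimator K G h (v T) T y x =
      (∑ t ∈ Finset.Icc 2 T, kernelWeight G v T t x *
        (fittedResidual K h T y t * fittedResidual K h T y (t - 1))) /
      ∑ t ∈ Finset.Icc 2 T, kernelWeight G v T t x * fittedResidual K h T y (t - 1) ^ 2 := by
  have e : ∀ t, kernelWeight G v T t x = 1 / (T : ℝ) * scaledKernel G (v T) (designPt T t - x) := by
    intro t
    rw [kernelWeight, scaledKernel, mul_comm (T : ℝ), ← div_div]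
    ring
  simp only [arEstimator, e, mul_assoc, ← Finset.mul_sum]

theorem eventually_interior {v b : ℕ → ℝ} {θ : ℝ} (hv : IsBandwidth θ v)
    (hbv : Tendsto (fun T => b T / v T) atTop atTop) (L : ℝ) :
    ∀ᶠ T in atTop, ∀ x ∈ Set.Icc (b T) (1 - b T), L * v T ≤ x ∧ x ≤ 1 - L * v T := by
  filter_upwards [hv.eventually_basic, hbv.eventually_ge_atTop L] with T ⟨_, _, hpos, _, _⟩ h1 x hx
  rw [le_div_iff₀ hpos] at h1
  exact ⟨h1.trans hx.1, by linarith [hx.2]⟩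

/-- Deterministic facts about the weights of the second step at interior points: only times
`t ≥ 3` contribute, the rescaled distances are bounded, and the first-order term of the expansion
of `φ` against the second moments `m` is `O(v + 1 / (T v))`. -/
theorem exists_secondStep_bounds {G S : ℝ → ℝ} (hG : IsLipschitzKernel G) (hG' : IsRegularKernel G)
    {v b : ℕ → ℝ} {θ : ℝ} (hv : IsBandwidth θ v)
    (hbv : Tendsto (fun T => b T / v T) atTop atTop) {m : ℕ → ℕ → ℝ} {C : ℝ} (hC : 0 < C)
    (hS : ∀ x ∈ Set.Icc (0 : ℝ) 1, |S x| ≤ C)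
    (hSl : ∀ x ∈ Set.Icc (0 : ℝ) 1, ∀ y ∈ Set.Icc (0 : ℝ) 1, |S y - S x| ≤ C * |y - x|)
    (hm : ∀ T : ℕ, 1 ≤ T → ∀ t ∈ Finset.Icc 1 T, |m T t - S (designPt T t)| ≤ C / t) :
    ∃ D L : ℝ, 0 < D ∧ 0 < L ∧ ∀ᶠ T : ℕ in atTop, ∀ x ∈ Set.Icc (b T) (1 - b T),
      x ∈ Set.Icc (0 : ℝ) 1 ∧
      (∀ t ∈ Finset.Icc 1 T, kernelWeight G v T t x ≠ 0 →
        3 ≤ t ∧ |(designPt T t - x) / v T| ≤ L) ∧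
      (∑ t ∈ Finset.Icc 2 T, kernelWeight G v T t x ≤ D) ∧
      |∑ t ∈ Finset.Icc 2 T, kernelWeight (fun u => G u * u) v T t x * m T (t - 1)| ≤
        D * (1 / (T * v T) + v T) := by
  have k0 := hG.isCompactLipschitz
  obtain ⟨B, Λ, L, hB, hΛ, hL, hb, hsupp, hlip⟩ := id k0
  obtain ⟨C₀, hC₀, w0⟩ := k0.isWeightArray hv
  obtain ⟨C₁, hC₁, w1⟩ := k0.mul_id.isWeightArray hv
  obtain ⟨C₂, L₂, hC₂, hL₂, hodd⟩ := k0.mul_id.exists_abs_sum_odd_le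
    (fun u => by rw [hG'.symm, mul_neg]) hv
  refine ⟨C₀ + (C * C₂ + C₁ * (C * (L + 2))), L, by positivity, by linarith, ?_⟩
  filter_upwards [eventually_interior hv hbv (L + 4), eventually_interior hv hbv (L₂ + 2), w0, w1,
    hodd, hv.eventually_basic] with T hint hint₂ w0 w1 hodd ⟨h3, hlog, hpos, hle, hN1⟩ x hx
  have hT : (0 : ℝ) < T := by positivity
  have hT1 : 1 ≤ T := by omega
  obtain ⟨hx1, hx2⟩ := hint x hx
  have hLv : 0 ≤ (L + 4) * v T := by positivity
  have hxI : x ∈ Set.Icc (0 : ℝ) 1 := ⟨by linarith, by linarith⟩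
  set N := (T : ℝ) * v T with hN
  have hN0 : 0 < N := by positivity
  have hTx : (L + 4) * N ≤ T * x := by
    calc (L + 4) * N = T * ((L + 4) * v T) := by rw [hN]; ring
      _ ≤ T * x := by gcongr
  have hmem : ∀ t ∈ Finset.Icc 1 T, L < |(designPt T t - x) / v T| ∨
      (|(designPt T t - x) / v T| ≤ L ∧ 3 ≤ t ∧ N ≤ (t : ℝ) - 1) := by
    intro t _
    rcases lt_or_ge L |(designPt T t - x) / v T| with h1 | h1
    · exact Or.inl h1
    · refine Or.inr ⟨h1, ?_⟩
      rw [designPt_sub_div hT1, abs_div, abs_of_pos hN0, div_le_iff₀ hN0] at h1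
      have h2 := (abs_le.1 h1).1
      have h4 : (3 : ℝ) ≤ t := by nlinarith
      exact ⟨by exact_mod_cast h4, by nlinarith⟩
  refine ⟨hxI, fun t ht hne => ?_, ?_, ?_⟩
  · rcases hmem t ht with h1 | ⟨h1, h2, -⟩
    · exact absurd (by rw [kernelWeight, hsupp _ h1, zero_div]) hne
    · exact ⟨h2, h1⟩
  · have h1 : 0 ≤ C * C₂ + C₁ * (C * (L + 2)) := by positivity
    calc ∑ t ∈ Finset.Icc 2 T, kernelWeight G v T t x
        ≤ ∑ t ∈ Finset.Icc 2 T, |kernelWeight G v T t x| :=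
          Finset.sum_le_sum fun _ _ => le_abs_self _
      _ ≤ ∑ t ∈ Finset.Icc 1 T, |kernelWeight G v T t x| :=
          Finset.sum_le_sum_of_subset_of_nonneg (Finset.Icc_two_subset_Icc_one T)
            fun _ _ _ => abs_nonneg _
      _ ≤ C₀ := (w0 x).2.1
      _ ≤ _ := by linarith
  · set k : ℕ → ℝ := fun t => kernelWeight (fun u => G u * u) v T t x with hk
    have hk1 : k 1 = 0 := by
      rcases hmem 1 (Finset.mem_Icc.2 ⟨le_rfl, hT1⟩) with h1 | ⟨-, h2, -⟩
      · simp only [hk, kernelWeight, hsupp _ h1, zero_mul, zero_div]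
      · omega
    have hIcc : ∑ t ∈ Finset.Icc 1 T, k t = ∑ t ∈ Finset.Icc 2 T, k t := by
      rw [← Finset.add_sum_Ioc_eq_sum_Icc hT1, hk1, zero_add]
      congr 1
    -- replace the second moments by the constant `S x`, for which the symmetry of the kernel applies
    have hsplit : ∑ t ∈ Finset.Icc 2 T, k t * m T (t - 1) =
        S x * ∑ t ∈ Finset.Icc 1 T, k t + ∑ t ∈ Finset.Icc 2 T, k t * (m T (t - 1) - S x) := by
      rw [hIcc, Finset.mul_sum, ← Finset.sum_add_distrib]
      exact Finset.sum_congr rfl fun t _ => by ring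
    have hfirst : |S x * ∑ t ∈ Finset.Icc 1 T, k t| ≤ C * (C₂ / N) := by
      rw [abs_mul]
      have h1 := hodd x (hint₂ x hx).1 (hint₂ x hx).2
      have h2 := hS x hxI
      exact mul_le_mul h2 h1 (abs_nonneg _) hC.le
    have hsecond : |∑ t ∈ Finset.Icc 2 T, k t * (m T (t - 1) - S x)| ≤
        C₁ * (C * (L + 2) * (1 / N + v T)) := by
      calc |∑ t ∈ Finset.Icc 2 T, k t * (m T (t - 1) - S x)|
          ≤ ∑ t ∈ Finset.Icc 2 T, |k t * (m T (t - 1) - S x)| := Finset.abs_sum_le_sum_abs _ _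
        _ ≤ ∑ t ∈ Finset.Icc 2 T, |k t| * (C * (L + 2) * (1 / N + v T)) := by
            refine Finset.sum_le_sum fun t ht => ?_
            have ht1 := Finset.Icc_two_subset_Icc_one T ht
            rw [abs_mul]
            rcases hmem t ht1 with h1 | ⟨h1, h2, h4⟩
            · have : k t = 0 := by
                simp only [hk, kernelWeight, hsupp _ h1, zero_mul, zero_div]
              rw [this, abs_zero, zero_mul, zero_mul]
            · gcongr
              obtain ⟨j, rfl⟩ : ∃ j, t = j + 1 := ⟨t - 1, by omega⟩
              have hjT : j ≤ T := by have := (Finset.mem_Icc.1 ht).2; omega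
              have hj1 : 1 ≤ j := by omega
              rw [Nat.add_sub_cancel]
              push_cast at h4
              have hj0 : (0 : ℝ) < j := by exact_mod_cast hj1
              have h5 := hm T hT1 j (Finset.mem_Icc.2 ⟨hj1, hjT⟩)
              have h6 := hSl x hxI _ (designPt_mem hjT)
              have h7 : |designPt T j - x| ≤ L * v T + 1 / T := by
                rw [abs_div, abs_of_pos hpos, div_le_iff₀ hpos] at h1
                have h8 : designPt T j - x = (designPt T (j + 1) - x) + -(1 / T) := by
                  unfold designPt; push_cast; ring
                rw [h8]
                refine (abs_add_le _ _).trans (add_le_add h1 ?_)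
                rw [abs_neg, abs_of_nonneg (by positivity)]
              have h9 : (1 : ℝ) / T ≤ 1 / N := by
                apply one_div_le_one_div_of_le hN0
                rw [hN]
                exact mul_le_of_le_one_right hT.le hle
              have h10 : C / (j : ℝ) ≤ C * (1 / N) := by
                rw [mul_one_div]
                gcongr
                linarith
              have e : m T j - S x = (m T j - S (designPt T j)) + (S (designPt T j) - S x) := by
                ring
              rw [e]
              calc |(m T j - S (designPt T j)) + (S (designPt T j) - S x)|
                  ≤ C * (1 / N) + C * (L * v T + 1 / N) := by
                    refine (abs_add_le _ _).trans (add_le_add (h5.trans h10) (h6.trans ?_))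
                    gcongr
                    exact h7.trans (by linarith)
                _ = C * (2 * (1 / N) + L * v T) := by ring
                _ ≤ C * ((L + 2) * (1 / N) + (L + 2) * v T) := by
                    gcongr <;> linarith
                _ = _ := by ring
        _ ≤ C₁ * (C * (L + 2) * (1 / N + v T)) := by
            rw [← Finset.sum_mul]
            gcongr
            exact (Finset.sum_le_sum_of_subset_of_nonneg (Finset.Icc_two_subset_Icc_one T)
              fun _ _ _ => abs_nonneg _).trans (w1 x).2.1
    rw [hsplit]
    calc |S x * ∑ t ∈ Finset.Icc 1 T, k t + ∑ t ∈ Finset.Icc 2 T, k t * (m T (t - 1) - S x)|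
        ≤ C * (C₂ / N) + C₁ * (C * (L + 2) * (1 / N + v T)) :=
          (abs_add_le _ _).trans (add_le_add hfirst hsecond)
      _ ≤ C * C₂ * (1 / N + v T) + C₁ * (C * (L + 2)) * (1 / N + v T) := by
          have : C * (C₂ / N) ≤ C * C₂ * (1 / N + v T) := by
            calc C * (C₂ / N) = C * C₂ * (1 / N) := by ring
              _ ≤ _ := by
                gcongr
                linarith
          linarith
      _ ≤ _ := by
          have : 0 ≤ C₀ * (1 / N + v T) := by positivity
          linarith

/-! ### The two-step autoregression estimator -/

/-- Bandwidths of the same order have stochastic rates of the same order. -/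
theorem exists_rate_comparison {h v : ℕ → ℝ} {θ θ' c_v : ℝ} (hh : IsBandwidth θ h)
    (hv : IsBandwidth θ' v) (hc : 0 < c_v) (hvh : Tendsto (fun T => v T / h T) atTop (𝓝 c_v)) :
    ∃ A : ℝ, 0 < A ∧ ∀ᶠ T in atTop,
      stochasticRate v T ≤ A * stochasticRate h T ∧ v T ^ 2 ≤ A * h T ^ 2 := by
  refine ⟨max (Real.sqrt (2 / c_v)) ((2 * c_v) ^ 2), by positivity, ?_⟩
  filter_upwards [hh.eventually_basic, hv.eventually_basic,
    hvh.eventually (lt_mem_nhds (show c_v / 2 < c_v by linarith)),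
    hvh.eventually (gt_mem_nhds (show c_v < 2 * c_v by linarith))] with T
    ⟨h3, hlog, hpos, hle, hN⟩ ⟨_, _, vpos, _, _⟩ h1 h2
  have hT : (0 : ℝ) < T := by positivity
  rw [lt_div_iff₀ hpos] at h1
  rw [div_lt_iff₀ hpos] at h2
  constructor
  · refine le_trans ?_ (mul_le_mul_of_nonneg_right (le_max_left _ _) (stochasticRate_nonneg h T))
    rw [stochasticRate, stochasticRate, ← Real.sqrt_mul (by positivity)]
    apply Real.sqrt_le_sqrt
    rw [div_mul_div_comm, div_le_div_iff₀ (by positivity) (by positivity)]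
    calc Real.log T * (c_v * (T * h T)) = 2 * Real.log T * (T * (c_v / 2 * h T)) := by ring
      _ ≤ 2 * Real.log T * (T * v T) := by gcongr
  · refine le_trans ?_ (mul_le_mul_of_nonneg_right (le_max_right _ _) (sq_nonneg (h T)))
    rw [← mul_pow]
    exact pow_le_pow_left₀ vpos.le h2.le 2

/-- Expansion of `∑ w (φ(t/T) - φ(x)) V_{t-1}²` for one realization: the first-order Taylor term
is compared with the second moments `m`, the remainder with the total of `w V²`. -/
theorem abs_sum_coeff_diff_le {S : Finset ℕ} {w u a f m : ℕ → ℝ} {p p' v C L Q E F : ℝ}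
    (hw : ∀ t ∈ S, 0 ≤ w t) (hu : ∀ t ∈ S, w t ≠ 0 → |u t| ≤ L) (hC : 0 ≤ C) (hv : 0 ≤ v)
    (hp' : |p'| ≤ C) (htaylor : ∀ t ∈ S, |f t - p - p' * (v * u t)| ≤ C * (v * u t) ^ 2)
    (hQ : ∑ t ∈ S, w t * a t ^ 2 ≤ Q)
    (hE : |∑ t ∈ S, w t * u t * (a t ^ 2 - m t)| ≤ E) (hF : |∑ t ∈ S, w t * u t * m t| ≤ F) :
    |∑ t ∈ S, w t * (f t - p) * a t ^ 2| ≤ C * v * (E + F) + C * L ^ 2 * v ^ 2 * Q := by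
  have e : ∑ t ∈ S, w t * (f t - p) * a t ^ 2 =
      p' * v * (∑ t ∈ S, w t * u t * (a t ^ 2 - m t) + ∑ t ∈ S, w t * u t * m t) +
      ∑ t ∈ S, w t * (f t - p - p' * (v * u t)) * a t ^ 2 := by
    rw [← Finset.sum_add_distrib, Finset.mul_sum, ← Finset.sum_add_distrib]
    exact Finset.sum_congr rfl fun t _ => by ring
  rw [e]
  refine (abs_add_le _ _).trans (add_le_add ?_ ?_)
  · rw [abs_mul, abs_mul, abs_of_nonneg hv]
    gcongr
    exact (abs_add_le _ _).trans (add_le_add hE hF)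
  · calc |∑ t ∈ S, w t * (f t - p - p' * (v * u t)) * a t ^ 2|
        ≤ ∑ t ∈ S, |w t * (f t - p - p' * (v * u t)) * a t ^ 2| := Finset.abs_sum_le_sum_abs _ _
      _ ≤ ∑ t ∈ S, C * L ^ 2 * v ^ 2 * (w t * a t ^ 2) := by
          refine Finset.sum_le_sum fun t ht => ?_
          by_cases h0 : w t = 0
          · simp [h0]
          have hwt := hw t ht
          have hut : u t ^ 2 ≤ L ^ 2 :=
            sq_le_sq' (abs_le.1 (hu t ht h0)).1 (abs_le.1 (hu t ht h0)).2
          rw [abs_mul, abs_mul, abs_of_nonneg hwt, abs_of_nonneg (sq_nonneg (a t))]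
          calc w t * |f t - p - p' * (v * u t)| * a t ^ 2
              ≤ w t * (C * (v * u t) ^ 2) * a t ^ 2 := by
                have := htaylor t ht
                gcongr
            _ = C * v ^ 2 * (w t * a t ^ 2) * u t ^ 2 := by ring
            _ ≤ C * v ^ 2 * (w t * a t ^ 2) * L ^ 2 := by gcongr
            _ = _ := by ring
      _ ≤ _ := by
          rw [← Finset.mul_sum]
          gcongr

namespace IsTimeVaryingARModel

variable {Ω : Type*} [mΩ : MeasurableSpace Ω] {P : Measure Ω} [IsProbabilityMeasure P]
  {g φ : ℝ → ℝ} {Y V e : ℕ → ℕ → Ω → ℝ} {K G : ℝ → ℝ} {h v b : ℕ → ℝ} {θ s c_v : ℝ}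

/-- Rate of the two-step estimator of the autoregression coefficient on the interior: the stochastic
ingredients are controlled on one event, on which the rest is deterministic. -/
theorem isBigOInProb_arEstimator (hm : IsTimeVaryingARModel P g φ Y V e)
    (har : AutoregressiveConditions P φ e s) (hK : IsLipschitzKernel K) (hK' : IsRegularKernel K)
    (hG : IsLipschitzKernel G) (hG' : IsRegularKernel G)
    (hg : ContDiffOn ℝ 2 g (Set.Icc 0 1)) (hφ : ContDiffOn ℝ 2 φ (Set.Icc 0 1))
    (hh : IsBandwidth θ h) (hv : IsBandwidth θ v) (hs : 2 < s)
    (hθ : θ ≤ 1 - 2 * (1 / s)) (hc : 0 < c_v)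
    (hvh : Tendsto (fun T => v T / h T) atTop (𝓝 c_v))
    (hbv : Tendsto (fun T => b T / v T) atTop atTop)
    (hV : UniformMomentBound P s 1 V)
    (hV2 : UniformMomentBound P s 2 (fun T t ω => V T (t - 1) ω ^ 2)) :
    IsBigOInProb P
      (fun T ω => supError (Set.Icc (b T) (1 - b T))
        (arEstimator K G (h T) (v T) T (fun t => Y T t ω)) φ)
      (fun T => h T ^ 2 + stochasticRate h T) := by
  obtain ⟨q, hq0, hq1, hφq⟩ := har.coeff_bound
  have he2 := hm.noise_moment_two_mul har hs hV2
  have hvar : ∀ T : ℕ, 1 ≤ T → ∀ t ∈ Finset.Icc 1 T, ∫ ω, (e T t ω ^ 2 - 1) ∂P = 0 :=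
    fun T hT t ht => (hm.integral_noise_sq_sub_one har hs hT ht).2.2
  set m : ℕ → ℕ → ℝ := fun T t => ∫ ω, V T t ω ^ 2 ∂P with hmdef
  obtain ⟨D₁, hm1⟩ := hm.exists_state_sq_le hs hV
  have hmrec : ∀ T : ℕ, 1 ≤ T → ∀ t ∈ Finset.Icc 2 T,
      m T t = φ (designPt T t) ^ 2 * m T (t - 1) + 1 := fun T hT t ht =>
    hm.integral_state_sq har hs hV hT ht
  have hm0 : ∀ T t, 0 ≤ m T t := fun T t => integral_nonneg fun ω => sq_nonneg _
  obtain ⟨φ', Cφ, hCφ, hφ'b, htaylor, hφlip⟩ := exists_taylor_bound hφ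
  obtain ⟨Cm, hCm, hSb, hSl, hmS⟩ :=
    exists_secondMoment_approx hq0 hq1 hφq hCφ hφlip hm1 hmrec
  obtain ⟨D, L, hD, hL, hstep⟩ := exists_secondStep_bounds hG hG' hv hbv hCm hSb hSl hmS
  obtain ⟨c, hc0, hlow⟩ := hG.exists_design_lower_bound hG' hv
  obtain ⟨A, hA, hrate⟩ := exists_rate_comparison hh hv hc hvh
  have w0 := hG.isCompactLipschitz.isWeightArray hv
  have w1 := hG.isCompactLipschitz.mul_id.isWeightArray hv
  have vpos : ∀ᶠ T in atTop, 0 < v T := hv.eventually_basic.mono fun T hT => hT.2.2.1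
  have hs0 : 0 < 1 / s := by positivity
  -- the stochastic ingredients
  have z1 := hm.uniformBigOInProb_localLinear_sub har hK hK' hg hh hs hθ hV
  have z2 := hm.uniformBigOInProb_sum_cross hq0 hq1 hφq hv hs hθ hV hV2 he2 hvar w0
  have z3 := hm.uniformBigOInProb_sum_sq_sub hq0 hq1 hφq hv hs hθ hV hV2 he2 hvar hm1 hmrec w1
  have z4 := hm.uniformBigOInProb_sum_sq_sub hq0 hq1 hφq hv hs hθ hV hV2 he2 hvar hm1 hmrec w0
  have z5 := hm.uniformBigOInProb_sum_sq hq0 hq1 hφq hv hs hθ hV (he2.sq_sub_one (by linarith))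
    hvar (w0.shift vpos)
  have z6 := hm.uniformBigOInProb_sum_sq hq0 hq1 hφq hv hs hθ hV (he2.sq_sub_one (by linarith))
    hvar w0
  intro ε hε
  have hε6 : 0 < ε / 6 := by positivity
  obtain ⟨M₁, hM₁, e1⟩ := z1 _ hε6
  obtain ⟨M₂, hM₂, e2⟩ := z2 _ hε6
  obtain ⟨M₃, hM₃, e3⟩ := z3 _ hε6
  have e4 := z4.eventually_le (hv.tendsto_rate (by linarith)) hε6 (half_pos hc0)
  obtain ⟨M₅, hM₅, e5⟩ := z5 _ hε6
  obtain ⟨M₆, hM₆, e6⟩ := z6 _ hε6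
  set Q := M₅ + M₆ with hQ
  set M : ℝ := (A * M₂ + (Cφ * (A * M₃ + (A * D + A * D)) + Cφ * L ^ 2 * A * Q) +
    M₁ * (8 * D + 6 * Q)) / (c / 2 / 4) with hM
  have hM0 : 0 < M := by positivity
  refine ⟨M, hM0, ?_⟩
  have hr0 : Tendsto (fun T => M₁ * (h T ^ 2 + stochasticRate h T)) atTop (𝓝 0) := by
    have := ((hh.tendsto_zero.pow 2).add (hh.tendsto_rate (by linarith))).const_mul M₁
    simpa using this
  have hsm1 := hr0.eventually (ge_mem_nhds one_pos)
  have hsm2 : ∀ᶠ T in atTop, D * (M₁ * (h T ^ 2 + stochasticRate h T)) ^ 2 ≤ c / 2 / 4 := by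
    have := (hr0.pow 2).const_mul D
    rw [zero_pow two_ne_zero, mul_zero] at this
    exact this.eventually (ge_mem_nhds (by positivity))
  filter_upwards [e1, e2, e3, e4, e5, e6, hstep, hlow, hrate, hsm1, hsm2, hv.eventually_basic,
    hv.inv_le] with T e1 e2 e3 e4 e5 e6 hstep hlow hrate hsm1 hsm2 ⟨hT3, hlog, hvpos, hvle, hN1⟩
    hinv
  have hT1 : 1 ≤ T := by omega
  have hTpos : (0 : ℝ) < T := by positivity
  have h12 := Finset.Icc_two_subset_Icc_one T
  set r := h T ^ 2 + stochasticRate h T with hr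
  have hρ0 := stochasticRate_nonneg h T
  have hrr : 0 ≤ r := add_nonneg (sq_nonneg _) hρ0
  have hρr : stochasticRate v T ≤ A * r := hrate.1.trans (by
    gcongr
    rw [hr]
    linarith [sq_nonneg (h T)])
  have hv2r : v T ^ 2 ≤ A * r := hrate.2.trans (by
    gcongr
    rw [hr]
    linarith)
  have hw0 : ∀ t x, 0 ≤ kernelWeight G v T t x := fun t x =>
    div_nonneg (hG'.nonneg _) (by positivity)
  refine (measure_mono (t :=
    {ω | ∃ x ∈ Set.Icc (0 : ℝ) 1, M₁ * r <
      |localLinearEstimator K (h T) T (fun t => Y T t ω) x - g x|} ∪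
    {ω | ∃ x ∈ Set.Icc (0 : ℝ) 1, M₂ * stochasticRate v T <
      |∑ i ∈ Finset.Icc 2 T, kernelWeight G v T i x * V T (i - 1) ω * e T i ω|} ∪
    {ω | ∃ x ∈ Set.Icc (0 : ℝ) 1, M₃ * stochasticRate v T <
      |∑ t ∈ Finset.Icc 2 T, kernelWeight (fun u => G u * u) v T t x *
        (V T (t - 1) ω ^ 2 - m T (t - 1))|} ∪
    {ω | ∃ x ∈ Set.Icc (0 : ℝ) 1, c / 2 <
      |∑ t ∈ Finset.Icc 2 T, kernelWeight G v T t x * (V T (t - 1) ω ^ 2 - m T (t - 1))|} ∪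
    {ω | ∃ x ∈ Set.Icc (0 : ℝ) 1, M₅ * 1 < |∑ t ∈ Finset.Icc 1 T,
      |if t + 1 ≤ T then kernelWeight G v T (t + 1) x else 0| * V T t ω ^ 2|} ∪
    {ω | ∃ x ∈ Set.Icc (0 : ℝ) 1, M₆ * 1 <
      |∑ t ∈ Finset.Icc 1 T, |kernelWeight G v T t x| * V T t ω ^ 2|}) ?_).trans ?_
  · intro ω hω
    by_contra hcon
    simp only [Set.mem_union, Set.mem_ofPred_eq, not_or, not_exists, not_and, not_lt] at hcon hω
    obtain ⟨⟨⟨⟨⟨g1, g2⟩, g3⟩, g4⟩, g5⟩, g6⟩ := hcon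
    refine absurd hω (not_lt.2 (supError_le_ofReal fun x hx => ?_))
    obtain ⟨hxI, hsupp, hWD, hF⟩ := hstep x hx
    have hshift : ∑ t ∈ Finset.Icc 2 T, kernelWeight G v T t x * V T (t - 1) ω ^ 2 =
        ∑ t ∈ Finset.Icc 1 T,
          |if t + 1 ≤ T then kernelWeight G v T (t + 1) x else 0| * V T t ω ^ 2 := by
      rw [sum_Icc_two_eq_shift (fun t => kernelWeight G v T t x) (fun j => V T j ω ^ 2)]
      refine Finset.sum_congr rfl fun j _ => ?_
      split_ifs
      · rw [abs_of_nonneg (hw0 _ _)]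
      · rw [abs_zero]
    have hQa : ∑ t ∈ Finset.Icc 2 T, kernelWeight G v T t x * V T (t - 1) ω ^ 2 ≤ Q := by
      rw [hshift]
      refine ((le_abs_self _).trans (g5 x hxI)).trans ?_
      rw [hQ]
      linarith
    have hQV : ∑ t ∈ Finset.Icc 2 T, kernelWeight G v T t x * V T t ω ^ 2 ≤ Q := by
      have h1 : ∑ t ∈ Finset.Icc 2 T, kernelWeight G v T t x * V T t ω ^ 2 ≤
          ∑ t ∈ Finset.Icc 1 T, |kernelWeight G v T t x| * V T t ω ^ 2 := by
        calc _ ≤ ∑ t ∈ Finset.Icc 1 T, kernelWeight G v T t x * V T t ω ^ 2 :=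
              Finset.sum_le_sum_of_subset_of_nonneg h12
                fun _ _ _ => mul_nonneg (hw0 _ _) (sq_nonneg _)
          _ = _ := Finset.sum_congr rfl fun t _ => by rw [abs_of_nonneg (hw0 _ _)]
      refine (h1.trans ((le_abs_self _).trans (g6 x hxI))).trans ?_
      rw [hQ]
      linarith
    have hkw : ∀ t, kernelWeight (fun u => G u * u) v T t x =
        kernelWeight G v T t x * ((designPt T t - x) / v T) := fun t => by
      simp only [kernelWeight]; ring
    have hE₂ := abs_sum_coeff_diff_le (S := Finset.Icc 2 T) (w := fun t => kernelWeight G v T t x)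
      (u := fun t => (designPt T t - x) / v T) (a := fun t => V T (t - 1) ω)
      (f := fun t => φ (designPt T t)) (m := fun t => m T (t - 1)) (p := φ x) (p' := φ' x)
      (v := v T) (C := Cφ) (L := L) (Q := Q) (E := M₃ * stochasticRate v T)
      (F := D * (1 / (T * v T) + v T)) (fun t _ => hw0 t x)
      (fun t ht hne => (hsupp t (h12 ht) hne).2) hCφ.le hvpos.le (hφ'b x hxI)
      (fun t ht => by
        rw [mul_div_cancel₀ _ hvpos.ne']
        exact htaylor x hxI _ (designPt_mem (Finset.mem_Icc.1 ht).2)) hQa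
      (by simpa only [hkw] using g3 x hxI) (by simpa only [hkw] using hF)
    -- the denominator: second moments are at least one at the times that contribute
    have hden : c / 2 ≤ ∑ t ∈ Finset.Icc 2 T, kernelWeight G v T t x * V T (t - 1) ω ^ 2 := by
      have h1 := (hlow x hxI).1
      have h2 : ∑ t ∈ Finset.Icc 1 T, kernelWeight G v T t x ≤
          ∑ t ∈ Finset.Icc 2 T, kernelWeight G v T t x * m T (t - 1) := by
        rw [← Finset.sum_subset h12 (f := fun t => kernelWeight G v T t x) fun t ht ht' => ?_]
        · refine Finset.sum_le_sum fun t ht => ?_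
          by_cases hne : kernelWeight G v T t x = 0
          · simp [hne]
          have ht3 := (hsupp t (h12 ht) hne).1
          have htT := (Finset.mem_Icc.1 ht).2
          refine le_mul_of_one_le_right (hw0 t x) ?_
          rw [hmrec T hT1 (t - 1) (Finset.mem_Icc.2 ⟨by omega, by omega⟩)]
          have := mul_nonneg (sq_nonneg (φ (designPt T (t - 1)))) (hm0 T (t - 1 - 1))
          linarith
        · by_contra hne
          have ht3 := (hsupp t ht hne).1
          exact ht' (Finset.mem_Icc.2 ⟨by omega, (Finset.mem_Icc.1 ht).2⟩)
      have h3 := (abs_le.1 (g4 x hxI)).1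
      simp only [mul_sub, Finset.sum_sub_distrib] at h3
      linarith
    have hres : ∀ t ∈ Finset.Icc 1 T, fittedResidual K (h T) T (fun t => Y T t ω) t =
        V T t ω - (localLinearEstimator K (h T) T (fun t => Y T t ω) (designPt T t) -
          g (designPt T t)) := by
      intro t ht
      rw [fittedResidual, hm.observation T hT1 t ht ω]
      ring
    have hpre : ∀ t ∈ Finset.Icc 2 T, t - 1 ∈ Finset.Icc 1 T := fun t ht => by
      have := Finset.mem_Icc.1 ht
      exact Finset.mem_Icc.2 ⟨by omega, by omega⟩
    have hδ : ∀ t ∈ Finset.Icc 1 T,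
        |localLinearEstimator K (h T) T (fun t => Y T t ω) (designPt T t) - g (designPt T t)| ≤
          M₁ * r := fun t ht => g1 _ (designPt_mem (Finset.mem_Icc.1 ht).2)
    have hmain := abs_ratio_sub_le (S := Finset.Icc 2 T) (w := fun t => kernelWeight G v T t x)
      (V := fun t => V T t ω) (a := fun t => V T (t - 1) ω) (e := fun t => e T t ω)
      (f := fun t => φ (designPt T t))
      (δ := fun t => localLinearEstimator K (h T) T (fun t => Y T t ω) (designPt T t) -
        g (designPt T t))
      (δ' := fun t => localLinearEstimator K (h T) T (fun t => Y T t ω) (designPt T (t - 1)) -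
        g (designPt T (t - 1)))
      (p := φ x) (W := D) (Q := Q) (Δ := M₁ * r) (E₁ := M₂ * stochasticRate v T) (c := c / 2)
      (fun t _ => hw0 t x) (fun t ht => hm.autoregression T hT1 t (h12 ht) ω)
      (fun t ht => hδ t (h12 ht)) (fun t ht => hδ _ (hpre t ht))
      (fun t ht => (hφq _ (designPt_mem (Finset.mem_Icc.1 ht).2)).trans hq1.le)
      ((hφq x hxI).trans hq1.le) hsm1 (by positivity) hWD hQa hQV (g2 x hxI) hE₂ (by positivity)
      hden hsm2
    have hnum : ∑ t ∈ Finset.Icc 2 T, kernelWeight G v T t x *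
          (fittedResidual K (h T) T (fun t => Y T t ω) t *
            fittedResidual K (h T) T (fun t => Y T t ω) (t - 1)) =
        ∑ t ∈ Finset.Icc 2 T, kernelWeight G v T t x *
          ((V T t ω - (localLinearEstimator K (h T) T (fun t => Y T t ω) (designPt T t) -
              g (designPt T t))) *
            (V T (t - 1) ω - (localLinearEstimator K (h T) T (fun t => Y T t ω)
              (designPt T (t - 1)) - g (designPt T (t - 1))))) :=
      Finset.sum_congr rfl fun t ht => by rw [hres t (h12 ht), hres _ (hpre t ht)]
    have hdenom : ∑ t ∈ Finset.Icc 2 T, kernelWeight G v T t x *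
          fittedResidual K (h T) T (fun t => Y T t ω) (t - 1) ^ 2 =
        ∑ t ∈ Finset.Icc 2 T, kernelWeight G v T t x *
          (V T (t - 1) ω - (localLinearEstimator K (h T) T (fun t => Y T t ω)
            (designPt T (t - 1)) - g (designPt T (t - 1)))) ^ 2 :=
      Finset.sum_congr rfl fun t ht => by rw [hres _ (hpre t ht)]
    rw [arEstimator_eq, hnum, hdenom]
    refine hmain.trans ?_
    rw [hM, div_mul_eq_mul_div]
    refine div_le_div_of_nonneg_right ?_ (by positivity)
    have t1 : M₂ * stochasticRate v T ≤ A * M₂ * r := by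
      calc _ ≤ M₂ * (A * r) := by gcongr
        _ = _ := by ring
    have t2 : Cφ * v T * (M₃ * stochasticRate v T + D * (1 / (T * v T) + v T)) ≤
        Cφ * (A * M₃ + (A * D + A * D)) * r := by
      calc Cφ * v T * (M₃ * stochasticRate v T + D * (1 / (T * v T) + v T))
          = Cφ * (v T * (M₃ * stochasticRate v T + D * (1 / (T * v T))) + D * v T ^ 2) := by ring
        _ ≤ Cφ * (1 * (M₃ * (A * r) + D * (A * r)) + D * (A * r)) := by
            have := hinv.trans hρr
            have := stochasticRate_nonneg v T
            gcongr
        _ = _ := by ring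
    have t3 : Cφ * L ^ 2 * v T ^ 2 * Q ≤ Cφ * L ^ 2 * A * Q * r := by
      calc _ ≤ Cφ * L ^ 2 * (A * r) * Q := by gcongr
        _ = _ := by ring
    calc _ ≤ A * M₂ * r + (Cφ * (A * M₃ + (A * D + A * D)) * r + Cφ * L ^ 2 * A * Q * r) +
          M₁ * r * (8 * D + 6 * Q) := by gcongr
      _ = _ := by ring
  · calc _ ≤ ENNReal.ofReal (ε / 6) + ENNReal.ofReal (ε / 6) + ENNReal.ofReal (ε / 6) +
          ENNReal.ofReal (ε / 6) + ENNReal.ofReal (ε / 6) + ENNReal.ofReal (ε / 6) := by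
          refine (measure_union_le _ _).trans (add_le_add ((measure_union_le _ _).trans
            (add_le_add ((measure_union_le _ _).trans (add_le_add ((measure_union_le _ _).trans
            (add_le_add ((measure_union_le _ _).trans (add_le_add e1 e2)) e3)) e4)) e5)) e6)
      _ = ENNReal.ofReal ε := by
          have h6 := hε6.le
          rw [← ENNReal.ofReal_add h6 h6, ← ENNReal.ofReal_add (by positivity) h6,
            ← ENNReal.ofReal_add (by positivity) h6, ← ENNReal.ofReal_add (by positivity) h6,
            ← ENNReal.ofReal_add (by positivity) h6]
          congr 1
          ring

end IsTimeVaryingARModel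

theorem theorem3 {Ω : Type*} [MeasurableSpace Ω] (P : Measure Ω) [IsProbabilityMeasure P]
    (g φ : ℝ → ℝ) (Y V e : ℕ → ℕ → Ω → ℝ) (K G : ℝ → ℝ) (h v b : ℕ → ℝ) (s β c_v : ℝ)
    (hmodel : IsTimeVaryingARModel P g φ Y V e)
    (hK : IsLipschitzKernel K) (hK' : IsRegularKernel K)
    (hG : IsLipschitzKernel G) (hG' : IsRegularKernel G)
    (hs : 2 < s) (hβ : (2 * s - 1) / (s - 2) < β)
    (hV : UniformMomentBound P s 1 V)
    (hg : ContDiffOn ℝ 2 g (Set.Icc 0 1)) (hφ : ContDiffOn ℝ 2 φ (Set.Icc 0 1))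
    (har : AutoregressiveConditions P φ e s)
    (hh : IsBandwidth (bandwidthExponent β s) h)
    (hv : IsBandwidth (bandwidthExponent β s) v)
    (hc : 0 < c_v) (hvh : Tendsto (fun T => v T / h T) atTop (𝓝 c_v))
    (hb : Tendsto b atTop (𝓝 0)) (hbv : Tendsto (fun T => b T / v T) atTop atTop) :
    (∃ (B : ℕ → ℝ) (R : ℕ → Ω → ℝ),
      B =O[atTop] (fun T => h T ^ 2) ∧
      IsBigOInProb P (fun T ω => ‖R T ω‖ₑ) (stochasticRate h) ∧
      ∀ᶠ T in atTop, ∀ ω,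
        ((supError (Set.Icc 0 1)
          (localLinearEstimator K (h T) T (fun t => Y T t ω)) g : ℝ≥0∞) : EReal)
          = ((B T + R T ω : ℝ) : EReal)) ∧
    (UniformMomentBound P s 2 (fun T t ω => V T t ω * V T (t - 1) ω) →
      UniformMomentBound P s 2 (fun T t ω => V T (t - 1) ω ^ 2) →
      IsBigOInProb P
        (fun T ω => supError (Set.Icc (b T) (1 - b T))
          (arEstimator K G (h T) (v T) T (fun t => Y T t ω)) φ)
        (fun T => h T ^ 2 + stochasticRate h T)) := by
  have hθ := bandwidthExponent_le hs hβ
  exact ⟨hmodel.localLinear_decomposition har hK hK' hg hh hs hθ hV, fun _ hV2 =>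
    hmodel.isBigOInProb_arEstimator har hK hK' hG hG' hg hφ hh hv hs hθ hc hvh hbv hV hV2⟩
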